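/- **Definitions.** Let $(M,g)$ be a smooth Riemannian manifold, $\alpha(y)=\sqrt{g(y,y)}$ for $y\in TM$, let $X$ be a smooth vector field on $M$ that does not vanish identically, and let $\beta(y)=g(X,y)$. A Finsler metric (a non-negative function on $TM$, smooth away from the zero section, positively homogeneous of degree one on each tangent space, and such that the fibrewise Hessian of $\tfrac12F^2$ is positive definite at each $y\ne0$) is a *Randers metric with underlying metric $g$* if it has the form $F=\alpha+\beta$, and a *Matsumoto metric with underlying metric $g$* if it has the form $F=\alpha^2/(\alpha-\beta)$, for such a $\beta\not\equiv0$. A Finsler metric $F$ is of *Berwald type* if in all natural local coordinates $(x,y)$ of $TM$ its spray coefficients $G^i=\tfrac14g^{il}\big([F^2]_{x^ky^l}y^k-[F^2]_{x^l}\big)$, where $g_{ij}=\tfrac12[F^2]_{y^iy^j}$, are quadratic in $y$: $G^i(x,y)=\tfrac12\Gamma^i_{jk}(x)y^jy^k$ for all $y\ne0$ (equivalently, the coefficients of its Chern connection do not depend on $y$). For a real $2\times2$ matrix $A$ let $\mathbb R^2\rtimes_A\mathbb R$ be the Lie group $\mathbb R^2\times\mathbb R$ with multiplication $(u,s)(v,t)=(u+e^{sA}v,\,s+t)$.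 Put $\tilde E_0(2)=\mathbb R^2\rtimes_A\mathbb R$ with $A=\begin{pmatrix}0&1\\-1&0\end{pmatrix}$ (the universal covering group of the group of proper rigid motions of the plane), and $G_c=\mathbb R^2\rtimes_A\mathbb R$ with $A=\begin{pmatrix}0&-c\\1&2\end{pmatrix}$, for $c\in\mathbb R$. **Theorem.** Let $G$ be a simply connected 3-dimensional real Lie group with Lie algebra $\mathfrak g$, and let $g$ be a left-invariant Riemannian metric on $G$. The following are equivalent: (a) $G$ admits a left-invariant Randers metric of Berwald type with underlying metric $g$; (b) $G$ admits a left-invariant Matsumoto metric of Berwald type with underlying metric $g$; (c) one of the following three cases holds: (i) $G\cong\mathbb R^3$ as a Lie group, and $\mathfrak g$ has a basis $x,y,z$ with $[x,y]=[x,z]=[y,z]=0$ in which $g$ has the identity matrix; (ii) $G\cong\tilde E_0(2)$ as a Lie group, and $\mathfrak g$ has a basis $x,y,z$ with $[x,y]=0$, $[x,z]=y$, $[y,z]=-x$ in which $g$ has the matrix $\begin{pmatrix}1&0&0\\0&1&0\\0&0&\nu\end{pmatrix}$ for some $\nu>0$; (iii) $G\cong G_c$ with $c=0$ as a Lie group,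 and $\mathfrak g$ has a basis $x,y,z$ with $[x,y]=0$, $[x,z]=-y$, $[y,z]=-2y$ in which $g$ has the matrix $\begin{pmatrix}1&\frac12&0\\\frac12&1&0\\0&0&\nu\end{pmatrix}$ for some $\nu>0$. In particular, $G$ admits a left-invariant Randers or Matsumoto metric of Berwald type with underlying metric $g$ if and only if (c) holds. -/

import Mathlib

open scoped Manifold ContDiff Matrix
open Bundle

noncomputable section

namespace LeftInvariantFinsler

/-! ### Finsler metrics and Berwald metrics -/

section Finsler

variable {E : Type*} [NormedAddCommGroup E] [NormedSpace ℝ E]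
  {M : Type*} [TopologicalSpace M] [ChartedSpace E M]

/-- The form `g_y(u, v) = (1/2) ∂²/∂s∂t F²(y + s u + t v)` at `s = t = 0`, on the tangent space of
`M` at `p`. -/
def fundamentalForm (F : TangentBundle 𝓘(ℝ, E) M → ℝ) (p : M)
    (y u v : TangentSpace 𝓘(ℝ, E) p) : ℝ :=
  (1 / 2 : ℝ) * deriv (fun s : ℝ =>
    deriv (fun t : ℝ => F ⟨p, y + s • u + t • v⟩ ^ 2) 0) 0

/-- `F : TM → ℝ` is a Finsler metric: it is non-negative, smooth on the slit tangent bundle,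
positively homogeneous of degree one on the fibres, and the fibrewise Hessian of `F²/2` is
positive definite at every non-zero tangent vector. -/
structure IsFinslerMetric [IsManifold 𝓘(ℝ, E) ∞ M] (F : TangentBundle 𝓘(ℝ, E) M → ℝ) :
    Prop where
  nonneg : ∀ v, 0 ≤ F v
  smooth : ContMDiffOn 𝓘(ℝ, E).tangent 𝓘(ℝ, ℝ) ∞ F {v | v.2 ≠ 0}
  homogeneous : ∀ (p : M) (y : TangentSpace 𝓘(ℝ, E) p) (c : ℝ), 0 < c →
    F ⟨p, c • y⟩ = c * F ⟨p, y⟩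
  posDef : ∀ (p : M) (y w : TangentSpace 𝓘(ℝ, E) p), y ≠ 0 → w ≠ 0 →
    0 < fundamentalForm F p y w w

/-- The function `F²` in the natural coordinates `(x, y)` of the tangent bundle which are induced
by a chart `φ`: the value of `F²` at the tangent vector `D(φ⁻¹)ₓ y` at the point `φ⁻¹(x)`. -/
def localEnergy (F : TangentBundle 𝓘(ℝ, E) M → ℝ) (φ : OpenPartialHomeomorph M E) (x y : E) : ℝ :=
  F ⟨φ.symm x, mfderiv 𝓘(ℝ, E) 𝓘(ℝ, E) φ.symm x y⟩ ^ 2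

/-- `S` is the vector `(Gⁱ(x, y))ᵢ` of geodesic (spray) coefficients
`Gⁱ = (1/4) gⁱˡ ([F²]_{xᵏ yˡ} yᵏ - [F²]_{xˡ})` at `(x, y)`, where `L = F²` in natural coordinates
and `g_{ij} = (1/2) [F²]_{yⁱ yʲ}`. The inverse matrix is avoided by moving `g` to the left-hand
side: `4 g_{il} Gⁱ vˡ = [F²]_{xᵏ yˡ} yᵏ vˡ - [F²]_{xˡ} vˡ` for all `v`; as `g` is positive
definite, this determines `S`. -/
def IsSprayCoefficient (L : E → E → ℝ) (x y S : E) : Prop :=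
  ∀ v : E,
    4 * ((1 / 2 : ℝ) * fderiv ℝ (fun y' => fderiv ℝ (L x) y' v) y S) =
      fderiv ℝ (fun x' => fderiv ℝ (L x') y v) x y - fderiv ℝ (fun x' => L x' y) x v

/-- `F` is of Berwald type: in natural coordinates over any chart of the smooth structure, the
spray coefficients are quadratic in `y`, that is `Gⁱ(x, y) = (1/2) Γⁱⱼₖ(x) yʲ yᵏ` for all `y ≠ 0`
(equivalently, the Chern connection coefficients do not depend on `y`). -/
def IsBerwald (F : TangentBundle 𝓘(ℝ, E) M → ℝ) : Prop :=
  ∀ φ ∈ IsManifold.maximalAtlas 𝓘(ℝ, E) ∞ M, ∀ x ∈ φ.target,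
    ∃ Γ : E →ₗ[ℝ] E →ₗ[ℝ] E, (∀ u v, Γ u v = Γ v u) ∧
      ∀ y : E, y ≠ 0 → IsSprayCoefficient (localEnergy F φ) x y ((1 / 2 : ℝ) • Γ y y)

/-! ### Randers and Matsumoto metrics -/

variable [IsManifold 𝓘(ℝ, E) ∞ M]

/-- Smooth Riemannian metrics on `M`. -/
abbrev RiemMetric (E : Type*) [NormedAddCommGroup E] [NormedSpace ℝ E]
    (M : Type*) [TopologicalSpace M] [ChartedSpace E M] [IsManifold 𝓘(ℝ, E) ∞ M] : Type _ :=
  ContMDiffRiemannianMetric 𝓘(ℝ, E) ∞ E (fun p : M => TangentSpace 𝓘(ℝ, E) p)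

/-- The Riemannian norm `α(p, y) = √g(y, y)`. -/
def alpha (g : RiemMetric E M) (v : TangentBundle 𝓘(ℝ, E) M) : ℝ :=
  Real.sqrt (g.inner v.1 v.2 v.2)

/-- `X` is a smooth vector field on `M` which is not identically zero. -/
def IsNonzeroVectorField (X : ∀ p : M, TangentSpace 𝓘(ℝ, E) p) : Prop :=
  ContMDiff 𝓘(ℝ, E) 𝓘(ℝ, E).tangent ∞ (fun p => (⟨p, X p⟩ : TangentBundle 𝓘(ℝ, E) M)) ∧
    ∃ p, X p ≠ 0

/-- `F` is a Randers metric `F = α + β` with underlying Riemannian metric `g`, where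
`β = g(X, ·)` for a vector field `X` that does not vanish identically. -/
def IsRandersMetric (g : RiemMetric E M) (F : TangentBundle 𝓘(ℝ, E) M → ℝ) : Prop :=
  IsFinslerMetric F ∧ ∃ X : ∀ p : M, TangentSpace 𝓘(ℝ, E) p, IsNonzeroVectorField X ∧
    ∀ v, F v = alpha g v + g.inner v.1 (X v.1) v.2

/-- `F` is a Matsumoto metric `F = α² / (α - β)` with underlying Riemannian metric `g`, where
`β = g(X, ·)` for a vector field `X` that does not vanish identically. -/
def IsMatsumotoMetric (g : RiemMetric E M) (F : TangentBundle 𝓘(ℝ, E) M → ℝ) : Prop :=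
  IsFinslerMetric F ∧ ∃ X : ∀ p : M, TangentSpace 𝓘(ℝ, E) p, IsNonzeroVectorField X ∧
    ∀ v, F v = alpha g v ^ 2 / (alpha g v - g.inner v.1 (X v.1) v.2)

end Finsler

/-! ### Left invariance -/

section LeftInvariance

variable {E : Type*} [NormedAddCommGroup E] [NormedSpace ℝ E]
  {G : Type*} [Group G] [TopologicalSpace G] [ChartedSpace E G]

/-- `F : TG → ℝ` is invariant under the differentials of all left translations. -/
def IsLeftInvariantFinsler (F : TangentBundle 𝓘(ℝ, E) G → ℝ) : Prop :=
  ∀ (a p : G) (y : TangentSpace 𝓘(ℝ, E) p),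
    F ⟨a * p, mfderiv 𝓘(ℝ, E) 𝓘(ℝ, E) (fun q : G => a * q) p y⟩ = F ⟨p, y⟩

/-- All left translations are isometries of `g`. -/
def IsLeftInvariantRiem [IsManifold 𝓘(ℝ, E) ∞ G] (g : RiemMetric E G) : Prop :=
  ∀ (a p : G) (y z : TangentSpace 𝓘(ℝ, E) p),
    g.inner (a * p) (mfderiv 𝓘(ℝ, E) 𝓘(ℝ, E) (fun q : G => a * q) p y)
      (mfderiv 𝓘(ℝ, E) 𝓘(ℝ, E) (fun q : G => a * q) p z) = g.inner p y z

/-- `G` admits a left invariant Randers metric of Berwald type with underlying metric `g`. -/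
def AdmitsBerwaldRanders [IsManifold 𝓘(ℝ, E) ∞ G] (g : RiemMetric E G) : Prop :=
  ∃ F : TangentBundle 𝓘(ℝ, E) G → ℝ,
    IsRandersMetric g F ∧ IsLeftInvariantFinsler F ∧ IsBerwald F

/-- `G` admits a left invariant Matsumoto metric of Berwald type with underlying metric `g`. -/
def AdmitsBerwaldMatsumoto [IsManifold 𝓘(ℝ, E) ∞ G] (g : RiemMetric E G) : Prop :=
  ∃ F : TangentBundle 𝓘(ℝ, E) G → ℝ,
    IsMatsumotoMetric g F ∧ IsLeftInvariantFinsler F ∧ IsBerwald F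

/-- The Lie algebra of `G` has a basis `x, y, z` with `[x, y] = 0`, `[x, z] = a x + b y`,
`[y, z] = c x + d y`, with respect to which the matrix of `g` is `Q`. -/
def HasBasis [IsManifold 𝓘(ℝ, E) ∞ G] (g : RiemMetric E G) (a b c d : ℝ)
    (Q : Matrix (Fin 3) (Fin 3) ℝ) : Prop :=
  ∃ e : Module.Basis (Fin 3) ℝ (GroupLieAlgebra 𝓘(ℝ, E) G),
    ⁅e 0, e 1⁆ = 0 ∧ ⁅e 0, e 2⁆ = a • e 0 + b • e 1 ∧ ⁅e 1, e 2⁆ = c • e 0 + d • e 1 ∧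
      ∀ i j, g.inner 1 (e i) (e j) = Q i j

end LeftInvariance

/-! ### The model groups -/

/-- The manifold `ℝ² × ℝ`, carrying the semidirect product group `ℝ² ⋊ ℝ` in which `t ∈ ℝ` acts on
`ℝ²` by `exp(tA)`. -/
def SemidirectPlane (_A : Matrix (Fin 2) (Fin 2) ℝ) : Type := (Fin 2 → ℝ) × ℝ

namespace SemidirectPlane

variable (A : Matrix (Fin 2) (Fin 2) ℝ)

instance : TopologicalSpace (SemidirectPlane A) :=
  inferInstanceAs (TopologicalSpace ((Fin 2 → ℝ) × ℝ))

instance : ChartedSpace ((Fin 2 → ℝ) × ℝ) (SemidirectPlane A) :=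
  inferInstanceAs (ChartedSpace ((Fin 2 → ℝ) × ℝ) ((Fin 2 → ℝ) × ℝ))

theorem exp_add_smul (s t : ℝ) : NormedSpace.exp ((s + t) • A) =
    NormedSpace.exp (s • A) * NormedSpace.exp (t • A) := by
  rw [add_smul]
  exact Matrix.exp_add_of_commute _ _ (((Commute.refl A).smul_left s).smul_right t)

instance : Mul (SemidirectPlane A) :=
  ⟨fun p q => (p.1 + NormedSpace.exp (p.2 • A) *ᵥ q.1, p.2 + q.2)⟩

instance : One (SemidirectPlane A) := ⟨((0 : Fin 2 → ℝ), (0 : ℝ))⟩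

instance : Inv (SemidirectPlane A) :=
  ⟨fun p => (-(NormedSpace.exp ((-p.2) • A) *ᵥ p.1), -p.2)⟩

instance : Group (SemidirectPlane A) :=
  Group.ofLeftAxioms
    (fun p q r => Prod.ext
      (show (p.1 + NormedSpace.exp (p.2 • A) *ᵥ q.1) + NormedSpace.exp ((p.2 + q.2) • A) *ᵥ r.1 =
          p.1 + NormedSpace.exp (p.2 • A) *ᵥ (q.1 + NormedSpace.exp (q.2 • A) *ᵥ r.1) by
        rw [exp_add_smul, Matrix.mulVec_add, Matrix.mulVec_mulVec, add_assoc])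
      (add_assoc p.2 q.2 r.2))
    (fun p => Prod.ext
      (show (0 : Fin 2 → ℝ) + NormedSpace.exp ((0 : ℝ) • A) *ᵥ p.1 = p.1 by
        rw [zero_smul, NormedSpace.exp_zero, Matrix.one_mulVec, zero_add])
      (zero_add p.2))
    (fun p => Prod.ext
      (show -(NormedSpace.exp ((-p.2) • A) *ᵥ p.1) + NormedSpace.exp ((-p.2) • A) *ᵥ p.1 = 0 from
        neg_add_cancel _)
      (neg_add_cancel p.2))

end SemidirectPlane

/-- `Ẽ₀(2)`, the universal covering group of the group of proper rigid motions of the plane: `ℝ` acts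
on `ℝ²` through rotations. With `x, y` the standard basis of `ℝ²` and `z = ∂/∂t`, its
Lie algebra has `[x, y] = 0`, `[x, z] = y`, `[y, z] = -x`. -/
abbrev E02 : Type := SemidirectPlane !![0, 1; -1, 0]

/-- `G_c`: with `x, y` the standard basis of `ℝ²` and `z = ∂/∂t`, its Lie algebra has
`[x, y] = 0`, `[x, z] = -y`, `[y, z] = c x - 2 y`. -/
abbrev GroupGc (c : ℝ) : Type := SemidirectPlane !![0, -c; 1, 2]

/-- `G` and `G'` are isomorphic as Lie groups. -/
def LieGroupIsomorphic (E : Type*) [NormedAddCommGroup E] [NormedSpace ℝ E]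
    (E' : Type*) [NormedAddCommGroup E'] [NormedSpace ℝ E']
    (G : Type*) [Group G] [TopologicalSpace G] [ChartedSpace E G]
    (G' : Type*) [Group G'] [TopologicalSpace G'] [ChartedSpace E' G'] : Prop :=
  ∃ Φ : G ≃* G', ContMDiff 𝓘(ℝ, E) 𝓘(ℝ, E') ∞ Φ ∧ ContMDiff 𝓘(ℝ, E') 𝓘(ℝ, E) ∞ Φ.symm

/-- `G` is isomorphic, as a Lie group, to the additive group of the vector space `E'`. -/
def IsomorphicToVectorGroup (E : Type*) [NormedAddCommGroup E] [NormedSpace ℝ E]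
    (E' : Type*) [NormedAddCommGroup E'] [NormedSpace ℝ E']
    (G : Type*) [Group G] [TopologicalSpace G] [ChartedSpace E G] : Prop :=
  ∃ Φ : G ≃* Multiplicative E',
    ContMDiff 𝓘(ℝ, E) 𝓘(ℝ, E') ∞ (fun p => (Φ p).toAdd) ∧
      ContMDiff 𝓘(ℝ, E') 𝓘(ℝ, E) ∞ (fun v => Φ.symm (Multiplicative.ofAdd v))

/-- The list of the classification: up to isomorphism, `G`, its Lie algebra and the matrix of `g`
with respect to a basis `x, y, z` are as in (i), (ii) or (iii). -/
def IsInList {G : Type*} [Group G] [TopologicalSpace G]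
    [ChartedSpace (EuclideanSpace ℝ (Fin 3)) G] [IsManifold (𝓡 3) ∞ G]
    (g : RiemMetric (EuclideanSpace ℝ (Fin 3)) G) : Prop :=
  (IsomorphicToVectorGroup (EuclideanSpace ℝ (Fin 3)) (EuclideanSpace ℝ (Fin 3)) G ∧
    HasBasis g 0 0 0 0 1) ∨
  (LieGroupIsomorphic (EuclideanSpace ℝ (Fin 3)) ((Fin 2 → ℝ) × ℝ) G E02 ∧
    ∃ ν : ℝ, 0 < ν ∧ HasBasis g 0 1 (-1) 0 !![1, 0, 0; 0, 1, 0; 0, 0, ν]) ∨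
  (LieGroupIsomorphic (EuclideanSpace ℝ (Fin 3)) ((Fin 2 → ℝ) × ℝ) G (GroupGc 0) ∧
    ∃ ν : ℝ, 0 < ν ∧ HasBasis g 0 (-1) 0 (-2) !![1, 1 / 2, 0; 1 / 2, 1, 0; 0, 0, ν])

end LeftInvariantFinsler

end

/-!
Why the classification holds. Let `g` be a left-invariant metric on `G` and `F = α + β` or
`F = α² / (α - β)` a left-invariant Finsler metric, with `β = g(X, ·)`.

*Berwald metrics and the Lie algebra.* For a function that is homogeneous of degree two, the spray
coefficients at `x` are `Γ(y, y) / 2` if and only if the function is constant along the horizontal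
vectors `(w, -Γ(y, w))` (`isSprayCoefficient_iff_isHorizontallyConstant`, from Euler's relation).
In the frame of left-invariant vector fields a left-invariant `F` has constant coefficients, so that
`F` is of Berwald type if and only if there is a product `Ω` on the Lie algebra with
`Ω(a, b) - Ω(b, a) = [a, b]` for which `Ω(a, b)` is tangent at `b` to the level set of `F`
(`isBerwald_iff`). Comparing the tangency conditions at `b` and `-b` separates `α` from `β`, so `Ω`
is compatible with the scalar product and with `X`: the field `X` is parallel, that is, `X` is
orthogonal to all brackets and `ad X` is skew-symmetric (`IsParallelVector`). Conversely, given such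
an `X`, the Levi-Civita product of the Koszul formula is a suitable `Ω` for the Randers and the
Matsumoto metric of a small multiple of `X`, which are Finsler metrics
(`IsParallelVector.admitsBerwaldRanders`, `IsParallelVector.admitsBerwaldMatsumoto`).

*Algebra.* In dimension three the plane orthogonal to `X` is an ideal on which `ad X` acts by a
multiple of a rotation by a right angle. By the Jacobi identity this action or the bracket of the
plane vanishes; normalizing a basis gives exactly the three families of metric Lie algebras
(`exists_frame_of_parallel`). In each of them a parallel vector can be written down
(`HasBasis.exists_isParallelVector`).

*From the Lie algebra to the group.* In all three cases the Lie algebra has a basis with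
`[e₀, e₁] = 0` for which `ad e₂` maps the span of `e₀` and `e₁` to itself, by a matrix `A`. As the
derivative of `Ad` is `ad` (`hasDerivAt_adj`), `Ad` of the one-parameter subgroup of `e₂` is
`exp(sA)` on this plane (`IsOneParameterSubgroup.adj_planeMap`), and therefore
`(u, s) ↦ exp(u₀ e₀) exp(u₁ e₁) exp(s e₂)` is a homomorphism from the semidirect product `ℝ² ⋊_A ℝ`
to `G` (`exists_hom_of_bracketOne`). Its derivative at `1` is invertible, so it is a covering map,
and an isomorphism because `G` is simply connected (`lieGroupIsomorphic_of_hasFDerivAt`).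
-/

noncomputable section

namespace LeftInvariantFinsler

/-! ### Spray equations and horizontal derivatives -/

section Spray

variable {E : Type*} [NormedAddCommGroup E] [NormedSpace ℝ E]

/-- `L (x, y)` has vanishing derivative along all horizontal vectors `(w, -Γ(y, w))` at the point
`x`, for the linear connection with Christoffel symbols `Γ` at `x`. -/
def IsHorizontallyConstant (L : E → E → ℝ) (x : E) (Γ : E →ₗ[ℝ] E →ₗ[ℝ] E) : Prop :=
  ∀ y : E, y ≠ 0 → ∀ w : E, fderiv ℝ (Function.uncurry L) (x, y) (w, -Γ y w) = 0

variable {L : E → E → ℝ} {U : Set E} {x y : E}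

lemma contDiffAt_uncurry_of_mem (hU : IsOpen U)
    (hL : ContDiffOn ℝ 2 (Function.uncurry L) (U ×ˢ {0}ᶜ)) (hx : x ∈ U) (hy : y ≠ 0) :
    ContDiffAt ℝ 2 (Function.uncurry L) (x, y) :=
  hL.contDiffAt ((hU.prod isOpen_compl_singleton).mem_nhds ⟨hx, hy⟩)

lemma differentiableAt_fderiv_uncurry (hL : ContDiffAt ℝ 2 (Function.uncurry L) (x, y)) :
    DifferentiableAt ℝ (fderiv ℝ (Function.uncurry L)) (x, y) :=
  (hL.fderiv_right (m := 1) (by norm_num)).differentiableAt (by norm_num)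

lemma fderiv_right_eq (hL : DifferentiableAt ℝ (Function.uncurry L) (x, y)) (v : E) :
    fderiv ℝ (L x) y v = fderiv ℝ (Function.uncurry L) (x, y) (0, v) := by
  have h := hL.hasFDerivAt.comp y (hasFDerivAt_prodMk_right x y)
  have : fderiv ℝ (L x) y = _ := h.fderiv
  rw [this]; simp

lemma fderiv_left_eq (hL : DifferentiableAt ℝ (Function.uncurry L) (x, y)) (v : E) :
    fderiv ℝ (fun x' => L x' y) x v = fderiv ℝ (Function.uncurry L) (x, y) (v, 0) := by
  have h := HasFDerivAt.comp (f := fun x' => (x', y)) x hL.hasFDerivAt (hasFDerivAt_prodMk_left x y)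
  have : fderiv ℝ (fun x' => L x' y) x = _ := h.fderiv
  rw [this]; simp

/-- The spray equation in terms of the first and second derivatives of `L` on the product. -/
lemma isSprayCoefficient_iff (hU : IsOpen U)
    (hL : ContDiffOn ℝ 2 (Function.uncurry L) (U ×ˢ {0}ᶜ)) (hx : x ∈ U) (hy : y ≠ 0) (S : E) :
    IsSprayCoefficient L x y S ↔ ∀ v : E,
      2 * fderiv ℝ (fderiv ℝ (Function.uncurry L)) (x, y) (0, S) (0, v) =
        fderiv ℝ (fderiv ℝ (Function.uncurry L)) (x, y) (y, 0) (0, v) -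
          fderiv ℝ (Function.uncurry L) (x, y) (v, 0) := by
  have hd : ∀ x' ∈ U, ∀ y' : E, y' ≠ 0 → DifferentiableAt ℝ (Function.uncurry L) (x', y') :=
    fun x' hx' y' hy' => (contDiffAt_uncurry_of_mem hU hL hx' hy').differentiableAt (by norm_num)
  have h2 := (differentiableAt_fderiv_uncurry (contDiffAt_uncurry_of_mem hU hL hx hy)).hasFDerivAt
  refine forall_congr' fun v => ?_
  have e1 : fderiv ℝ (fun y' => fderiv ℝ (L x) y' v) y S =
      fderiv ℝ (fderiv ℝ (Function.uncurry L)) (x, y) (0, S) (0, v) := by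
    have h3 := (h2.comp y (hasFDerivAt_prodMk_right x y)).clm_apply
      (hasFDerivAt_const ((0 : E), v) y)
    have h4 : (fun y' => fderiv ℝ (L x) y' v) =ᶠ[nhds y]
        fun y' => (fderiv ℝ (Function.uncurry L) ∘ Prod.mk x) y' (0, v) := by
      filter_upwards [isOpen_compl_singleton.mem_nhds hy] with y' hy'
      exact fderiv_right_eq (hd x hx y' hy') v
    rw [h4.fderiv_eq, h3.fderiv]; simp
  have e2 : fderiv ℝ (fun x' => fderiv ℝ (L x') y v) x y =
      fderiv ℝ (fderiv ℝ (Function.uncurry L)) (x, y) (y, 0) (0, v) := by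
    have h3 := (HasFDerivAt.comp (f := fun x' => (x', y)) x h2
      (hasFDerivAt_prodMk_left x y)).clm_apply (hasFDerivAt_const ((0 : E), v) x)
    have h4 : (fun x' => fderiv ℝ (L x') y v) =ᶠ[nhds x]
        fun x' => (fderiv ℝ (Function.uncurry L) ∘ fun x' => (x', y)) x' (0, v) := by
      filter_upwards [hU.mem_nhds hx] with x' hx'
      exact fderiv_right_eq (hd x' hx' y hy) v
    rw [h4.fderiv_eq, h3.fderiv]; simp
  rw [e1, e2, fderiv_left_eq (hd x hx y hy)]
  constructor <;> intro h <;> linarith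

variable [FiniteDimensional ℝ E]

/-- A bilinear map on a finite-dimensional space, as a continuous bilinear map. -/
def toContBilin {V : Type*} [NormedAddCommGroup V] [NormedSpace ℝ V] (Γ : E →ₗ[ℝ] E →ₗ[ℝ] V) :
    E →L[ℝ] E →L[ℝ] V :=
  LinearMap.toContinuousLinearMap (LinearMap.toContinuousLinearMap.toLinearMap ∘ₗ Γ)

@[simp] lemma toContBilin_apply {V : Type*} [NormedAddCommGroup V] [NormedSpace ℝ V]
    (Γ : E →ₗ[ℝ] E →ₗ[ℝ] V) (u v : E) : toContBilin Γ u v = Γ u v := rfl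

/-- For a function that is homogeneous of degree two in `y`, the vectors `Γ(y, y) / 2` are the
spray coefficients at `x` if and only if the function is constant along the horizontal
directions of the connection `Γ`. -/
theorem isSprayCoefficient_iff_isHorizontallyConstant (hU : IsOpen U)
    (hL : ContDiffOn ℝ 2 (Function.uncurry L) (U ×ˢ {0}ᶜ)) (hx : x ∈ U)
    (hom : ∀ x ∈ U, ∀ y : E, ∀ c : ℝ, 0 < c → L x (c • y) = c ^ 2 * L x y)
    (Γ : E →ₗ[ℝ] E →ₗ[ℝ] E) (hΓ : ∀ u v, Γ u v = Γ v u) :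
    (∀ y : E, y ≠ 0 → IsSprayCoefficient L x y ((1 / 2 : ℝ) • Γ y y)) ↔
      IsHorizontallyConstant L x Γ := by
  set f := Function.uncurry L with hf
  have hc : ∀ y : E, y ≠ 0 → ContDiffAt ℝ 2 f (x, y) := fun y hy =>
    contDiffAt_uncurry_of_mem hU hL hx hy
  have h2 : ∀ y : E, y ≠ 0 → HasFDerivAt (fderiv ℝ f) (fderiv ℝ (fderiv ℝ f) (x, y)) (x, y) :=
    fun y hy => (differentiableAt_fderiv_uncurry (hc y hy)).hasFDerivAt
  have hsymm : ∀ y : E, y ≠ 0 → ∀ a b, fderiv ℝ (fderiv ℝ f) (x, y) a b =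
      fderiv ℝ (fderiv ℝ f) (x, y) b a := fun y hy a b =>
    ((hc y hy).isSymmSndFDerivAt (by simp)).eq a b
  -- derivative in the direction `(0, v)` of a horizontal derivative with variable direction
  have key : ∀ y : E, y ≠ 0 → ∀ (c : E → E × E) (c' : E →L[ℝ] E × E), HasFDerivAt c c' y →
      (∀ y : E, y ≠ 0 → fderiv ℝ f (x, y) (c y) = 0) → ∀ v,
        fderiv ℝ (fderiv ℝ f) (x, y) (0, v) (c y) + fderiv ℝ f (x, y) (c' v) = 0 := by
    intro y hy c c' hcc h0 v
    have h3 := ((h2 y hy).comp y (hasFDerivAt_prodMk_right x y)).clm_apply hcc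
    have h4 : (fun y' => (fderiv ℝ f ∘ Prod.mk x) y' (c y')) =ᶠ[nhds y] fun _ => 0 := by
      filter_upwards [isOpen_compl_singleton.mem_nhds hy] with y' hy'
      exact h0 y' hy'
    have h5 := h3.unique ((hasFDerivAt_const (0 : ℝ) y).congr_of_eventuallyEq h4)
    have h6 := congrArg (fun T : E →L[ℝ] ℝ => T v) h5
    simp only [Function.comp_apply] at h6
    simpa [add_comm] using h6
  have split : ∀ y, ∀ a b : E, fderiv ℝ f (x, y) (a, b) =
      fderiv ℝ f (x, y) (a, 0) + fderiv ℝ f (x, y) (0, b) := fun y a b => by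
    rw [← map_add]; simp
  have hspray : ∀ y : E, y ≠ 0 → (IsSprayCoefficient L x y ((1 / 2 : ℝ) • Γ y y) ↔ ∀ v : E,
      fderiv ℝ (fderiv ℝ f) (x, y) (0, Γ y y) (0, v) =
        fderiv ℝ (fderiv ℝ f) (x, y) (y, 0) (0, v) - fderiv ℝ f (x, y) (v, 0)) := by
    intro y hy
    rw [isSprayCoefficient_iff hU hL hx hy]
    refine forall_congr' fun v => ?_
    have : ((0 : E), (1 / 2 : ℝ) • Γ y y) = (1 / 2 : ℝ) • ((0 : E), Γ y y) := by simp
    rw [this, map_smul, _root_.smul_apply, smul_eq_mul, ← mul_assoc]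
    norm_num [hf]
  constructor
  · intro h
    -- Euler's relation for the function `L`, and its derivative
    have euler : ∀ x' ∈ U, ∀ y' : E, y' ≠ 0 →
        fderiv ℝ f (x', y') (0, y') = 2 * f (x', y') := by
      intro x' hx' y' hy'
      have hd := (contDiffAt_uncurry_of_mem hU hL hx' hy').differentiableAt (by norm_num)
      have hcurve : HasDerivAt (fun t : ℝ => (x', t • y')) ((0 : E), y') 1 := by
        have := (hasDerivAt_const (1 : ℝ) x').prodMk ((hasDerivAt_id (1 : ℝ)).smul_const y')
        simpa using this
      have h1 : HasFDerivAt f (fderiv ℝ f (x', y')) (x', (1 : ℝ) • y') := by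
        rw [one_smul]; exact hd.hasFDerivAt
      have h3 := h1.comp_hasDerivAt (1 : ℝ) hcurve
      have h4 : HasDerivAt (fun t : ℝ => t ^ 2 * f (x', y')) (2 * f (x', y')) 1 := by
        have := (hasDerivAt_pow 2 (1 : ℝ)).mul_const (f (x', y'))
        simpa using this
      refine h3.unique (h4.congr_of_eventuallyEq ?_)
      filter_upwards [lt_mem_nhds (zero_lt_one' ℝ)] with t ht
      exact hom x' hx' y' t ht
    have euler' : ∀ y : E, y ≠ 0 → ∀ a : E × E, fderiv ℝ (fderiv ℝ f) (x, y) a (0, y) +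
        fderiv ℝ f (x, y) (0, a.2) = 2 * fderiv ℝ f (x, y) a := by
      intro y hy a
      have h3 := (h2 y hy).clm_apply
        (((hasFDerivAt_const (0 : E) (x, y)).prodMk (hasFDerivAt_snd (𝕜 := ℝ) (p := (x, y)))))
      have h4 : HasFDerivAt (fun p => 2 * f p) ((2 : ℝ) • fderiv ℝ f (x, y)) (x, y) :=
        ((hc y hy).differentiableAt (by norm_num)).hasFDerivAt.const_mul 2
      have h5 : (fun p : E × E => fderiv ℝ f p ((0 : E), p.2)) =ᶠ[nhds (x, y)]
          fun p => 2 * f p := by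
        filter_upwards [(hU.prod isOpen_compl_singleton).mem_nhds
          (show (x, y) ∈ U ×ˢ {0}ᶜ from ⟨hx, hy⟩)] with p hp
        exact euler p.1 hp.1 p.2 hp.2
      have h6 := congrArg (fun T : E × E →L[ℝ] ℝ => T a)
        (h3.unique (h4.congr_of_eventuallyEq h5))
      simpa [add_comm] using h6
    -- the derivative of `L` along the spray vanishes
    have hS : ∀ y : E, y ≠ 0 → fderiv ℝ f (x, y) (y, -Γ y y) = 0 := by
      intro y hy
      have h1 := (hspray y hy).1 (h y hy) y
      have h3 := euler' y hy (0, Γ y y)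
      have h4 := euler' y hy (y, 0)
      have h5 : fderiv ℝ f (x, y) (0, -Γ y y) = -fderiv ℝ f (x, y) (0, Γ y y) := by
        rw [← map_neg (fderiv ℝ f (x, y)), Prod.neg_mk, neg_zero]
      have h6 : fderiv ℝ f (x, y) ((0 : E), (0 : E)) = 0 := map_zero _
      rw [split y y, h5]
      simp only at h3 h4
      rw [h6] at h4
      linarith
    intro y hy v
    let B := toContBilin Γ
    have hB : HasFDerivAt (fun y' : E => (y', -B y' y'))
        ((ContinuousLinearMap.id ℝ E).prod (-(B y + B.flip y))) y := by
      refine (hasFDerivAt_id y).prodMk ?_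
      refine HasFDerivAt.neg ?_
      have := B.hasFDerivAt (x := y) |>.clm_apply (hasFDerivAt_id y)
      exact this
    have h1 := key y hy _ _ hB hS v
    have h3 := (hspray y hy).1 (h y hy) v
    have e1 : B y y = Γ y y := rfl
    have e2 : (((ContinuousLinearMap.id ℝ E).prod (-(B y + B.flip y))) v) =
        (v, -((2 : ℝ) • Γ y v)) := by
      have : (B.flip y) v = Γ y v := hΓ v y
      have h' : B y v = Γ y v := rfl
      simp [this, h', two_smul]
    rw [e2, e1, split, hsymm y hy] at h1
    have e3 : fderiv ℝ (fderiv ℝ f) (x, y) (y, -Γ y y) (0, v) =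
        fderiv ℝ (fderiv ℝ f) (x, y) (y, 0) (0, v) -
          fderiv ℝ (fderiv ℝ f) (x, y) (0, Γ y y) (0, v) := by
      rw [← _root_.sub_apply, ← map_sub]; simp
    have e4 : fderiv ℝ f (x, y) (0, -((2 : ℝ) • Γ y v)) =
        2 * fderiv ℝ f (x, y) (0, -Γ y v) := by
      rw [← smul_eq_mul, ← map_smul (fderiv ℝ f (x, y)), Prod.smul_mk, smul_zero, smul_neg]
    rw [split]
    rw [e3, e4] at h1
    linarith
  · intro h y hy
    rw [hspray y hy]
    intro v
    let B := toContBilin Γ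
    have hB : HasFDerivAt (fun y' : E => (y, -B y' y))
        ((0 : E →L[ℝ] E).prod (-(B.flip y))) y := by
      refine (hasFDerivAt_const y y).prodMk ?_
      refine HasFDerivAt.neg ?_
      exact (B.flip y).hasFDerivAt
    have h1 := key y hy _ _ hB (fun y' hy' => h y' hy' y) v
    have h3 := h y hy v
    rw [split] at h3
    have e1 : B y y = Γ y y := rfl
    have e2 : (((0 : E →L[ℝ] E).prod (-(B.flip y))) v) = ((0 : E), -Γ y v) := by
      have : (B.flip y) v = Γ y v := hΓ v y
      simp [this]
    rw [e2, e1, hsymm y hy] at h1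
    have e3 : fderiv ℝ (fderiv ℝ f) (x, y) (y, -Γ y y) (0, v) =
        fderiv ℝ (fderiv ℝ f) (x, y) (y, 0) (0, v) -
          fderiv ℝ (fderiv ℝ f) (x, y) (0, Γ y y) (0, v) := by
      rw [← _root_.sub_apply, ← map_sub]; simp
    rw [e3] at h1
    linarith

end Spray

/-! ### Functions on the tangent bundle that are constant in a moving frame -/

section Frame

variable {E : Type*} [NormedAddCommGroup E] [NormedSpace ℝ E] [FiniteDimensional ℝ E]

lemma contDiffAt_clm_inverse {Y : E → E →L[ℝ] E} {x : E} (hY : ContDiffAt ℝ 2 Y x)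
    (hi : (Y x).IsInvertible) : ContDiffAt ℝ 2 (fun x => (Y x).inverse) x := by
  obtain ⟨e, he⟩ := hi
  have h := contDiffAt_map_inverse (n := 2) (𝕜 := ℝ) e
  rw [he] at h
  exact h.comp x hY

/-- The Maurer–Cartan equation: if the frame `Y` has structure constants `br` at `x`, then the
exterior derivative of the inverse coframe `θ` satisfies `dθ(w, y) = -br (θ w) (θ y)` at `x`. -/
lemma fderiv_inverse_frame_sub {Y : E → E →L[ℝ] E} {U : Set E} {x : E} (hU : IsOpen U)
    (hx : x ∈ U) (hY : ContDiffOn ℝ 2 Y U) (hi : ∀ x ∈ U, (Y x).IsInvertible) {br : E → E → E}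
    (hbr : ∀ a b, VectorField.lieBracket ℝ (fun x => Y x a) (fun x => Y x b) x = Y x (br a b))
    (w y : E) :
    fderiv ℝ (fun x => (Y x).inverse) x w y - fderiv ℝ (fun x => (Y x).inverse) x y w =
      -br ((Y x).inverse w) ((Y x).inverse y) := by
  have hYx := hY.contDiffAt (hU.mem_nhds hx)
  have hY' : HasFDerivAt Y (fderiv ℝ Y x) x :=
    (hYx.differentiableAt (by norm_num)).hasFDerivAt
  have hT' : HasFDerivAt (fun x => (Y x).inverse) (fderiv ℝ (fun x => (Y x).inverse) x) x :=
    ((contDiffAt_clm_inverse hYx (hi x hx)).differentiableAt (by norm_num)).hasFDerivAt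
  have hYa : ∀ a, HasFDerivAt (fun x => Y x a) ((fderiv ℝ Y x).flip a) x := fun a => by
    simpa using hY'.clm_apply (hasFDerivAt_const a x)
  -- differentiate `θ (Y a) = a`
  have key : ∀ a w, fderiv ℝ (fun x => (Y x).inverse) x w (Y x a) +
      (Y x).inverse (fderiv ℝ Y x w a) = 0 := by
    intro a w
    have h1 := hT'.clm_apply (hYa a)
    have h2 : (fun x => (Y x).inverse (Y x a)) =ᶠ[nhds x] fun _ => a := by
      filter_upwards [hU.mem_nhds hx] with x' hx'
      exact (hi x' hx').inverse_apply_eq.2 rfl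
    have h3 := h1.unique ((hasFDerivAt_const a x).congr_of_eventuallyEq h2)
    have h4 := congrArg (fun T : E →L[ℝ] E => T w) h3
    simpa [add_comm] using h4
  have hYT : ∀ y, Y x ((Y x).inverse y) = y := fun y => by
    obtain ⟨e, he⟩ := hi x hx
    rw [← he]; simp
  have hTY : ∀ a, (Y x).inverse (Y x a) = a := fun a => (hi x hx).inverse_apply_eq.2 rfl
  have h1 := key ((Y x).inverse y) w
  have h2 := key ((Y x).inverse w) y
  have h3 := hbr ((Y x).inverse w) ((Y x).inverse y)
  rw [VectorField.lieBracket_eq] at h3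
  beta_reduce at h3
  rw [(hYa _).fderiv, (hYa _).fderiv] at h3
  simp only [ContinuousLinearMap.flip_apply, hYT] at h1 h2 h3
  have h4 := congrArg (Y x).inverse h3
  rw [hTY, map_sub] at h4
  rw [← h4, eq_neg_of_add_eq_zero_left h1, eq_neg_of_add_eq_zero_left h2]
  abel

/-- For a function on the tangent bundle which has the constant expression `ℓ` in a moving frame
`Y`, a symmetric connection at a point whose spray is that of the function amounts to a bilinear
map `Ω` whose torsion is given by the structure constants of the frame and whose values
`Ω a b` are tangent to the level sets of `ℓ` at `b`. -/
theorem exists_isSprayCoefficient_iff {Y : E → E →L[ℝ] E} {U : Set E} {x : E} (hU : IsOpen U)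
    (hx : x ∈ U) (hY : ContDiffOn ℝ 2 Y U) (hi : ∀ x ∈ U, (Y x).IsInvertible) {br : E → E → E}
    (hbr : ∀ a b, VectorField.lieBracket ℝ (fun x => Y x a) (fun x => Y x b) x = Y x (br a b))
    {ℓ : E → ℝ} (hℓ : ContDiffOn ℝ 2 ℓ {0}ᶜ) (hom : ∀ a : E, ∀ c : ℝ, 0 < c →
      ℓ (c • a) = c ^ 2 * ℓ a) {L : E → E → ℝ}
    (hL : ∀ x ∈ U, ∀ y, L x y = ℓ ((Y x).inverse y)) :
    (∃ Γ : E →ₗ[ℝ] E →ₗ[ℝ] E, (∀ u v, Γ u v = Γ v u) ∧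
      ∀ y : E, y ≠ 0 → IsSprayCoefficient L x y ((1 / 2 : ℝ) • Γ y y)) ↔
    ∃ Ω : E →ₗ[ℝ] E →ₗ[ℝ] E, (∀ a b, Ω a b - Ω b a = br a b) ∧
      ∀ b, b ≠ 0 → ∀ a, fderiv ℝ ℓ b (Ω a b) = 0 := by
  have hYT : ∀ x ∈ U, ∀ y, Y x ((Y x).inverse y) = y := fun x hx y => by
    obtain ⟨e, he⟩ := hi x hx
    rw [← he]; simp
  have hTY : ∀ x ∈ U, ∀ a, (Y x).inverse (Y x a) = a :=
    fun x hx a => (hi x hx).inverse_apply_eq.2 rfl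
  have hT0 : ∀ x ∈ U, ∀ y, y ≠ 0 → (Y x).inverse y ≠ 0 := fun x hx y hy h => hy <| by
    rw [← hYT x hx y, h, map_zero]
  have hTC : ∀ x ∈ U, ContDiffAt ℝ 2 (fun x => (Y x).inverse) x := fun x hx =>
    contDiffAt_clm_inverse (hY.contDiffAt (hU.mem_nhds hx)) (hi x hx)
  have hℓd : ∀ b : E, b ≠ 0 → ContDiffAt ℝ 2 ℓ b := fun b hb =>
    hℓ.contDiffAt (isOpen_compl_singleton.mem_nhds hb)
  have hev : ∀ x ∈ U, ∀ y, Function.uncurry L =ᶠ[nhds (x, y)]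
      fun p => ℓ ((Y p.1).inverse p.2) := fun x hx y => by
    filter_upwards [(hU.preimage continuous_fst).mem_nhds
      (show (x, y) ∈ Prod.fst ⁻¹' U from hx)] with p hp
    exact hL p.1 hp p.2
  have hLC : ContDiffOn ℝ 2 (Function.uncurry L) (U ×ˢ {0}ᶜ) := by
    rintro ⟨x, y⟩ ⟨hx, hy⟩
    refine ContDiffAt.contDiffWithinAt (ContDiffAt.congr_of_eventuallyEq ?_ (hev x hx y))
    refine ContDiffAt.comp (g := ℓ) (x, y) (hℓd _ (hT0 x hx y hy)) ?_
    exact ((hTC x hx).comp (x, y) contDiffAt_fst).clm_apply contDiffAt_snd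
  have hLhom : ∀ x ∈ U, ∀ y : E, ∀ c : ℝ, 0 < c → L x (c • y) = c ^ 2 * L x y := by
    intro x hx y c hc
    rw [hL x hx, hL x hx, map_smul, hom _ _ hc]
  set T := (Y x).inverse with hT
  set T' := fderiv ℝ (fun x => (Y x).inverse) x with hT'
  have hMC := fderiv_inverse_frame_sub hU hx hY hi hbr
  have hder : ∀ y, y ≠ 0 → ∀ w z, fderiv ℝ (Function.uncurry L) (x, y) (w, z) =
      fderiv ℝ ℓ (T y) (T z + T' w y) := by
    intro y hy w z
    rw [(hev x hx y).fderiv_eq]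
    have h1 : HasFDerivAt (fun p : E × E => (Y p.1).inverse p.2) _ (x, y) :=
      (HasFDerivAt.comp (f := Prod.fst) (x, y)
        ((hTC x hx).differentiableAt (by norm_num)).hasFDerivAt hasFDerivAt_fst).clm_apply
        hasFDerivAt_snd
    have h2 := HasFDerivAt.comp (x, y)
      ((hℓd _ (hT0 x hx y hy)).differentiableAt (by norm_num)).hasFDerivAt h1
    have h3 : fderiv ℝ (fun p : E × E => ℓ ((Y p.1).inverse p.2)) (x, y) = _ := h2.fderiv
    rw [h3]
    simp [hT, hT']
  constructor
  · rintro ⟨Γ, hΓ, hS⟩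
    have hH := (isSprayCoefficient_iff_isHorizontallyConstant hU hLC hx hLhom Γ hΓ).1 hS
    -- `Ω a b` consists of the components of the covariant derivative of `Y b` along `Y a`
    let Ω : E →ₗ[ℝ] E →ₗ[ℝ] E := LinearMap.mk₂ ℝ
      (fun a b => T (Γ (Y x b) (Y x a)) - T' (Y x a) (Y x b))
      (fun a a' b => by simp only [map_add, _root_.add_apply]; abel)
      (fun c a b => by simp only [map_smul, _root_.smul_apply, smul_sub])
      (fun a b b' => by simp only [map_add, LinearMap.add_apply]; abel)
      (fun c a b => by simp only [map_smul, LinearMap.smul_apply, smul_sub])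
    have hΩ : ∀ a b, Ω a b = T (Γ (Y x b) (Y x a)) - T' (Y x a) (Y x b) := fun a b => rfl
    refine ⟨Ω, fun a b => ?_, fun b hb a => ?_⟩
    · have := hMC (Y x a) (Y x b)
      rw [hTY x hx, hTY x hx] at this
      rw [hΩ, hΩ, hΓ (Y x a), sub_sub_sub_cancel_left, ← neg_sub, this, neg_neg]
    · have hy : Y x b ≠ 0 := fun h => hb <| by rw [← hTY x hx b, h, map_zero]
      have h1 := hH (Y x b) hy (Y x a)
      rw [hder _ hy, hT, hTY x hx, ← hT] at h1
      rw [hΩ, ← neg_eq_zero, ← map_neg, ← h1]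
      congr 1
      simp only [map_neg]
      abel
  · rintro ⟨Ω, hΩt, hΩ⟩
    -- the connection for which `Ω` is the covariant derivative of the frame; by the Maurer–Cartan
    -- equation it is symmetric
    let Γ : E →ₗ[ℝ] E →ₗ[ℝ] E := LinearMap.mk₂ ℝ
      (fun u v => Y x (Ω (T v) (T u) + T' v u))
      (fun a a' b => by simp only [map_add]; abel)
      (fun c a b => by simp only [map_smul, map_add, smul_add])
      (fun a b b' => by simp only [map_add, _root_.add_apply, LinearMap.add_apply]; abel)
      (fun c a b => by
        simp only [map_smul, map_add, _root_.smul_apply, LinearMap.smul_apply, smul_add])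
    have hΓdef : ∀ u v, Γ u v = Y x (Ω (T v) (T u) + T' v u) := fun u v => rfl
    have hΓ : ∀ u v, Γ u v = Γ v u := fun u v => by
      rw [hΓdef, hΓdef]
      congr 1
      have h1 := hMC u v
      have h2 := hΩt (T u) (T v)
      rw [← h2] at h1
      rw [← sub_eq_zero]
      have h3 : T' v u - T' u v = Ω (T u) (T v) - Ω (T v) (T u) := by
        rw [← neg_sub, h1, neg_neg]
      calc Ω (T v) (T u) + T' v u - (Ω (T u) (T v) + T' u v)
          = (T' v u - T' u v) - (Ω (T u) (T v) - Ω (T v) (T u)) := by abel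
        _ = 0 := by rw [h3, sub_self]
    refine ⟨Γ, hΓ, ?_⟩
    rw [isSprayCoefficient_iff_isHorizontallyConstant hU hLC hx hLhom Γ hΓ]
    intro y hy w
    rw [hder y hy, hΓdef, ← neg_eq_zero, ← map_neg, ← hΩ (T y) (hT0 x hx y hy) (T w)]
    congr 1
    rw [map_neg, hT, hTY x hx]
    abel

end Frame

/-! ### Restriction of a Finsler metric to a fibre -/

section Fibre

variable {E : Type*} [NormedAddCommGroup E] [NormedSpace ℝ E]
  {M : Type*} [TopologicalSpace M] [ChartedSpace E M] [IsManifold 𝓘(ℝ, E) ∞ M]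

lemma contMDiff_fiber_inclusion (p : M) :
    ContMDiff 𝓘(ℝ, E) 𝓘(ℝ, E).tangent ∞
      (fun y : E => (⟨p, y⟩ : TangentBundle 𝓘(ℝ, E) M)) := by
  intro y
  rw [contMDiffAt_totalSpace]
  refine ⟨contMDiffAt_const, ?_⟩
  have h : ∀ y : TangentSpace 𝓘(ℝ, E) p, (trivializationAt E (TangentSpace 𝓘(ℝ, E)) p
      (⟨p, y⟩ : TangentBundle 𝓘(ℝ, E) M)).2 =
      (trivializationAt E (TangentSpace 𝓘(ℝ, E)) p).continuousLinearMapAt ℝ p y := fun y => by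
    rw [Bundle.Trivialization.continuousLinearMapAt_apply, Bundle.Trivialization.linearMapAt_apply,
      if_pos (FiberBundle.mem_baseSet_trivializationAt' p)]
  let D : E →L[ℝ] E := (trivializationAt E (TangentSpace 𝓘(ℝ, E)) p).continuousLinearMapAt ℝ p
  exact D.contMDiff.contMDiffAt.congr_of_eventuallyEq (Filter.Eventually.of_forall h)

lemma IsFinslerMetric.contDiffOn_fiber (hF : IsFinslerMetric F)
    (p : M) : ContDiffOn ℝ ∞ (fun y : E => F ⟨p, y⟩) {0}ᶜ := by
  rw [← contMDiffOn_iff_contDiffOn]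
  exact hF.smooth.comp (contMDiff_fiber_inclusion p).contMDiffOn (fun y hy => hy)

/-- A Finsler metric is positive on non-zero vectors: otherwise its square would vanish on a ray,
along which the Hessian is positive. -/
lemma IsFinslerMetric.pos (hF : IsFinslerMetric F)
    (p : M) {y : E} (hy : y ≠ 0) : 0 < F ⟨p, y⟩ := by
  refine lt_of_le_of_ne (hF.nonneg _) fun h0 => ?_
  have h := hF.posDef p y y hy hy
  have h1 : ∀ c : ℝ, 0 < c → F ⟨p, c • y⟩ = 0 := fun c hc => by
    rw [← mul_zero c, h0]; exact hF.homogeneous p y c hc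
  have h2 : (fun s : ℝ => deriv (fun t : ℝ =>
      F ⟨p, (y + s • y + t • y : E)⟩ ^ 2) 0) =ᶠ[nhds 0] fun _ => 0 := by
    filter_upwards [lt_mem_nhds (show (-1 / 2 : ℝ) < 0 by norm_num)] with s hs
    have h3 : (fun t : ℝ => F ⟨p, (y + s • y + t • y : E)⟩ ^ 2) =ᶠ[nhds 0] fun _ => 0 := by
      filter_upwards [lt_mem_nhds (show (-1 / 2 : ℝ) < 0 by norm_num)] with t ht
      have : y + s • y + t • y = (1 + s + t) • y := by module
      rw [this, h1 _ (by linarith)]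
      norm_num
    rw [h3.deriv_eq, deriv_const]
  have h4 : fundamentalForm F p y y y = (1 / 2 : ℝ) * deriv (fun s : ℝ => deriv (fun t : ℝ =>
      F ⟨p, (y + s • y + t • y : E)⟩ ^ 2) 0) 0 := rfl
  rw [h4, h2.deriv_eq, deriv_const, mul_zero] at h
  exact lt_irrefl _ h

end Fibre

/-! ### Left-invariant functions in a chart -/

section LeftInvariantFrame

variable {E : Type*} [NormedAddCommGroup E] [NormedSpace ℝ E]
  {G : Type*} [Group G] [TopologicalSpace G] [ChartedSpace E G]

/-- The form in which Mathlib requires smoothness for the Lie algebra structure. -/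
lemma lieGroup_minSmoothness [LieGroup 𝓘(ℝ, E) ∞ G] :
    LieGroup 𝓘(ℝ, E) (minSmoothness ℝ 3) G := by
  rw [minSmoothness_of_isRCLikeNormedField]
  infer_instance

lemma mdifferentiable_mul_left [LieGroup 𝓘(ℝ, E) ∞ G] (a : G) :
    MDifferentiable 𝓘(ℝ, E) 𝓘(ℝ, E) (fun q : G => a * q) :=
  (contMDiff_mul_left (I := 𝓘(ℝ, E)) (n := ∞)).mdifferentiable (by simp)

lemma mfderiv_mul_left_comp [LieGroup 𝓘(ℝ, E) ∞ G] (a b p : G) (v : TangentSpace 𝓘(ℝ, E) p) :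
    mfderiv 𝓘(ℝ, E) 𝓘(ℝ, E) (fun q : G => a * q) (b * p)
      (mfderiv 𝓘(ℝ, E) 𝓘(ℝ, E) (fun q : G => b * q) p v) =
      mfderiv 𝓘(ℝ, E) 𝓘(ℝ, E) (fun q : G => a * b * q) p v := by
  have h := mfderiv_comp p (mdifferentiable_mul_left (E := E) a (b * p))
    (mdifferentiable_mul_left (E := E) b p)
  have h2 : (fun q : G => a * q) ∘ (fun q : G => b * q) = fun q : G => a * b * q := by
    ext q; simp [mul_assoc]
  rw [h2] at h
  rw [h]; rfl

/-- Left translation by `a`, as a diffeomorphism. -/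
def leftTranslation [LieGroup 𝓘(ℝ, E) ∞ G] (a : G) : G ≃ₘ^∞⟮𝓘(ℝ, E), 𝓘(ℝ, E)⟯ G where
  toEquiv := Equiv.mulLeft a
  contMDiff_toFun := contMDiff_mul_left
  contMDiff_invFun := contMDiff_mul_left

lemma isInvertible_mfderiv_mul_left [LieGroup 𝓘(ℝ, E) ∞ G] (a p : G) :
    (mfderiv 𝓘(ℝ, E) 𝓘(ℝ, E) (fun q : G => a * q) p).IsInvertible :=
  ⟨(leftTranslation (E := E) a).mfderivToContinuousLinearEquiv (by simp) p, rfl⟩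

/-- The left-invariant vector fields in the chart `φ`: the map which sends `a` in the Lie algebra
to the coordinate expression at `x` of the left-invariant field with value `a` at `1`. -/
def leftFrame (φ : OpenPartialHomeomorph G E) (x : E) : E →L[ℝ] E :=
  ContinuousLinearMap.inverse (mfderiv 𝓘(ℝ, E) 𝓘(ℝ, E) φ.symm x : E →L[ℝ] E) ∘L
    (mfderiv 𝓘(ℝ, E) 𝓘(ℝ, E) (fun q : G => φ.symm x * q) 1 : E →L[ℝ] E)

variable {φ : OpenPartialHomeomorph G E} {x : E}

omit [Group G] in
lemma isInvertible_mfderiv_symm [IsManifold 𝓘(ℝ, E) ∞ G]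
    (hφ : φ ∈ IsManifold.maximalAtlas 𝓘(ℝ, E) ∞ G) (hx : x ∈ φ.target) :
    (mfderiv 𝓘(ℝ, E) 𝓘(ℝ, E) φ.symm x).IsInvertible := by
  have h : φ.MDifferentiable 𝓘(ℝ, E) 𝓘(ℝ, E) :=
    ⟨(contMDiffOn_of_mem_maximalAtlas hφ).mdifferentiableOn (by simp),
      (contMDiffOn_symm_of_mem_maximalAtlas hφ).mdifferentiableOn (by simp)⟩
  exact ⟨h.symm.mfderiv hx, rfl⟩

variable [LieGroup 𝓘(ℝ, E) ∞ G]

lemma mfderiv_symm_leftFrame (hφ : φ ∈ IsManifold.maximalAtlas 𝓘(ℝ, E) ∞ G) (hx : x ∈ φ.target)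
    (a : E) : mfderiv 𝓘(ℝ, E) 𝓘(ℝ, E) φ.symm x (leftFrame φ x a) =
      mfderiv 𝓘(ℝ, E) 𝓘(ℝ, E) (fun q : G => φ.symm x * q) 1 a := by
  have key : ∀ D : E →L[ℝ] E, D.IsInvertible → ∀ v, D (D.inverse v) = v := by
    rintro _ ⟨e, rfl⟩ v
    simp
  exact key _ (isInvertible_mfderiv_symm hφ hx) _

lemma isInvertible_leftFrame (hφ : φ ∈ IsManifold.maximalAtlas 𝓘(ℝ, E) ∞ G)
    (hx : x ∈ φ.target) : (leftFrame φ x).IsInvertible := by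
  have key : ∀ D D' : E →L[ℝ] E, D.IsInvertible → D'.IsInvertible →
      (D.inverse ∘L D').IsInvertible := by
    rintro _ _ ⟨e, rfl⟩ ⟨e', rfl⟩
    exact ⟨e'.trans e.symm, by ext; simp⟩
  exact key _ _ (isInvertible_mfderiv_symm hφ hx) (isInvertible_mfderiv_mul_left (φ.symm x) 1)

/-- Left-invariant vector fields on a smooth Lie group are smooth: they arise from the tangent map
of the multiplication by fixing the zero vector in the first and a vector at `1` in the second
factor. -/
lemma contMDiff_infty_mulInvariantVectorField (v : GroupLieAlgebra 𝓘(ℝ, E) G) :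
    ContMDiff 𝓘(ℝ, E) 𝓘(ℝ, E).tangent ∞
      (fun g : G => (mulInvariantVectorField v g : TangentBundle 𝓘(ℝ, E) G)) := by
  let fg : G → TangentBundle 𝓘(ℝ, E) G := fun g => TotalSpace.mk' E g 0
  have sfg : ContMDiff 𝓘(ℝ, E) 𝓘(ℝ, E).tangent ∞ fg := contMDiff_zeroSection _ _
  let fv : G → TangentBundle 𝓘(ℝ, E) G := fun _ => TotalSpace.mk' E 1 v
  have sfv : ContMDiff 𝓘(ℝ, E) 𝓘(ℝ, E).tangent ∞ fv := contMDiff_const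
  let F₁ : G → (TangentBundle 𝓘(ℝ, E) G × TangentBundle 𝓘(ℝ, E) G) := fun g => (fg g, fv g)
  have S₁ : ContMDiff 𝓘(ℝ, E) (𝓘(ℝ, E).tangent.prod 𝓘(ℝ, E).tangent) ∞ F₁ := sfg.prodMk sfv
  let F₂ : (TangentBundle 𝓘(ℝ, E) G × TangentBundle 𝓘(ℝ, E) G) →
      TangentBundle (𝓘(ℝ, E).prod 𝓘(ℝ, E)) (G × G) :=
    (equivTangentBundleProd 𝓘(ℝ, E) G 𝓘(ℝ, E) G).symm
  have S₂ : ContMDiff (𝓘(ℝ, E).tangent.prod 𝓘(ℝ, E).tangent)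
      (𝓘(ℝ, E).prod 𝓘(ℝ, E)).tangent ∞ F₂ := contMDiff_equivTangentBundleProd_symm
  let F₃ : TangentBundle (𝓘(ℝ, E).prod 𝓘(ℝ, E)) (G × G) → TangentBundle 𝓘(ℝ, E) G :=
    tangentMap (𝓘(ℝ, E).prod 𝓘(ℝ, E)) 𝓘(ℝ, E) (fun (p : G × G) => p.1 * p.2)
  have S₃ : ContMDiff (𝓘(ℝ, E).prod 𝓘(ℝ, E)).tangent 𝓘(ℝ, E).tangent ∞ F₃ :=
    ContMDiff.contMDiff_tangentMap (contMDiff_mul 𝓘(ℝ, E) ∞) (m := ∞) le_rfl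
  have key : ∀ g : G, F₃ (F₂ (F₁ g)) = (mulInvariantVectorField v g : TangentBundle 𝓘(ℝ, E) G) := by
    intro g
    have h1 : F₃ (F₂ (F₁ g)) = ⟨g * 1, mfderiv (𝓘(ℝ, E).prod 𝓘(ℝ, E)) 𝓘(ℝ, E)
      (fun (p : G × G) => p.1 * p.2) (g, 1) ((0 : E), (v : E))⟩ := rfl
    let D₁ : E →L[ℝ] E := mfderiv 𝓘(ℝ, E) 𝓘(ℝ, E) (fun z => z * (1 : G)) g
    let D₂ : E →L[ℝ] E := mfderiv 𝓘(ℝ, E) 𝓘(ℝ, E) (fun z => g * z) 1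
    have h2 : (mfderiv (𝓘(ℝ, E).prod 𝓘(ℝ, E)) 𝓘(ℝ, E)
        (fun (p : G × G) => p.1 * p.2) (g, 1) ((0 : E), (v : E)) : E) = D₁ 0 + D₂ v :=
      mfderiv_prod_eq_add_apply ((contMDiff_mul 𝓘(ℝ, E) ∞).mdifferentiableAt (by simp))
    rw [map_zero, zero_add] at h2
    have h3 : ∀ w : E, (⟨g * 1, w⟩ : TangentBundle 𝓘(ℝ, E) G) = ⟨g, w⟩ := fun w => by
      rw [mul_one]
    exact (h1.trans (congrArg (fun w : E => (⟨g * 1, w⟩ : TangentBundle 𝓘(ℝ, E) G)) h2)).trans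
      (h3 _)
  exact ((S₃.comp S₂).comp S₁).congr fun g => (key g).symm

variable [FiniteDimensional ℝ E]

lemma contDiffOn_leftFrame (hφ : φ ∈ IsManifold.maximalAtlas 𝓘(ℝ, E) ∞ G) :
    ContDiffOn ℝ ∞ (leftFrame φ) φ.target := by
  rw [contDiffOn_clm_apply]
  intro a x hx
  refine ContDiffAt.contDiffWithinAt ?_
  refine contMDiffAt_vectorSpace_iff_contDiffAt (V := fun x => leftFrame φ x a) |>.1 ?_
  exact ContMDiffAt.mpullback_vectorField_preimage
    (contMDiff_infty_mulInvariantVectorField (E := E) (G := G) a).contMDiffAt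
    (contMDiffAt_symm_of_mem_maximalAtlas hφ hx) (isInvertible_mfderiv_symm hφ hx)
    le_rfl

/-- The structure constants of the frame of left-invariant fields are those of the Lie algebra. -/
lemma lieBracket_leftFrame (hφ : φ ∈ IsManifold.maximalAtlas 𝓘(ℝ, E) ∞ G) (hx : x ∈ φ.target)
    (a b : GroupLieAlgebra 𝓘(ℝ, E) G) :
    VectorField.lieBracket ℝ (fun x => leftFrame φ x a) (fun x => leftFrame φ x b) x =
      leftFrame φ x (⁅a, b⁆ : GroupLieAlgebra 𝓘(ℝ, E) G) := by
  have := lieGroup_minSmoothness (E := E) (G := G)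
  have h := VectorField.mpullback_mlieBracket (I := 𝓘(ℝ, E)) (I' := 𝓘(ℝ, E)) (n := ∞)
    (f := φ.symm) (x₀ := x)
    (mdifferentiableAt_mulInvariantVectorField (I := 𝓘(ℝ, E)) (G := G) a)
    (mdifferentiableAt_mulInvariantVectorField (I := 𝓘(ℝ, E)) (G := G) b)
    (contMDiffAt_symm_of_mem_maximalAtlas hφ hx)
    (by rw [minSmoothness_of_isRCLikeNormedField]; exact ENat.LEInfty.out)
  rw [← mulInvariantVector_mlieBracket,
    ← VectorField.mlieBracketWithin_univ (V := VectorField.mpullback _ _ _ _),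
    VectorField.mlieBracketWithin_eq_lieBracketWithin] at h
  exact (h.trans (congrFun VectorField.lieBracketWithin_univ x)).symm

omit [FiniteDimensional ℝ E] in
/-- In a chart, the square of a left-invariant function is the square of its restriction to the
Lie algebra, evaluated on the components with respect to the frame of left-invariant fields. -/
lemma localEnergy_eq {F : TangentBundle 𝓘(ℝ, E) G → ℝ} (hF : IsLeftInvariantFinsler F)
    (hφ : φ ∈ IsManifold.maximalAtlas 𝓘(ℝ, E) ∞ G) (hx : x ∈ φ.target) (y : E) :
    localEnergy F φ x y = F ⟨1, (leftFrame φ x).inverse y⟩ ^ 2 := by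
  obtain ⟨e, he⟩ := isInvertible_leftFrame hφ hx
  have h1 := mfderiv_symm_leftFrame hφ hx ((leftFrame φ x).inverse y)
  have h2 : leftFrame φ x ((leftFrame φ x).inverse y) = y := by rw [← he]; simp
  rw [h2] at h1
  have h3 := hF (φ.symm x) 1 ((leftFrame φ x).inverse y)
  rw [localEnergy, h1, ← h3, mul_one]

variable {F : TangentBundle 𝓘(ℝ, E) G → ℝ}

/-- A left-invariant Finsler metric is of Berwald type if and only if the Lie algebra carries a
bilinear product `Ω` with torsion-free antisymmetrization such that `Ω a b` is tangent at `b` to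
the level set of the metric. -/
theorem isBerwald_iff (hF : IsFinslerMetric F) (hl : IsLeftInvariantFinsler F) :
    IsBerwald F ↔ ∃ Ω : E →ₗ[ℝ] E →ₗ[ℝ] E,
      (∀ a b : GroupLieAlgebra 𝓘(ℝ, E) G, Ω a b - Ω b a = (⁅a, b⁆ : GroupLieAlgebra 𝓘(ℝ, E) G)) ∧
      ∀ b : E, b ≠ 0 → ∀ a, fderiv ℝ (fun y : E => F ⟨1, y⟩) b (Ω a b) = 0 := by
  have hd : ∀ b : E, b ≠ 0 → DifferentiableAt ℝ (fun y : E => F ⟨1, y⟩) b := fun b hb =>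
    ((hF.contDiffOn_fiber 1).contDiffAt (isOpen_compl_singleton.mem_nhds hb)).differentiableAt
      (by simp)
  have key : ∀ φ ∈ IsManifold.maximalAtlas 𝓘(ℝ, E) ∞ G, ∀ x ∈ φ.target,
      ((∃ Γ : E →ₗ[ℝ] E →ₗ[ℝ] E, (∀ u v, Γ u v = Γ v u) ∧
        ∀ y : E, y ≠ 0 → IsSprayCoefficient (localEnergy F φ) x y ((1 / 2 : ℝ) • Γ y y)) ↔
      ∃ Ω : E →ₗ[ℝ] E →ₗ[ℝ] E,
        (∀ a b : GroupLieAlgebra 𝓘(ℝ, E) G, Ω a b - Ω b a = (⁅a, b⁆ : GroupLieAlgebra 𝓘(ℝ, E) G)) ∧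
        ∀ b : E, b ≠ 0 → ∀ a, fderiv ℝ (fun y : E => F ⟨1, y⟩) b (Ω a b) = 0) := by
    intro φ hφ x hx
    have h := exists_isSprayCoefficient_iff φ.open_target hx
      ((contDiffOn_leftFrame hφ).of_le ENat.LEInfty.out)
      (fun x hx => isInvertible_leftFrame hφ hx)
      (br := fun a b : GroupLieAlgebra 𝓘(ℝ, E) G => (⁅a, b⁆ : GroupLieAlgebra 𝓘(ℝ, E) G))
      (lieBracket_leftFrame hφ hx)
      (ℓ := fun y : E => F ⟨1, y⟩ ^ 2)
      (((hF.contDiffOn_fiber 1).pow 2).of_le ENat.LEInfty.out)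
      (fun a c hc => by
        have : F ⟨1, (c • a : E)⟩ = c * F ⟨1, a⟩ := hF.homogeneous 1 a c hc
        rw [this, mul_pow])
      (fun x hx y => localEnergy_eq hl hφ hx y)
    refine h.trans (exists_congr fun Ω => and_congr Iff.rfl (forall₃_congr fun b hb a => ?_))
    have h2 : fderiv ℝ (fun y : E => F ⟨1, y⟩ ^ 2) b =
        (2 * F ⟨1, b⟩) • fderiv ℝ (fun y : E => F ⟨1, y⟩) b := by
      have := ((hd b hb).hasFDerivAt.pow 2).fderiv
      simpa using this
    rw [h2, _root_.smul_apply, smul_eq_mul, mul_eq_zero]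
    have := hF.pos 1 hb
    exact or_iff_right (by positivity)
  constructor
  · intro h
    have hc := IsManifold.chart_mem_maximalAtlas (I := 𝓘(ℝ, E)) (n := ∞) (1 : G)
    have hx := mem_chart_target E (1 : G)
    exact (key _ hc _ hx).1 (h _ hc _ hx)
  · intro h φ hφ x hx
    exact (key φ hφ x hx).2 h

end LeftInvariantFrame

/-! ### From Berwald metrics to parallel vectors -/

section Parallel

variable {E : Type*} [NormedAddCommGroup E] [NormedSpace ℝ E]
  {G : Type*} [Group G] [TopologicalSpace G] [ChartedSpace E G]

/-- The algebraic conditions on `X` in the Lie algebra which say that the left-invariant vector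
field with value `X` at `1` is non-zero and parallel for the Levi-Civita connection of the
left-invariant metric `g`: it is orthogonal to all brackets, and `ad X` is skew-symmetric. -/
structure IsParallelVector [IsManifold 𝓘(ℝ, E) ∞ G] (g : RiemMetric E G)
    (X : GroupLieAlgebra 𝓘(ℝ, E) G) : Prop where
  ne_zero : X ≠ 0
  inner_bracket : ∀ a b : GroupLieAlgebra 𝓘(ℝ, E) G, g.inner 1 X ⁅a, b⁆ = 0
  skew : ∀ a : GroupLieAlgebra 𝓘(ℝ, E) G, g.inner 1 a ⁅X, a⁆ = 0

/-- The inner product on the Lie algebra, as a bilinear form on the model space. -/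
def innerOne [IsManifold 𝓘(ℝ, E) ∞ G] (g : RiemMetric E G) : E →L[ℝ] E →L[ℝ] ℝ :=
  g.inner 1

section
variable [IsManifold 𝓘(ℝ, E) ∞ G] (g : RiemMetric E G)

lemma innerOne_symm (a b : E) : innerOne g a b = innerOne g b a := g.symm 1 a b

lemma innerOne_pos {a : E} (ha : a ≠ 0) : 0 < innerOne g a a := g.pos 1 a ha

lemma hasFDerivAt_innerOne_self (b : E) :
    HasFDerivAt (fun y : E => innerOne g y y) ((2 : ℝ) • innerOne g b) b := by
  have h := (innerOne g).hasFDerivAt (x := b) |>.clm_apply (hasFDerivAt_id b)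
  refine h.congr_fderiv ?_
  ext z
  have h1 : innerOne g z b = innerOne g b z := innerOne_symm g z b
  simp [two_mul, h1]

lemma hasFDerivAt_sqrt_innerOne {b : E} (hb : b ≠ 0) :
    HasFDerivAt (fun y : E => √(innerOne g y y)) ((√(innerOne g b b))⁻¹ • innerOne g b) b := by
  have h := (hasFDerivAt_innerOne_self g b).sqrt (innerOne_pos g hb).ne'
  refine h.congr_fderiv ?_
  rw [smul_smul]
  congr 1
  field_simp

/-- A torsion-free product that is compatible with the inner product and with the linear form
`⟨X, ·⟩` exists only if `X` is a parallel vector. -/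
lemma isParallelVector_of_product {X : E} (hX : X ≠ 0) {Ω : E →ₗ[ℝ] E →ₗ[ℝ] E}
    (hΩ : ∀ a b : GroupLieAlgebra 𝓘(ℝ, E) G,
      Ω a b - Ω b a = (⁅a, b⁆ : GroupLieAlgebra 𝓘(ℝ, E) G))
    (h1 : ∀ a b, innerOne g b (Ω a b) = 0) (h2 : ∀ a b, innerOne g X (Ω a b) = 0) :
    IsParallelVector g X := by
  -- polarization of `h1`
  have h3 : ∀ a b c, innerOne g b (Ω a c) + innerOne g c (Ω a b) = 0 := fun a b c => by
    have h := h1 a (b + c)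
    simp only [map_add, _root_.add_apply] at h
    linarith [h1 a b, h1 a c]
  -- hence `Ω a X = 0`
  have h4 : ∀ a, Ω a X = 0 := fun a => by
    by_contra hne
    have h := h3 a (Ω a X) X
    rw [h2, add_zero] at h
    exact (innerOne_pos g hne).ne' h
  have h5 : ∀ a b, innerOne g X (Ω a b - Ω b a) = 0 := fun a b => by
    rw [map_sub, h2, h2, sub_zero]
  have h6 : ∀ a, innerOne g a (Ω X a - Ω a X) = 0 := fun a => by
    rw [map_sub, h1, h4, map_zero, sub_zero]
  exact ⟨hX, fun a b => (congrArg (innerOne g X) (hΩ a b)).symm.trans (h5 a b),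
    fun a => (congrArg (innerOne g a) (hΩ X a)).symm.trans (h6 a)⟩

end

variable [LieGroup 𝓘(ℝ, E) ∞ G] {g : RiemMetric E G} {F : TangentBundle 𝓘(ℝ, E) G → ℝ}

lemma alpha_mfderiv_mul_left (hg : IsLeftInvariantRiem g) (a p : G)
    (y : TangentSpace 𝓘(ℝ, E) p) :
    alpha g ⟨a * p, mfderiv 𝓘(ℝ, E) 𝓘(ℝ, E) (fun q : G => a * q) p y⟩ = alpha g ⟨p, y⟩ := by
  simp only [alpha, hg a p y y]

lemma alpha_pos {p : G} {y : TangentSpace 𝓘(ℝ, E) p} (hy : y ≠ 0) : 0 < alpha g ⟨p, y⟩ :=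
  Real.sqrt_pos.2 (g.pos p y hy)

/-- If the zeros of the `1`-form `⟨X, ·⟩` are invariant under left translations and `X` vanishes at
`1`, then it vanishes. -/
lemma eq_zero_of_apply_one_eq_zero {X : ∀ p : G, TangentSpace 𝓘(ℝ, E) p} (h1 : X 1 = 0)
    (h : ∀ (a p : G) (y : TangentSpace 𝓘(ℝ, E) p), y ≠ 0 →
      g.inner (a * p) (X (a * p)) (mfderiv 𝓘(ℝ, E) 𝓘(ℝ, E) (fun q : G => a * q) p y) = 0 →
      g.inner p (X p) y = 0) (p : G) : X p = 0 := by
  by_contra hne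
  -- the base points `p⁻¹ * p` and `1` are not definitionally equal
  have h2 : ∀ q, q = 1 → X q = 0 := by rintro _ rfl; exact h1
  have h3 := h p⁻¹ p (X p) hne (by rw [h2 _ (inv_mul_cancel p), map_zero]; rfl)
  exact (g.pos p _ hne).ne' h3

lemma exists_eq_of_isRandersMetric (hg : IsLeftInvariantRiem g) (hF : IsRandersMetric g F)
    (hl : IsLeftInvariantFinsler F) :
    ∃ X : E, X ≠ 0 ∧ ∀ y : E, F ⟨1, y⟩ = √(innerOne g y y) + innerOne g X y := by
  obtain ⟨-, X, ⟨-, p, hp⟩, hX⟩ := hF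
  refine ⟨X 1, fun h1 => hp (eq_zero_of_apply_one_eq_zero (g := g) h1 ?_ p), fun y => hX ⟨1, y⟩⟩
  intro a p y _ h
  have h2 := hl a p y
  rw [hX, hX, alpha_mfderiv_mul_left hg] at h2
  linarith

lemma exists_eq_of_isMatsumotoMetric (hg : IsLeftInvariantRiem g) (hF : IsMatsumotoMetric g F)
    (hl : IsLeftInvariantFinsler F) :
    ∃ X : E, X ≠ 0 ∧
      ∀ y : E, F ⟨1, y⟩ = √(innerOne g y y) ^ 2 / (√(innerOne g y y) - innerOne g X y) := by
  obtain ⟨hF, X, ⟨-, p, hp⟩, hX⟩ := hF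
  refine ⟨X 1, fun h1 => hp (eq_zero_of_apply_one_eq_zero (g := g) h1 ?_ p), fun y => hX ⟨1, y⟩⟩
  intro a p y hy h
  have h2 := hl a p y
  have h3 := hF.pos p hy
  have ha : 0 < alpha g ⟨p, y⟩ := alpha_pos hy
  rw [hX, hX, alpha_mfderiv_mul_left hg] at h2
  rw [hX] at h3
  dsimp only at h2 h3
  rw [h, sub_zero] at h2
  have h4 : alpha g ⟨p, y⟩ - g.inner p (X p) y ≠ 0 := by
    intro h0
    rw [h0, div_zero] at h3
    exact lt_irrefl _ h3
  field_simp at h2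
  linarith

/-- As `α` is even and `β` is odd, the tangency conditions for a Randers metric at `b` and at `-b`
imply those for `α` and for `β`. -/
lemma exists_isParallelVector_of_admitsBerwaldRanders [FiniteDimensional ℝ E]
    (hg : IsLeftInvariantRiem g) (h : AdmitsBerwaldRanders g) :
    ∃ X, IsParallelVector g X := by
  obtain ⟨F, hR, hl, hB⟩ := h
  obtain ⟨Ω, hΩ, hF⟩ := (isBerwald_iff hR.1 hl).1 hB
  obtain ⟨X, hX, hFX⟩ := exists_eq_of_isRandersMetric hg hR hl
  have key : ∀ b : E, b ≠ 0 → ∀ z, fderiv ℝ (fun y : E => F ⟨1, y⟩) b z =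
      (√(innerOne g b b))⁻¹ * innerOne g b z + innerOne g X z := by
    intro b hb z
    have hF' : (fun y : E => F ⟨1, y⟩) = fun y => √(innerOne g y y) + innerOne g X y :=
      funext hFX
    rw [hF', ((hasFDerivAt_sqrt_innerOne g hb).fun_add (innerOne g X).hasFDerivAt).fderiv]
    simp
  have h12 : ∀ a b, innerOne g b (Ω a b) = 0 ∧ innerOne g X (Ω a b) = 0 := by
    intro a b
    rcases eq_or_ne b 0 with rfl | hb
    · simp
    have e1 := hF b hb a
    have e2 := hF (-b) (neg_ne_zero.2 hb) a
    rw [key b hb] at e1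
    rw [key (-b) (neg_ne_zero.2 hb)] at e2
    simp only [map_neg, _root_.neg_apply, neg_neg] at e2
    have hpos : 0 < (√(innerOne g b b))⁻¹ := inv_pos.2 (Real.sqrt_pos.2 (innerOne_pos g hb))
    have e3 : (√(innerOne g b b))⁻¹ * innerOne g b (Ω a b) = 0 := by linarith
    have e4 := (mul_eq_zero.1 e3).resolve_left hpos.ne'
    exact ⟨e4, by linarith⟩
  exact ⟨X, isParallelVector_of_product g hX hΩ (fun a b => (h12 a b).1) fun a b => (h12 a b).2⟩

/-- As for Randers metrics, the tangency conditions at `b` and at `-b` separate `α` from `β`. -/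
lemma exists_isParallelVector_of_admitsBerwaldMatsumoto [FiniteDimensional ℝ E]
    (hg : IsLeftInvariantRiem g) (h : AdmitsBerwaldMatsumoto g) :
    ∃ X, IsParallelVector g X := by
  obtain ⟨F, hR, hl, hB⟩ := h
  obtain ⟨Ω, hΩ, hF⟩ := (isBerwald_iff hR.1 hl).1 hB
  obtain ⟨X, hX, hFX⟩ := exists_eq_of_isMatsumotoMetric hg hR hl
  have hu : ∀ b : E, b ≠ 0 → √(innerOne g b b) - innerOne g X b ≠ 0 := by
    intro b hb h0
    have h := hR.1.pos 1 hb
    -- a vanishing denominator would make the quotient, and so `F`, zero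
    rw [hFX, h0, div_zero] at h
    exact lt_irrefl _ h
  -- the numerator of the derivative of `α² / (α - β)`
  have key : ∀ b : E, b ≠ 0 → ∀ z, fderiv ℝ (fun y : E => F ⟨1, y⟩) b z = 0 →
      (√(innerOne g b b) - 2 * innerOne g X b) * innerOne g b z +
        √(innerOne g b b) ^ 2 * innerOne g X z = 0 := by
    intro b hb z h0
    have hα := hasFDerivAt_sqrt_innerOne g hb
    have hF' : (fun y : E => F ⟨1, y⟩) =
        fun y => √(innerOne g y y) ^ 2 * (√(innerOne g y y) - innerOne g X y)⁻¹ :=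
      funext fun y => by rw [hFX, div_eq_mul_inv]
    have h := (hα.pow 2).fun_mul ((hasDerivAt_inv (hu b hb)).comp_hasFDerivAt b
      (hα.fun_sub (innerOne g X).hasFDerivAt))
    have h' := (congrArg (fun f => fderiv ℝ f b) hF').trans h.fderiv
    beta_reduce at h'
    rw [h'] at h0
    have hpos : 0 < √(innerOne g b b) := Real.sqrt_pos.2 (innerOne_pos g hb)
    have hu' := hu b hb
    simp at h0
    field_simp at h0
    linarith
  have h12 : ∀ a b, innerOne g b (Ω a b) = 0 ∧ innerOne g X (Ω a b) = 0 := by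
    intro a b
    rcases eq_or_ne b 0 with rfl | hb
    · simp
    have e1 := key b hb _ (hF b hb a)
    have e2 := key (-b) (neg_ne_zero.2 hb) _ (hF (-b) (neg_ne_zero.2 hb) a)
    simp only [map_neg, _root_.neg_apply, neg_neg] at e2
    have hpos : 0 < √(innerOne g b b) := Real.sqrt_pos.2 (innerOne_pos g hb)
    have e3 : √(innerOne g b b) * innerOne g b (Ω a b) = 0 := by linarith
    have e4 := (mul_eq_zero.1 e3).resolve_left hpos.ne'
    rw [e4, mul_zero, zero_add] at e1
    exact ⟨e4, (mul_eq_zero.1 e1).resolve_left (by positivity)⟩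
  exact ⟨X, isParallelVector_of_product g hX hΩ (fun a b => (h12 a b).1) fun a b => (h12 a b).2⟩

end Parallel

/-! ### Strong convexity along lines -/

section Convexity

open Filter Topology

/-- The Hessian of `f² / 2` along a line, in terms of the derivatives of `f`. -/
lemma half_deriv_deriv_sq {f f₁ : ℝ → ℝ} {f₂ : ℝ} (h1 : ∀ᶠ r in 𝓝 0, HasDerivAt f (f₁ r) r)
    (h2 : HasDerivAt f₁ f₂ 0) :
    (1 / 2 : ℝ) * deriv (fun s => deriv (fun t => f (s + t) ^ 2) 0) 0 =
      f₁ 0 ^ 2 + f 0 * f₂ := by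
  have e1 : (fun s => deriv (fun t => f (s + t) ^ 2) 0) =ᶠ[𝓝 0] fun s => 2 * f s * f₁ s := by
    filter_upwards [h1] with s hs
    have h3 : HasDerivAt (fun t => f (s + t)) (f₁ s) 0 := by
      have : HasDerivAt f (f₁ s) (s + 0) := by rwa [add_zero]
      exact this.comp_const_add s 0
    have h4 := (h3.fun_pow 2).deriv
    rw [h4]
    simp
  have h5 := (h1.self_of_nhds.const_mul 2).fun_mul h2
  rw [e1.deriv_eq, h5.deriv]
  ring

variable {A B C b₀ b₁ : ℝ}

lemma eventually_quadratic_pos (hA : 0 < A) : ∀ᶠ r in 𝓝 (0 : ℝ), 0 < A + 2 * B * r + C * r ^ 2 := by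
  have hc : Continuous fun r : ℝ => A + 2 * B * r + C * r ^ 2 := by fun_prop
  have := hc.tendsto 0
  simp only [mul_zero, ne_eq, OfNat.ofNat_ne_zero, not_false_eq_true, zero_pow, add_zero] at this
  exact this.eventually (lt_mem_nhds hA)

lemma hasDerivAt_quadratic (r : ℝ) :
    HasDerivAt (fun r : ℝ => A + 2 * B * r + C * r ^ 2) (2 * (B + C * r)) r := by
  have := (((hasDerivAt_id r).const_mul (2 * B)).const_add A).add
    ((hasDerivAt_pow 2 r).const_mul C)
  refine this.congr_deriv ?_
  simp; ring

lemma hasDerivAt_sqrt_quadratic {r : ℝ} (hr : 0 < A + 2 * B * r + C * r ^ 2) :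
    HasDerivAt (fun r : ℝ => √(A + 2 * B * r + C * r ^ 2))
      ((B + C * r) / √(A + 2 * B * r + C * r ^ 2)) r := by
  refine ((hasDerivAt_quadratic r).sqrt hr.ne').congr_deriv ?_
  field_simp

lemma hasDerivAt_deriv_sqrt_quadratic (hA : 0 < A) :
    HasDerivAt (fun r : ℝ => (B + C * r) / √(A + 2 * B * r + C * r ^ 2))
      ((A * C - B ^ 2) / √A ^ 3) 0 := by
  have h0 : 0 < A + 2 * B * 0 + C * 0 ^ 2 := by simpa using hA
  have h1 := hasDerivAt_sqrt_quadratic h0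
  have h2 : HasDerivAt (fun r : ℝ => B + C * r) C 0 := by
    simpa using ((hasDerivAt_id (0 : ℝ)).const_mul C).const_add B
  have hs : 0 < √A := Real.sqrt_pos.2 hA
  refine (h2.fun_div h1 (Real.sqrt_pos.2 h0).ne').congr_deriv ?_
  simp only [mul_zero, ne_eq, OfNat.ofNat_ne_zero, not_false_eq_true, zero_pow, add_zero]
  have h3 : √A ^ 2 = A := Real.sq_sqrt hA.le
  field_simp
  rw [h3]

/-- Here `α² = A + 2 B r + C r²` and `β = b₀ + b₁ r` along a line. Either the line does not pass
through the origin, and the claim follows from `α'' > 0`; or `α + β` is linear near `r = 0`, with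
non-zero slope. -/
lemma randers_hessian_pos (hA : 0 < A) (hC : B ^ 2 < A * C ∨
      ∃ c : ℝ, c ≠ 0 ∧ B = c * A ∧ C = c ^ 2 * A ∧ b₁ = c * b₀) (hb : |b₀| ≤ √A / 3) :
    0 < (1 / 2 : ℝ) * deriv (fun s => deriv (fun t =>
      (√(A + 2 * B * (s + t) + C * (s + t) ^ 2) + (b₀ + b₁ * (s + t))) ^ 2) 0) 0 := by
  have hs : 0 < √A := Real.sqrt_pos.2 hA
  have h3 : √A ^ 2 = A := Real.sq_sqrt hA.le
  have hlin : ∀ r : ℝ, HasDerivAt (fun r : ℝ => b₀ + b₁ * r) b₁ r := fun r => by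
    simpa using ((hasDerivAt_id r).const_mul b₁).const_add b₀
  have h1 : ∀ᶠ r in 𝓝 (0 : ℝ), HasDerivAt
      (fun r => √(A + 2 * B * r + C * r ^ 2) + (b₀ + b₁ * r))
      ((B + C * r) / √(A + 2 * B * r + C * r ^ 2) + b₁) r := by
    filter_upwards [eventually_quadratic_pos hA] with r hr
    exact (hasDerivAt_sqrt_quadratic hr).fun_add (hlin r)
  have h2 := (hasDerivAt_deriv_sqrt_quadratic (B := B) (C := C) hA).add_const b₁
  rw [half_deriv_deriv_sq h1 h2]
  simp only [mul_zero, ne_eq, OfNat.ofNat_ne_zero, not_false_eq_true, zero_pow, add_zero]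
  have hf : 0 < √A + b₀ := by linarith [neg_abs_le b₀]
  rcases hC with hC | ⟨c, hc, rfl, rfl, rfl⟩
  · have : 0 < (A * C - B ^ 2) / √A ^ 3 := div_pos (by linarith) (by positivity)
    positivity
  · have e1 : c * A / √A + c * b₀ = c * (√A + b₀) := by
      field_simp
      linear_combination -h3
    have e2 : A * (c ^ 2 * A) - (c * A) ^ 2 = 0 := by ring
    rw [e1, e2, zero_div, mul_zero, add_zero]
    positivity

/-- The analogue of `randers_hessian_pos` for `f = α² / (α - β)`: with `u = α - β`, one has
`f'' = 2 (α' u - α u')² / u³ + α α'' (α - 2β) / u²`, and the bound on `β` makes `u` and `α - 2β`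
positive. -/
lemma matsumoto_hessian_pos (hA : 0 < A) (hC : B ^ 2 < A * C ∨
      ∃ c : ℝ, c ≠ 0 ∧ B = c * A ∧ C = c ^ 2 * A ∧ b₁ = c * b₀) (hb : |b₀| ≤ √A / 3) :
    0 < (1 / 2 : ℝ) * deriv (fun s => deriv (fun t =>
      ((A + 2 * B * (s + t) + C * (s + t) ^ 2) /
        (√(A + 2 * B * (s + t) + C * (s + t) ^ 2) - (b₀ + b₁ * (s + t)))) ^ 2) 0) 0 := by
  have hs : 0 < √A := Real.sqrt_pos.2 hA
  have h3 : √A ^ 2 = A := Real.sq_sqrt hA.le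
  have hlin : ∀ r : ℝ, HasDerivAt (fun r : ℝ => b₀ + b₁ * r) b₁ r := fun r => by
    simpa using ((hasDerivAt_id r).const_mul b₁).const_add b₀
  have hu0 : 0 < √A - b₀ := by linarith [le_abs_self b₀]
  have hv0 : 0 < √A - 2 * b₀ := by linarith [le_abs_self b₀]
  have hu : ∀ r, 0 < A + 2 * B * r + C * r ^ 2 → HasDerivAt
      (fun r => √(A + 2 * B * r + C * r ^ 2) - (b₀ + b₁ * r))
      ((B + C * r) / √(A + 2 * B * r + C * r ^ 2) - b₁) r := fun r hr =>
    (hasDerivAt_sqrt_quadratic hr).fun_sub (hlin r)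
  have hupos : ∀ᶠ r in 𝓝 (0 : ℝ), 0 < √(A + 2 * B * r + C * r ^ 2) - (b₀ + b₁ * r) := by
    have hc : Continuous fun r : ℝ => √(A + 2 * B * r + C * r ^ 2) - (b₀ + b₁ * r) := by fun_prop
    have := hc.tendsto 0
    simp only [mul_zero, ne_eq, OfNat.ofNat_ne_zero, not_false_eq_true, zero_pow, add_zero] at this
    exact this.eventually (lt_mem_nhds hu0)
  have h1 : ∀ᶠ r in 𝓝 (0 : ℝ), HasDerivAt
      (fun r => (A + 2 * B * r + C * r ^ 2) / (√(A + 2 * B * r + C * r ^ 2) - (b₀ + b₁ * r)))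
      ((2 * (B + C * r) * (√(A + 2 * B * r + C * r ^ 2) - (b₀ + b₁ * r)) -
        (A + 2 * B * r + C * r ^ 2) * ((B + C * r) / √(A + 2 * B * r + C * r ^ 2) - b₁)) /
          (√(A + 2 * B * r + C * r ^ 2) - (b₀ + b₁ * r)) ^ 2) r := by
    filter_upwards [eventually_quadratic_pos hA, hupos] with r hr hr'
    exact (hasDerivAt_quadratic r).fun_div (hu r hr) hr'.ne'
  have hA0 : 0 < A + 2 * B * 0 + C * 0 ^ 2 := by simpa using hA
  have hB : HasDerivAt (fun r : ℝ => 2 * (B + C * r)) (2 * C) 0 := by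
    simpa using (((hasDerivAt_id (0 : ℝ)).const_mul C).const_add B).const_mul 2
  have hq := hasDerivAt_quadratic (A := A) (B := B) (C := C) 0
  have h2 := ((hB.fun_mul (hu 0 hA0)).fun_sub (hq.fun_mul
    ((hasDerivAt_deriv_sqrt_quadratic (B := B) (C := C) hA).sub_const b₁))).fun_div
    ((hu 0 hA0).fun_pow 2) (by simpa using hu0.ne')
  rw [half_deriv_deriv_sq h1 h2]
  simp only [mul_zero, ne_eq, OfNat.ofNat_ne_zero, not_false_eq_true, zero_pow, add_zero]
  set a := √A with ha
  have e : ∀ D : ℝ, D = (A * C - B ^ 2) / a ^ 3 →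
      ((2 * C * (a - b₀) + 2 * B * (B / a - b₁) - (2 * B * (B / a - b₁) + A * D)) * (a - b₀) ^ 2 -
        (2 * B * (a - b₀) - A * (B / a - b₁)) *
          (((2 : ℕ) : ℝ) * (a - b₀) ^ (2 - 1) * (B / a - b₁))) / ((a - b₀) ^ 2) ^ 2 =
      2 * (B / a * (a - b₀) - a * (B / a - b₁)) ^ 2 / (a - b₀) ^ 3 +
        a * D * (a - 2 * b₀) / (a - b₀) ^ 2 := by
    intro D hD
    have hC' : C = (B ^ 2 + D * a ^ 3) / a ^ 2 := by
      rw [hD, h3]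
      field_simp
      ring
    rw [hC', ← h3]
    push_cast
    field_simp
    ring
  rw [e _ rfl]
  rcases hC with hC | ⟨c, hc, rfl, rfl, rfl⟩
  · have : 0 < (A * C - B ^ 2) / a ^ 3 := div_pos (by linarith) (by positivity)
    positivity
  · have e1 : (2 * (c * A) * (a - b₀) - A * (c * A / a - c * b₀)) / (a - b₀) ^ 2 =
        c * a ^ 2 / (a - b₀) := by
      rw [← h3]
      field_simp
      ring
    have e2 : A * (c ^ 2 * A) - (c * A) ^ 2 = 0 := by ring
    rw [e1, e2, zero_div, mul_zero, zero_mul, zero_div, add_zero]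
    positivity

end Convexity

/-! ### The Levi-Civita product of a metric Lie algebra -/

section Koszul

variable {V : Type*} [AddCommGroup V] [Module ℝ V] [FiniteDimensional ℝ V]

/-- Existence of the torsion-free metric product, by the Koszul formula
`2 ⟨Ω a b, c⟩ = ⟨[a, b], c⟩ - ⟨[b, c], a⟩ + ⟨[c, a], b⟩`. A linear form `⟨X, ·⟩` vanishes on its
values if `X` is orthogonal to all brackets and `ad X` is skew-symmetric. -/
lemma exists_koszul_product (B : V →ₗ[ℝ] V →ₗ[ℝ] ℝ) (hsymm : ∀ a b, B a b = B b a)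
    (hpos : ∀ a, a ≠ 0 → 0 < B a a) (br : V →ₗ[ℝ] V →ₗ[ℝ] V) (hbr : ∀ a, br a a = 0) :
    ∃ Ω : V →ₗ[ℝ] V →ₗ[ℝ] V, (∀ a b, Ω a b - Ω b a = br a b) ∧ (∀ a b, B b (Ω a b) = 0) ∧
      ∀ X, (∀ a b, B X (br a b) = 0) → (∀ a, B a (br X a) = 0) → ∀ a b, B X (Ω a b) = 0 := by
  have hskew : ∀ a b, br a b = -br b a := fun a b => by
    have h := hbr (a + b)
    simp only [map_add, LinearMap.add_apply, hbr, zero_add, add_zero] at h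
    exact eq_neg_of_add_eq_zero_right h
  have hinj : Function.Injective B := by
    rw [← LinearMap.ker_eq_bot, LinearMap.ker_eq_bot']
    intro a ha
    by_contra hne
    have h := hpos a hne
    rw [ha] at h
    exact lt_irrefl _ h
  let R := LinearEquiv.ofInjectiveOfFinrankEq B hinj (Subspace.dual_finrank_eq (K := ℝ)).symm
  have hR : ∀ (f : V →ₗ[ℝ] ℝ) c, B (R.symm f) c = f c := fun f c => by
    have h : R (R.symm f) = f := R.apply_symm_apply f
    exact congrArg (fun f : V →ₗ[ℝ] ℝ => f c) h
  -- half the right-hand side of the Koszul formula, as a linear form in `c`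
  let K : V →ₗ[ℝ] V →ₗ[ℝ] V →ₗ[ℝ] ℝ := LinearMap.mk₂ ℝ
    (fun a b => (1 / 2 : ℝ) • (B (br a b) - B a ∘ₗ br b + B b ∘ₗ br.flip a))
    (fun a a' b => by ext c; simp; ring) (fun r a b => by ext c; simp; ring)
    (fun a b b' => by ext c; simp; ring) (fun r a b => by ext c; simp; ring)
  have hK : ∀ a b c, K a b c = 1 / 2 * (B (br a b) c - B a (br b c) + B b (br c a)) :=
    fun a b c => by simp [K]; ring
  let Ω : V →ₗ[ℝ] V →ₗ[ℝ] V := K.compr₂ R.symm.toLinearMap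
  have hΩ : ∀ a b c, B (Ω a b) c = 1 / 2 * (B (br a b) c - B a (br b c) + B b (br c a)) :=
    fun a b c => by rw [← hK]; exact hR _ _
  refine ⟨Ω, fun a b => hinj ?_, fun a b => ?_, fun X h1 h2 a b => ?_⟩
  · ext c
    rw [map_sub, LinearMap.sub_apply, hΩ, hΩ, hskew b a, hskew c b, hskew c a]
    simp only [map_neg, LinearMap.neg_apply]
    ring
  · rw [hsymm, hΩ, hbr, map_zero, hskew b a, map_neg, hsymm b]
    ring
  · have h3 : B a (br X b) + B b (br X a) = 0 := by
      have h := h2 (a + b)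
      simp only [map_add, LinearMap.add_apply] at h
      linarith [h2 a, h2 b]
    rw [hsymm, hΩ, hsymm _ X, h1, hskew b X, map_neg]
    linarith

end Koszul

/-! ### Construction of the Randers and Matsumoto metrics -/

section Construction

variable {E : Type*} [NormedAddCommGroup E] [NormedSpace ℝ E]

/-- Restriction of a scalar product to a line `y + r w` with `w ≠ 0`: strict Cauchy–Schwarz unless
the line passes through the origin. -/
lemma cauchySchwarz_alternative {B : E →L[ℝ] E →L[ℝ] ℝ} (hsymm : ∀ a b, B a b = B b a)
    (hpos : ∀ a, a ≠ 0 → 0 < B a a) {y w : E} (hy : y ≠ 0) (hw : w ≠ 0) :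
    B y w ^ 2 < B y y * B w w ∨ ∃ c : ℝ, c ≠ 0 ∧ w = c • y := by
  by_cases h : B y y • w - B y w • y = 0
  · right
    have h1 : w = (B y w / B y y) • y := by
      rw [div_eq_inv_mul, mul_smul, ← sub_eq_zero.1 h, inv_smul_smul₀ (hpos y hy).ne']
    refine ⟨_, fun h0 => hw ?_, h1⟩
    rw [h1, h0, zero_smul]
  · left
    have h1 := hpos _ h
    simp only [map_sub, map_smul, _root_.sub_apply, _root_.smul_apply, smul_eq_mul] at h1
    rw [hsymm w y] at h1
    have h2 : 0 < B y y * (B y y * B w w - B y w ^ 2) := by linarith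
    linarith [pos_of_mul_pos_right h2 (hpos y hy).le]

lemma apply_smul_smul (B : E →L[ℝ] E →L[ℝ] ℝ) (c : ℝ) (x : E) :
    B (c • x) (c • x) = c ^ 2 * B x x := by
  simp only [map_smul, _root_.smul_apply, smul_eq_mul]
  ring

lemma sq_apply_le {B : E →L[ℝ] E →L[ℝ] ℝ} (hsymm : ∀ a b, B a b = B b a)
    (hpos : ∀ a, a ≠ 0 → 0 < B a a) (y w : E) : B y w ^ 2 ≤ B y y * B w w := by
  rcases eq_or_ne y 0 with rfl | hy
  · simp
  rcases eq_or_ne w 0 with rfl | hw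
  · simp
  rcases cauchySchwarz_alternative hsymm hpos hy hw with h | ⟨c, -, rfl⟩
  · exact h.le
  · simp only [map_smul, _root_.smul_apply, smul_eq_mul]
    exact le_of_eq (by ring)

variable {M : Type*} [TopologicalSpace M] [ChartedSpace E M] [IsManifold 𝓘(ℝ, E) ∞ M]

lemma contMDiff_inner_field (g : RiemMetric E M) {Y : ∀ p : M, TangentSpace 𝓘(ℝ, E) p}
    (hY : ContMDiff 𝓘(ℝ, E) 𝓘(ℝ, E).tangent ∞
      (fun p => (⟨p, Y p⟩ : TangentBundle 𝓘(ℝ, E) M))) :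
    ContMDiff 𝓘(ℝ, E).tangent 𝓘(ℝ, ℝ) ∞
      (fun v : TangentBundle 𝓘(ℝ, E) M => g.inner v.1 (Y v.1) v.2) := by
  have hπ : ContMDiff 𝓘(ℝ, E).tangent 𝓘(ℝ, E) ∞
    (fun v : TangentBundle 𝓘(ℝ, E) M => v.1) := contMDiff_proj _
  have h : ContMDiff 𝓘(ℝ, E).tangent (𝓘(ℝ, E).prod 𝓘(ℝ, ℝ)) ∞
      (fun v : TangentBundle 𝓘(ℝ, E) M =>
        TotalSpace.mk' ℝ (E := Bundle.Trivial M ℝ) v.1 (g.inner v.1 (Y v.1) v.2)) := by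
    apply ContMDiff.clm_bundle_apply₂ (F₁ := E) (F₂ := E)
    · exact g.contMDiff.comp hπ
    · exact hY.comp hπ
    · exact contMDiff_id
  intro v
  have h' := h v
  simp only [contMDiffAt_totalSpace] at h'
  exact h'.2

lemma contMDiff_inner_self (g : RiemMetric E M) :
    ContMDiff 𝓘(ℝ, E).tangent 𝓘(ℝ, ℝ) ∞
      (fun v : TangentBundle 𝓘(ℝ, E) M => g.inner v.1 v.2 v.2) := by
  have hπ : ContMDiff 𝓘(ℝ, E).tangent 𝓘(ℝ, E) ∞
    (fun v : TangentBundle 𝓘(ℝ, E) M => v.1) := contMDiff_proj _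
  have h : ContMDiff 𝓘(ℝ, E).tangent (𝓘(ℝ, E).prod 𝓘(ℝ, ℝ)) ∞
      (fun v : TangentBundle 𝓘(ℝ, E) M =>
        TotalSpace.mk' ℝ (E := Bundle.Trivial M ℝ) v.1 (g.inner v.1 v.2 v.2)) := by
    apply ContMDiff.clm_bundle_apply₂ (F₁ := E) (F₂ := E)
    · exact g.contMDiff.comp hπ
    · exact contMDiff_id
    · exact contMDiff_id
  intro v
  have h' := h v
  simp only [contMDiffAt_totalSpace] at h'
  exact h'.2

lemma contMDiffOn_alpha (g : RiemMetric E M) :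
    ContMDiffOn 𝓘(ℝ, E).tangent 𝓘(ℝ, ℝ) ∞ (alpha g) {v | v.2 ≠ 0} := by
  intro v hv
  exact ((Real.contDiffAt_sqrt (g.pos v.1 v.2 hv).ne').contMDiffAt.comp v
    (contMDiff_inner_self g v)).contMDiffWithinAt

/-- The values of `g` on the vectors `y + r w`. -/
lemma inner_line (B : E →L[ℝ] E →L[ℝ] ℝ) (hsymm : ∀ a b, B a b = B b a) (y w : E) (s t : ℝ) :
    B (y + s • w + t • w) (y + s • w + t • w) =
      B y y + 2 * B y w * (s + t) + B w w * (s + t) ^ 2 := by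
  simp only [map_add, map_smul, _root_.add_apply, _root_.smul_apply, smul_eq_mul, hsymm w y]
  ring

lemma line_apply (f : E →L[ℝ] ℝ) (y w : E) (s t : ℝ) :
    f (y + s • w + t • w) = f y + f w * (s + t) := by
  simp only [map_add, map_smul, smul_eq_mul]
  ring

lemma alpha_smul (g : RiemMetric E M) (p : M) (y : TangentSpace 𝓘(ℝ, E) p) {c : ℝ} (hc : 0 < c) :
    alpha g ⟨p, c • y⟩ = c * alpha g ⟨p, y⟩ := by
  simp only [alpha]
  rw [map_smul, map_smul, _root_.smul_apply, smul_eq_mul, smul_eq_mul, ← mul_assoc,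
    Real.sqrt_mul (by positivity), Real.sqrt_mul_self hc.le]

lemma randers_hessian_pos_line {B : E →L[ℝ] E →L[ℝ] ℝ} (hsymm : ∀ a b, B a b = B b a)
    (hpos : ∀ a, a ≠ 0 → 0 < B a a) {X y w : E} (hy : y ≠ 0) (hw : w ≠ 0)
    (hb : |B X y| ≤ √(B y y) / 3) :
    0 < (1 / 2 : ℝ) * deriv (fun s : ℝ => deriv (fun t : ℝ =>
      (√(B (y + s • w + t • w) (y + s • w + t • w)) +
        B X (y + s • w + t • w)) ^ 2) 0) 0 := by
  refine lt_of_lt_of_eq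
    (randers_hessian_pos (B := B y w) (C := B w w) (b₁ := B X w) (hpos y hy) ?_ hb)
    (by simp only [inner_line B hsymm, line_apply (B X)])
  rcases cauchySchwarz_alternative hsymm hpos hy hw with h | ⟨c, hc, rfl⟩
  · exact Or.inl h
  · refine Or.inr ⟨c, hc, ?_⟩
    simp only [map_smul, _root_.smul_apply, smul_eq_mul, true_and, and_true]
    ring

lemma matsumoto_hessian_pos_line {B : E →L[ℝ] E →L[ℝ] ℝ} (hsymm : ∀ a b, B a b = B b a)
    (hpos : ∀ a, a ≠ 0 → 0 < B a a) {X y w : E} (hy : y ≠ 0) (hw : w ≠ 0)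
    (hb : |B X y| ≤ √(B y y) / 3) :
    0 < (1 / 2 : ℝ) * deriv (fun s : ℝ => deriv (fun t : ℝ =>
      (√(B (y + s • w + t • w) (y + s • w + t • w)) ^ 2 /
        (√(B (y + s • w + t • w) (y + s • w + t • w)) - B X (y + s • w + t • w))) ^ 2) 0) 0 := by
  have hnn : ∀ a, 0 ≤ B a a := fun a => by
    rcases eq_or_ne a 0 with rfl | ha
    · simp
    · exact (hpos a ha).le
  simp only [Real.sq_sqrt (hnn _)]
  refine lt_of_lt_of_eq
    (matsumoto_hessian_pos (B := B y w) (C := B w w) (b₁ := B X w) (hpos y hy) ?_ hb)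
    (by simp only [inner_line B hsymm, line_apply (B X)])
  rcases cauchySchwarz_alternative hsymm hpos hy hw with h | ⟨c, hc, rfl⟩
  · exact Or.inl h
  · refine Or.inr ⟨c, hc, ?_⟩
    simp only [map_smul, _root_.smul_apply, smul_eq_mul, true_and, and_true]
    ring

/-- `α + β` is a Finsler metric if `|β| ≤ α / 3`. -/
lemma isFinslerMetric_randers (g : RiemMetric E M) {Y : ∀ p : M, TangentSpace 𝓘(ℝ, E) p}
    (hY : ContMDiff 𝓘(ℝ, E) 𝓘(ℝ, E).tangent ∞
      (fun p => (⟨p, Y p⟩ : TangentBundle 𝓘(ℝ, E) M)))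
    (hb : ∀ v : TangentBundle 𝓘(ℝ, E) M, |g.inner v.1 (Y v.1) v.2| ≤ alpha g v / 3) :
    IsFinslerMetric (fun v => alpha g v + g.inner v.1 (Y v.1) v.2) where
  nonneg v := by
    have h := abs_le.1 (hb v)
    have h2 : 0 ≤ alpha g v := Real.sqrt_nonneg _
    linarith
  smooth := (contMDiffOn_alpha g).add (contMDiff_inner_field g hY).contMDiffOn
  homogeneous p y c hc := by
    rw [alpha_smul g p y hc, map_smul, smul_eq_mul]
    dsimp only
    ring
  posDef p y w hy hw :=
    randers_hessian_pos_line (E := E) (B := g.inner p) (X := Y p) (g.symm p) (g.pos p) hy hw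
      (hb ⟨p, y⟩)

/-- `α² / (α - β)` is a Finsler metric if `|β| ≤ α / 3`. -/
lemma isFinslerMetric_matsumoto (g : RiemMetric E M) {Y : ∀ p : M, TangentSpace 𝓘(ℝ, E) p}
    (hY : ContMDiff 𝓘(ℝ, E) 𝓘(ℝ, E).tangent ∞
      (fun p => (⟨p, Y p⟩ : TangentBundle 𝓘(ℝ, E) M)))
    (hb : ∀ v : TangentBundle 𝓘(ℝ, E) M, |g.inner v.1 (Y v.1) v.2| ≤ alpha g v / 3) :
    IsFinslerMetric (fun v => alpha g v ^ 2 / (alpha g v - g.inner v.1 (Y v.1) v.2)) where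
  nonneg v := by
    have h := abs_le.1 (hb v)
    have h2 : 0 ≤ alpha g v := Real.sqrt_nonneg _
    exact div_nonneg (by positivity) (by linarith)
  smooth := by
    refine ((contMDiffOn_alpha g).pow 2).div₀
      ((contMDiffOn_alpha g).sub (contMDiff_inner_field g hY).contMDiffOn) fun v hv => ?_
    have h := abs_le.1 (hb v)
    have h2 : 0 < alpha g v := Real.sqrt_pos.2 (g.pos v.1 v.2 hv)
    exact (by linarith : 0 < alpha g v - g.inner v.1 (Y v.1) v.2).ne'
  homogeneous p y c hc := by
    rw [alpha_smul g p y hc, map_smul, smul_eq_mul]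
    dsimp only
    rw [← mul_sub, mul_pow, pow_two c, mul_assoc, mul_div_mul_left _ _ hc.ne', mul_div_assoc]
  posDef p y w hy hw :=
    matsumoto_hessian_pos_line (E := E) (B := g.inner p) (X := Y p) (g.symm p) (g.pos p) hy hw
      (hb ⟨p, y⟩)

end Construction

section LeftInvariantConstruction

variable {E : Type*} [NormedAddCommGroup E] [NormedSpace ℝ E]
  {G : Type*} [Group G] [TopologicalSpace G] [ChartedSpace E G] [LieGroup 𝓘(ℝ, E) ∞ G]
  {g : RiemMetric E G}

omit [LieGroup 𝓘(ℝ, E) ∞ G] in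
lemma mulInvariantVectorField_apply_one (X : GroupLieAlgebra 𝓘(ℝ, E) G) :
    mulInvariantVectorField X (1 : G) = X := by
  have h : (fun q : G => 1 * q) = id := funext one_mul
  have h2 : ∀ f : G → G, f = id → ∀ r : G, (mfderiv 𝓘(ℝ, E) 𝓘(ℝ, E) f r : E →L[ℝ] E) =
      ContinuousLinearMap.id ℝ E := by
    rintro _ rfl r; exact mfderiv_id
  exact congrArg (fun D : E →L[ℝ] E => D X) (h2 _ h 1)

lemma inner_mulInvariantVectorField (hg : IsLeftInvariantRiem g)
    (X : GroupLieAlgebra 𝓘(ℝ, E) G) (a p : G) (y : TangentSpace 𝓘(ℝ, E) p) :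
    g.inner (a * p) (mulInvariantVectorField X (a * p))
      (mfderiv 𝓘(ℝ, E) 𝓘(ℝ, E) (fun q : G => a * q) p y) =
        g.inner p (mulInvariantVectorField X p) y := by
  -- the base points `p * 1` and `p` are not definitionally equal
  have h1 : ∀ r, r = p → (mfderiv 𝓘(ℝ, E) 𝓘(ℝ, E) (fun q : G => a * q) r
      (mfderiv 𝓘(ℝ, E) 𝓘(ℝ, E) (fun q : G => p * q) 1 X) : E) =
      mfderiv 𝓘(ℝ, E) 𝓘(ℝ, E) (fun q : G => a * q) p
      (mfderiv 𝓘(ℝ, E) 𝓘(ℝ, E) (fun q : G => p * q) 1 X) := by rintro _ rfl; rfl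
  have h2 : (mulInvariantVectorField X (a * p) : E) =
      mfderiv 𝓘(ℝ, E) 𝓘(ℝ, E) (fun q : G => a * q) p (mulInvariantVectorField X p) :=
    (mfderiv_mul_left_comp (E := E) a p 1 X).symm.trans (h1 _ (mul_one p))
  let B : E →L[ℝ] E →L[ℝ] ℝ := g.inner (a * p)
  exact (congrArg (fun u => B u _) h2).trans (hg a p _ y)

lemma isNonzeroVectorField_mulInvariantVectorField {X : GroupLieAlgebra 𝓘(ℝ, E) G} (hX : X ≠ 0) :
    IsNonzeroVectorField (mulInvariantVectorField (I := 𝓘(ℝ, E)) (G := G) X) := by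
  refine ⟨contMDiff_infty_mulInvariantVectorField X, 1, ?_⟩
  rwa [mulInvariantVectorField_apply_one]

/-- A small multiple of a left-invariant vector field has norm `1 / 3`, as the norm is constant; by
the Cauchy–Schwarz inequality, its scalar product with a unit vector is at most `1 / 3`. -/
lemma exists_smul_abs_inner_le (hg : IsLeftInvariantRiem g) {X : GroupLieAlgebra 𝓘(ℝ, E) G}
    (hX : X ≠ 0) : ∃ c : ℝ, c ≠ 0 ∧ ∀ v : TangentBundle 𝓘(ℝ, E) G,
      |g.inner v.1 (mulInvariantVectorField (c • X) v.1) v.2| ≤ alpha g v / 3 := by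
  have hpos : 0 < innerOne g X X := innerOne_pos g hX
  refine ⟨(3 * √(innerOne g X X))⁻¹, by positivity, fun ⟨p, y⟩ => ?_⟩
  set c := (3 * √(innerOne g X X))⁻¹ with hc
  have h1 := sq_apply_le (E := E) (B := g.inner p) (g.symm p) (g.pos p)
    (mulInvariantVectorField (c • X) p) y
  have h2 : g.inner p (mulInvariantVectorField (c • X) p) (mulInvariantVectorField (c • X) p) =
      1 / 9 := by
    have h3 : ∀ r, r = p → g.inner r (mulInvariantVectorField (c • X) r)
        (mulInvariantVectorField (c • X) r) = g.inner p (mulInvariantVectorField (c • X) p)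
        (mulInvariantVectorField (c • X) p) := by rintro _ rfl; rfl
    have h4 : innerOne g (c • X : E) (c • X : E) = 1 / 9 := by
      refine (apply_smul_smul (innerOne g) c X).trans ?_
      have h5 := Real.mul_self_sqrt hpos.le
      rw [hc]
      have h6 : 0 < √(innerOne g X X) := Real.sqrt_pos.2 hpos
      field_simp
      linarith
    have h7 := hg p 1 (c • X) (c • X)
    have h8 : ∀ r, r = p → g.inner r (mulInvariantVectorField (c • X) p : E)
        (mulInvariantVectorField (c • X) p : E) = g.inner p (mulInvariantVectorField (c • X) p)
        (mulInvariantVectorField (c • X) p) := by rintro _ rfl; rfl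
    exact ((h8 _ (mul_one p)).symm.trans h7).trans h4
  replace h1 := h1.trans_eq (congrArg (· * g.inner p y y) h2)
  refine abs_le_of_sq_le_sq (le_of_le_of_eq h1 ?_) (div_nonneg (Real.sqrt_nonneg _) (by norm_num))
  rw [div_pow, alpha, Real.sq_sqrt]
  · ring
  · rcases eq_or_ne y 0 with rfl | hy
    · simp
    · exact (g.pos p y hy).le

/-- The Lie bracket of the Lie algebra of `G`, as a bilinear map on the model space. -/
def bracketOne (E : Type*) [NormedAddCommGroup E] [NormedSpace ℝ E] [CompleteSpace E]
    (G : Type*) [Group G] [TopologicalSpace G] [ChartedSpace E G] [LieGroup 𝓘(ℝ, E) ∞ G] :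
    E →ₗ[ℝ] E →ₗ[ℝ] E :=
  have := lieGroup_minSmoothness (E := E) (G := G)
  LinearMap.mk₂ ℝ
    (fun a b => (⁅(show GroupLieAlgebra 𝓘(ℝ, E) G from a),
      (show GroupLieAlgebra 𝓘(ℝ, E) G from b)⁆ : GroupLieAlgebra 𝓘(ℝ, E) G))
    (fun a b c => add_lie (L := GroupLieAlgebra 𝓘(ℝ, E) G) (M := GroupLieAlgebra 𝓘(ℝ, E) G) a b c)
    (fun r a b => smul_lie (L := GroupLieAlgebra 𝓘(ℝ, E) G) (M := GroupLieAlgebra 𝓘(ℝ, E) G) r a b)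
    (fun a b c => lie_add (L := GroupLieAlgebra 𝓘(ℝ, E) G) (M := GroupLieAlgebra 𝓘(ℝ, E) G) a b c)
    (fun r a b => lie_smul (L := GroupLieAlgebra 𝓘(ℝ, E) G) (M := GroupLieAlgebra 𝓘(ℝ, E) G) r a b)

lemma bracketOne_self [CompleteSpace E] (a : E) : bracketOne E G a a = 0 := by
  have := lieGroup_minSmoothness (E := E) (G := G)
  exact lie_self (L := GroupLieAlgebra 𝓘(ℝ, E) G) a

lemma bracketOne_skew [CompleteSpace E] (a b : E) : bracketOne E G a b = -bracketOne E G b a := by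
  have h := bracketOne_self (G := G) (a + b)
  simp only [map_add, LinearMap.add_apply, bracketOne_self, zero_add, add_zero] at h
  exact eq_neg_of_add_eq_zero_right h

lemma bracketOne_jacobi [CompleteSpace E] (a b c : E) :
    bracketOne E G a (bracketOne E G b c) =
      bracketOne E G (bracketOne E G a b) c + bracketOne E G b (bracketOne E G a c) := by
  have := lieGroup_minSmoothness (E := E) (G := G)
  exact leibniz_lie (show GroupLieAlgebra 𝓘(ℝ, E) G from a) (show GroupLieAlgebra 𝓘(ℝ, E) G from b)
    (show GroupLieAlgebra 𝓘(ℝ, E) G from c)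

/-- The conditions of `IsParallelVector`, with all vectors in the model space. -/
lemma isParallelVector_iff [CompleteSpace E] {X : E} :
    IsParallelVector (G := G) g X ↔ X ≠ 0 ∧ (∀ a b, innerOne g X (bracketOne E G a b) = 0) ∧
      ∀ a, innerOne g a (bracketOne E G X a) = 0 :=
  ⟨fun h => ⟨h.1, h.2, h.3⟩, fun h => ⟨h.1, h.2.1, h.2.2⟩⟩

lemma IsParallelVector.smul [CompleteSpace E] {X : E} (hX : IsParallelVector (G := G) g X) {c : ℝ}
    (hc : c ≠ 0) : IsParallelVector (G := G) g (c • X : E) := by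
  rw [isParallelVector_iff] at hX ⊢
  refine ⟨smul_ne_zero hc hX.1, fun a b => ?_, fun a => ?_⟩
  · rw [map_smul, _root_.smul_apply, hX.2.1, smul_zero]
  · rw [map_smul, LinearMap.smul_apply, map_smul, hX.2.2, smul_zero]

/-- The Levi-Civita product of the Lie algebra preserves the linear form given by a parallel
vector. -/
lemma IsParallelVector.exists_product [FiniteDimensional ℝ E] [CompleteSpace E]
    {X : GroupLieAlgebra 𝓘(ℝ, E) G}
    (hX : IsParallelVector g X) :
    ∃ Ω : E →ₗ[ℝ] E →ₗ[ℝ] E, (∀ a b : GroupLieAlgebra 𝓘(ℝ, E) G,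
      Ω a b - Ω b a = (⁅a, b⁆ : GroupLieAlgebra 𝓘(ℝ, E) G)) ∧
      (∀ a b, innerOne g b (Ω a b) = 0) ∧ ∀ a b, innerOne g X (Ω a b) = 0 := by
  obtain ⟨Ω, h1, h2, h3⟩ := exists_koszul_product (V := E)
    ((innerOne g).toLinearMap₁₂) (innerOne_symm g)
    (fun a ha => innerOne_pos g ha) (bracketOne E G) bracketOne_self
  exact ⟨Ω, h1, h2, h3 X hX.inner_bracket hX.skew⟩

/-- The Levi-Civita product shows that the Randers metric of a small multiple of a parallel vector
is of Berwald type. -/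
lemma IsParallelVector.admitsBerwaldRanders [FiniteDimensional ℝ E]
    (hg : IsLeftInvariantRiem g) {X : GroupLieAlgebra 𝓘(ℝ, E) G} (hX : IsParallelVector g X) :
    AdmitsBerwaldRanders g := by
  have := FiniteDimensional.complete ℝ E
  obtain ⟨Y, hX', hb⟩ : ∃ Y, IsParallelVector g Y ∧ ∀ v : TangentBundle 𝓘(ℝ, E) G,
      |g.inner v.1 (mulInvariantVectorField Y v.1) v.2| ≤ alpha g v / 3 := by
    obtain ⟨c, hc, hb⟩ := exists_smul_abs_inner_le hg hX.ne_zero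
    exact ⟨_, hX.smul hc, hb⟩
  have hF := isFinslerMetric_randers g (contMDiff_infty_mulInvariantVectorField Y) hb
  have hl : IsLeftInvariantFinsler (E := E) (G := G)
      (fun v => alpha g v + g.inner v.1 (mulInvariantVectorField Y v.1) v.2) := fun a p y => by
    dsimp only
    rw [alpha_mfderiv_mul_left hg]
    exact congrArg _ (inner_mulInvariantVectorField hg Y a p y)
  refine ⟨_, ⟨hF, mulInvariantVectorField Y,
    isNonzeroVectorField_mulInvariantVectorField hX'.ne_zero, fun v => rfl⟩, hl,
    (isBerwald_iff hF hl).2 ?_⟩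
  obtain ⟨Ω, h1, h2, h3⟩ := hX'.exists_product
  refine ⟨Ω, h1, fun b hb a => ?_⟩
  have hF' : (fun y : E => alpha g ⟨1, y⟩ + g.inner 1 (mulInvariantVectorField Y (1 : G)) y) =
      fun y => √(innerOne g y y) + innerOne g Y y := by
    rw [mulInvariantVectorField_apply_one]; rfl
  have h4 := (hasFDerivAt_sqrt_innerOne g hb).fun_add (innerOne g Y).hasFDerivAt
  have h5 := (congrArg (fun f => fderiv ℝ f b) hF').trans h4.fderiv
  refine (congrArg (fun D : E →L[ℝ] ℝ => D (Ω a b)) h5).trans ?_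
  simp [h2, h3]

/-- The Levi-Civita product shows that the Matsumoto metric of a small multiple of a parallel vector
is of Berwald type. -/
lemma IsParallelVector.admitsBerwaldMatsumoto [FiniteDimensional ℝ E]
    (hg : IsLeftInvariantRiem g) {X : GroupLieAlgebra 𝓘(ℝ, E) G} (hX : IsParallelVector g X) :
    AdmitsBerwaldMatsumoto g := by
  have := FiniteDimensional.complete ℝ E
  obtain ⟨Y, hX', hb⟩ : ∃ Y, IsParallelVector g Y ∧ ∀ v : TangentBundle 𝓘(ℝ, E) G,
      |g.inner v.1 (mulInvariantVectorField Y v.1) v.2| ≤ alpha g v / 3 := by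
    obtain ⟨c, hc, hb⟩ := exists_smul_abs_inner_le hg hX.ne_zero
    exact ⟨_, hX.smul hc, hb⟩
  have hF := isFinslerMetric_matsumoto g (contMDiff_infty_mulInvariantVectorField Y) hb
  have hl : IsLeftInvariantFinsler (E := E) (G := G)
      (fun v => alpha g v ^ 2 / (alpha g v - g.inner v.1 (mulInvariantVectorField Y v.1) v.2)) :=
    fun a p y => by
    dsimp only
    rw [alpha_mfderiv_mul_left hg]
    exact congrArg (fun r => alpha g ⟨p, y⟩ ^ 2 / (alpha g ⟨p, y⟩ - r))
      (inner_mulInvariantVectorField hg Y a p y)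
  refine ⟨_, ⟨hF, mulInvariantVectorField Y,
    isNonzeroVectorField_mulInvariantVectorField hX'.ne_zero, fun v => rfl⟩, hl,
    (isBerwald_iff hF hl).2 ?_⟩
  obtain ⟨Ω, h1, h2, h3⟩ := hX'.exists_product
  refine ⟨Ω, h1, fun b hb' a => ?_⟩
  have hF' : (fun y : E => alpha g ⟨1, y⟩ ^ 2 /
      (alpha g ⟨1, y⟩ - g.inner 1 (mulInvariantVectorField Y (1 : G)) y)) =
      fun y => √(innerOne g y y) ^ 2 * (√(innerOne g y y) - innerOne g Y y)⁻¹ := by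
    rw [mulInvariantVectorField_apply_one]; rfl
  have h0 : √(innerOne g b b) - innerOne g Y b ≠ 0 := by
    have h6 := hb ⟨1, b⟩
    rw [mulInvariantVectorField_apply_one] at h6
    have h7 : |innerOne g Y b| ≤ √(innerOne g b b) / 3 := h6
    have h8 : 0 < √(innerOne g b b) := Real.sqrt_pos.2 (innerOne_pos g hb')
    linarith [(abs_le.1 h7).2]
  have h4 := ((hasFDerivAt_sqrt_innerOne g hb').pow 2).fun_mul
    ((hasDerivAt_inv h0).comp_hasFDerivAt b
      ((hasFDerivAt_sqrt_innerOne g hb').fun_sub (innerOne g Y).hasFDerivAt))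
  have h5 := (congrArg (fun f => fderiv ℝ f b) hF').trans h4.fderiv
  refine (congrArg (fun D : E →L[ℝ] ℝ => D (Ω a b)) h5).trans ?_
  simp [h2, h3]

end LeftInvariantConstruction

/-! ### Three-dimensional metric Lie algebras with a parallel vector -/

section Algebra

variable {V : Type*} [AddCommGroup V] [Module ℝ V]

/-- An orthonormal basis whose first vector is proportional to a given one. -/
lemma exists_orthonormal_frame (hdim : Module.finrank ℝ V = 3) {B : V →ₗ[ℝ] V →ₗ[ℝ] ℝ}
    (hsymm : ∀ a b, B a b = B b a) (hpos : ∀ a, a ≠ 0 → 0 < B a a) {X : V} (hX : X ≠ 0) :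
    ∃ (n u v : V) (r : ℝ), r ≠ 0 ∧ X = r • n ∧ B n n = 1 ∧ B u u = 1 ∧ B v v = 1 ∧ B n u = 0 ∧
      B n v = 0 ∧ B u v = 0 ∧ ∀ w, w = B n w • n + B u w • u + B v w • v := by
  let core : InnerProductSpace.Core ℝ V :=
    { inner := fun a b => B a b
      conj_inner_symm := fun a b => hsymm b a
      re_inner_nonneg := fun a => by
        rcases eq_or_ne a 0 with rfl | ha
        · simp
        · exact (hpos a ha).le
      add_left := fun a b c => by simp
      smul_left := fun a b r => by simp
      definite := fun a h => by
        by_contra ha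
        exact (hpos a ha).ne' h }
  let : NormedAddCommGroup V := core.toNormedAddCommGroup
  let : InnerProductSpace ℝ V := InnerProductSpace.ofCore core.toCore
  have hB : ∀ a b : V, inner ℝ a b = B a b := fun a b => rfl
  have : FiniteDimensional ℝ V := Module.finite_of_finrank_pos (by omega)
  have hn : ‖X‖ ≠ 0 := norm_ne_zero_iff.2 hX
  obtain ⟨b, hb⟩ := Orthonormal.exists_orthonormalBasis_extension_of_card_eq (ι := Fin 3)
    (𝕜 := ℝ) (E := V) (by simp [hdim]) (v := fun _ => ‖X‖⁻¹ • X) (s := {0}) (by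
      rw [orthonormal_iff_ite]
      rintro ⟨i, rfl⟩ ⟨j, rfl⟩
      simp only [Set.domRestrict_apply, real_inner_self_eq_norm_sq, if_true]
      rw [norm_smul, norm_inv, norm_norm, inv_mul_cancel₀ hn, one_pow])
  have ho := orthonormal_iff_ite.1 b.orthonormal
  refine ⟨b 0, b 1, b 2, ‖X‖, hn, ?_, (ho 0 0).trans (by simp), (ho 1 1).trans (by simp),
    (ho 2 2).trans (by simp), (ho 0 1).trans (by simp), (ho 0 2).trans (by simp),
    (ho 1 2).trans (by simp), fun w => ?_⟩
  · rw [hb 0 rfl, smul_inv_smul₀ hn]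
  · rw [← hB, ← hB, ← hB, ← Fin.sum_univ_three (fun i => inner ℝ (b i) w • b i)]
    exact (b.sum_repr' w).symm

/-- Three vectors whose Gram matrix is that of the classification are a basis. -/
lemma exists_basis_of_gram (hdim : Module.finrank ℝ V = 3) {B : V →ₗ[ℝ] V →ₗ[ℝ] ℝ} {x y z : V}
    {s ν : ℝ} (hs : s ^ 2 < 1) (hν : 0 < ν) (hxx : B x x = 1) (hxy : B x y = s) (hyx : B y x = s)
    (hyy : B y y = 1) (hxz : B x z = 0) (hyz : B y z = 0) (hzx : B z x = 0) (hzy : B z y = 0)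
    (hzz : B z z = ν) : ∃ e : Module.Basis (Fin 3) ℝ V, e 0 = x ∧ e 1 = y ∧ e 2 = z := by
  have : FiniteDimensional ℝ V := Module.finite_of_finrank_pos (by omega)
  have hli : LinearIndependent ℝ ![x, y, z] := by
    rw [Fintype.linearIndependent_iff]
    intro c hc
    simp only [Fin.sum_univ_three, Matrix.cons_val_zero, Matrix.cons_val_one,
      Matrix.cons_val] at hc
    have h0 := congrArg (B x) hc
    have h1 := congrArg (B y) hc
    have h2 := congrArg (B z) hc
    simp only [map_add, map_smul, map_zero, smul_eq_mul, hxx, hxy, hyx, hyy, hxz, hyz, hzx, hzy,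
      hzz] at h0 h1 h2
    have e2 : c 2 = 0 := by
      have : c 2 * ν = 0 := by linarith
      exact (mul_eq_zero.1 this).resolve_right hν.ne'
    have e0 : c 0 = 0 := by
      have : c 0 * (1 - s ^ 2) = 0 := by linear_combination h0 - s * h1
      exact (mul_eq_zero.1 this).resolve_right (by linarith)
    have e1 : c 1 = 0 := by
      rw [e0] at h1; linarith
    intro i
    fin_cases i
    · exact e0
    · exact e1
    · exact e2
  refine ⟨basisOfLinearIndependentOfCardEqFinrank hli (by simp [hdim]), ?_, ?_, ?_⟩ <;> simp

/-- The Lie algebras with a parallel vector `X`. The plane orthogonal to `X` is an ideal on which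
`ad X` acts by an infinitesimal rotation and a derivation; the three cases are: both this action
and the bracket of the plane vanish; the action does not vanish; the bracket does not vanish. -/
lemma exists_frame_of_parallel (hdim : Module.finrank ℝ V = 3) {B : V →ₗ[ℝ] V →ₗ[ℝ] ℝ}
    (hsymm : ∀ a b, B a b = B b a) (hpos : ∀ a, a ≠ 0 → 0 < B a a)
    {br : V →ₗ[ℝ] V →ₗ[ℝ] V} (hbr : ∀ a, br a a = 0)
    (hjac : ∀ a b c, br a (br b c) = br (br a b) c + br b (br a c))
    {X : V} (hX : X ≠ 0) (h1 : ∀ a b, B X (br a b) = 0) (h2 : ∀ a, B a (br X a) = 0) :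
    ∃ x y z : V, br x y = 0 ∧ B x x = 1 ∧ B y y = 1 ∧ B x z = 0 ∧ B y z = 0 ∧
      ((B x y = 0 ∧ B z z = 1 ∧ br x z = 0 ∧ br y z = 0) ∨
        (B x y = 0 ∧ 0 < B z z ∧ br x z = y ∧ br y z = -x) ∨
        (B x y = 1 / 2 ∧ 0 < B z z ∧ br x z = -y ∧ br y z = (-2 : ℝ) • y)) := by
  obtain ⟨n, u, v, r, hr, rfl, hnn, huu, hvv, hnu, hnv, huv, hw⟩ :=
    exists_orthonormal_frame hdim hsymm hpos hX
  have hskew : ∀ a b, br a b = -br b a := fun a b => by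
    have h := hbr (a + b)
    simp only [map_add, LinearMap.add_apply, hbr, zero_add, add_zero] at h
    exact eq_neg_of_add_eq_zero_right h
  replace h1 : ∀ a b, B n (br a b) = 0 := fun a b => by
    have h := h1 a b
    rw [map_smul, LinearMap.smul_apply, smul_eq_mul] at h
    exact (mul_eq_zero.1 h).resolve_left hr
  replace h2 : ∀ a, B a (br n a) = 0 := fun a => by
    have h := h2 a
    rw [map_smul, LinearMap.smul_apply, map_smul, smul_eq_mul] at h
    exact (mul_eq_zero.1 h).resolve_left hr
  have h3 : B u (br n v) = -B v (br n u) := by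
    have h := h2 (u + v)
    simp only [map_add, LinearMap.add_apply, h2] at h
    linarith
  have hun : B u n = 0 := by rw [hsymm, hnu]
  have hvn : B v n = 0 := by rw [hsymm, hnv]
  have hvu : B v u = 0 := by rw [hsymm, huv]
  obtain ⟨k, hk⟩ : ∃ k, k = B v (br n u) := ⟨_, rfl⟩
  obtain ⟨p, hp⟩ : ∃ p, p = B u (br u v) := ⟨_, rfl⟩
  obtain ⟨q, hq⟩ : ∃ q, q = B v (br u v) := ⟨_, rfl⟩
  have bnu : br n u = k • v := by
    have h := hw (br n u)
    rwa [h1, h2, ← hk, zero_smul, zero_smul, zero_add, zero_add] at h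
  have bnv : br n v = (-k) • u := by
    have h := hw (br n v)
    rwa [h1, h2, h3, ← hk, zero_smul, zero_smul, zero_add, add_zero] at h
  have buv : br u v = p • u + q • v := by
    have h := hw (br u v)
    rwa [h1, ← hp, ← hq, zero_smul, zero_add] at h
  have bun : br u n = (-k) • v := by rw [hskew, bnu, neg_smul]
  have bvn : br v n = k • u := by rw [hskew, bnv, neg_smul, neg_neg]
  have bvu : br v u = -(p • u + q • v) := by rw [hskew, buv]
  -- `ad n` is a derivation, and as it is skew-symmetric on the plane, it annihilates `[u, v]`
  have hj : (p * k) • v - (q * k) • u = 0 := by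
    have h := hjac n u v
    simp only [buv, bnu, bnv, map_add, map_smul, LinearMap.smul_apply, hbr] at h
    rw [smul_zero, smul_zero, add_zero] at h
    rw [← h]
    module
  have hpk : p * k = 0 := by
    have h := congrArg (B v) hj
    simpa [hvv, hvu] using h
  have hqk : q * k = 0 := by
    have h := congrArg (B u) hj
    simpa [huu, huv] using h
  by_cases hk0 : k = 0
  · subst hk0
    simp only [neg_zero, zero_smul] at bnu bnv bun bvn
    by_cases hm : p ^ 2 + q ^ 2 = 0
    · have hp0 : p = 0 := by nlinarith [sq_nonneg p, sq_nonneg q]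
      have hq0 : q = 0 := by nlinarith [sq_nonneg p, sq_nonneg q]
      refine ⟨u, v, n, ?_, huu, hvv, hun, hvn, Or.inl ⟨huv, hnn, bun, bvn⟩⟩
      rw [buv, hp0, hq0, zero_smul, zero_smul, add_zero]
    · have hm' : 0 < p ^ 2 + q ^ 2 := lt_of_le_of_ne (by positivity) (Ne.symm hm)
      obtain ⟨m, hmpos, hmsq⟩ : ∃ m : ℝ, 0 < m ∧ p ^ 2 + q ^ 2 = m ^ 2 :=
        ⟨_, Real.sqrt_pos.2 hm', (Real.sq_sqrt hm'.le).symm⟩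
      obtain ⟨t, ht, ht2⟩ : ∃ t : ℝ, t * 4 * t = 3 ∧ 0 < t :=
        ⟨√3 / 2, by nlinarith [Real.mul_self_sqrt (show (0 : ℝ) ≤ 3 by norm_num)], by positivity⟩
      -- `y` is a unit vector which spans the derived algebra, `z` is orthogonal to it in the plane,
      -- scaled such that `[y, z] = -2y`, and `n` is central; so `x = y / 2 + t n` with `t² = 3 / 4`
      -- satisfies `[x, z] = -y`
      refine ⟨(1 / 2 : ℝ) • (m⁻¹ • (p • u + q • v)) + t • n, m⁻¹ • (p • u + q • v),
        (-2 / m ^ 2) • (p • v - q • u), ?_⟩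
      have hm0 := hmpos.ne'
      simp only [map_add, map_sub, map_smul, LinearMap.add_apply, LinearMap.sub_apply,
        LinearMap.smul_apply, smul_eq_mul, hnn, huu, hvv, hnu, hnv, huv, hun, hvn, hvu, bnu, bnv,
        buv, bvu, hbr, mul_zero, mul_one, add_zero, zero_add, smul_zero, sub_zero]
      refine ⟨by module, ?_, ?_, ?_, ?_, Or.inr (Or.inr ⟨?_, ?_, ?_, ?_⟩)⟩
      · field_simp
        linear_combination hmsq + m ^ 2 * ht
      · field_simp
        linear_combination hmsq
      · field_simp
        ring
      · field_simp
        ring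
      · field_simp
        linear_combination hmsq
      · have e : 0 < (2 / m ^ 2) ^ 2 * (p ^ 2 + q ^ 2) := by positivity
        refine lt_of_lt_of_eq e ?_
        ring
      · transitivity (-(p ^ 2 + q ^ 2) / m ^ 2 * m⁻¹) • (p • u + q • v)
        · module
        · rw [hmsq, neg_div, div_self (pow_ne_zero 2 hm0), neg_one_mul, neg_smul]
      · transitivity (-2 * ((p ^ 2 + q ^ 2) / m ^ 2) * m⁻¹) • (p • u + q • v)
        · module
        · rw [hmsq, div_self (pow_ne_zero 2 hm0), mul_one, mul_smul]
  · have hp0 : p = 0 := (mul_eq_zero.1 hpk).resolve_right hk0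
    have hq0 : q = 0 := (mul_eq_zero.1 hqk).resolve_right hk0
    refine ⟨u, v, (-k⁻¹) • n, ?_, huu, hvv, ?_, ?_, Or.inr (Or.inl ⟨huv, ?_, ?_, ?_⟩)⟩
    · rw [buv, hp0, hq0, zero_smul, zero_smul, add_zero]
    · rw [map_smul, hun, smul_zero]
    · rw [map_smul, hvn, smul_zero]
    · simp only [map_smul, LinearMap.smul_apply, hnn, smul_eq_mul, mul_one]
      rw [neg_mul_neg]
      exact mul_self_pos.2 (inv_ne_zero hk0)
    · rw [map_smul, bun, smul_smul, neg_mul_neg, inv_mul_cancel₀ hk0, one_smul]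
    · rw [map_smul, bvn, smul_smul, neg_mul, inv_mul_cancel₀ hk0, neg_one_smul]

end Algebra

section MetricLieAlgebra

variable {G : Type*} [Group G] [TopologicalSpace G] [ChartedSpace (EuclideanSpace ℝ (Fin 3)) G]
  [LieGroup (𝓡 3) ∞ G] {g : RiemMetric (EuclideanSpace ℝ (Fin 3)) G}

lemma hasBasis_of_frame {x y z : EuclideanSpace ℝ (Fin 3)} {s ν a b c d : ℝ} (hs : s ^ 2 < 1)
    (hν : 0 < ν) (hxx : innerOne g x x = 1) (hyy : innerOne g y y = 1) (hxz : innerOne g x z = 0)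
    (hyz : innerOne g y z = 0) (hxy : innerOne g x y = s) (hzz : innerOne g z z = ν)
    (bxy : bracketOne _ G x y = 0) (bxz : bracketOne _ G x z = a • x + b • y)
    (byz : bracketOne _ G y z = c • x + d • y) :
    HasBasis g a b c d !![1, s, 0; s, 1, 0; 0, 0, ν] := by
  have hyx := (innerOne_symm g y x).trans hxy
  have hzx := (innerOne_symm g z x).trans hxz
  have hzy := (innerOne_symm g z y).trans hyz
  obtain ⟨e, rfl, rfl, rfl⟩ := exists_basis_of_gram (B := (innerOne g).toLinearMap₁₂) (by simp)
    hs hν hxx hxy hyx hyy hxz hyz hzx hzy hzz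
  refine ⟨e, bxy, bxz, byz, fun i j => ?_⟩
  fin_cases i <;> fin_cases j
  exacts [hxx, hxy, hxz, hyx, hyy, hyz, hzx, hzy, hzz]

/-- The metric Lie algebras with a parallel vector are those of the classification. -/
lemma IsParallelVector.hasBasis {X : EuclideanSpace ℝ (Fin 3)}
    (hX : IsParallelVector (G := G) g X) :
    HasBasis g 0 0 0 0 1 ∨
      (∃ ν : ℝ, 0 < ν ∧ HasBasis g 0 1 (-1) 0 !![1, 0, 0; 0, 1, 0; 0, 0, ν]) ∨
      ∃ ν : ℝ, 0 < ν ∧ HasBasis g 0 (-1) 0 (-2) !![1, 1 / 2, 0; 1 / 2, 1, 0; 0, 0, ν] := by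
  rw [isParallelVector_iff] at hX
  obtain ⟨x, y, z, bxy, hxx, hyy, hxz, hyz, h⟩ := exists_frame_of_parallel (by simp)
    (B := (innerOne g).toLinearMap₁₂) (innerOne_symm g) (fun a ha => innerOne_pos g ha)
    bracketOne_self bracketOne_jacobi hX.1 hX.2.1 hX.2.2
  rcases h with ⟨hxy, hzz, bxz, byz⟩ | ⟨hxy, hzz, bxz, byz⟩ | ⟨hxy, hzz, bxz, byz⟩
  · refine Or.inl ?_
    have h := hasBasis_of_frame (a := 0) (b := 0) (c := 0) (d := 0) (by norm_num) one_pos hxx hyy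
      hxz hyz hxy hzz bxy (by rw [bxz]; simp) (by rw [byz]; simp)
    rwa [← Matrix.one_fin_three] at h
  · exact Or.inr (Or.inl ⟨_, hzz, hasBasis_of_frame (by norm_num) hzz hxx hyy hxz hyz hxy rfl bxy
      (by rw [bxz]; simp) (by rw [byz]; simp)⟩)
  · exact Or.inr (Or.inr ⟨_, hzz, hasBasis_of_frame (by norm_num) hzz hxx hyy hxz hyz hxy rfl bxy
      (by rw [bxz]; simp) (by rw [byz]; simp)⟩)

/-- The relations of `HasBasis`, with all vectors in the model space. -/
lemma HasBasis.exists_bracketOne {a b c d : ℝ} {Q : Matrix (Fin 3) (Fin 3) ℝ}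
    (h : HasBasis g a b c d Q) : ∃ e : Module.Basis (Fin 3) ℝ (EuclideanSpace ℝ (Fin 3)),
      bracketOne _ G (e 0) (e 1) = 0 ∧ bracketOne _ G (e 0) (e 2) = a • e 0 + b • e 1 ∧
        bracketOne _ G (e 1) (e 2) = c • e 0 + d • e 1 ∧
        ∀ i j, innerOne g (e i) (e j) = Q i j := h

/-- Conditions on the coefficients `p` which make the vector `∑ pᵢ eᵢ` parallel: it is orthogonal to
the brackets `[e₀, e₂]` and `[e₁, e₂]`, which span the derived algebra, and
`⟨w, [∑ pᵢ eᵢ, w]⟩ = 0` for all `w`. -/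
lemma HasBasis.exists_isParallelVector {a b c d : ℝ} {Q : Matrix (Fin 3) (Fin 3) ℝ}
    (h : HasBasis g a b c d Q) (p : Fin 3 → ℝ) (hp : p ≠ 0)
    (h1 : ∑ i, p i * (a * Q i 0 + b * Q i 1) = 0) (h2 : ∑ i, p i * (c * Q i 0 + d * Q i 1) = 0)
    (h3 : ∀ w : Fin 3 → ℝ, ∑ i, w i * (
      (p 0 * w 2 - p 2 * w 0) * (a * Q i 0 + b * Q i 1) +
      (p 1 * w 2 - p 2 * w 1) * (c * Q i 0 + d * Q i 1)) = 0) :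
    ∃ X, IsParallelVector g X := by
  obtain ⟨e, b01, b02, b12, hQ⟩ := h.exists_bracketOne
  have hbr : ∀ v w : Fin 3 → ℝ, bracketOne _ G (∑ i, v i • e i) (∑ i, w i • e i) =
      (v 0 * w 2 - v 2 * w 0) • (a • e 0 + b • e 1) +
      (v 1 * w 2 - v 2 * w 1) • (c • e 0 + d • e 1) := fun v w => by
    simp only [Fin.sum_univ_three, map_add, LinearMap.add_apply, map_smul, LinearMap.smul_apply,
      bracketOne_self, bracketOne_skew (e 1) (e 0),
      bracketOne_skew (e 2) (e 0), bracketOne_skew (e 2) (e 1), b01, b02, b12]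
    module
  have hin : ∀ (v : Fin 3 → ℝ) (r s : ℝ), innerOne g (∑ i, v i • e i)
      (r • (a • e 0 + b • e 1) + s • (c • e 0 + d • e 1)) =
      ∑ i, v i * (r * (a * Q i 0 + b * Q i 1) + s * (c * Q i 0 + d * Q i 1)) := fun v r s => by
    simp only [Fin.sum_univ_three, map_add, _root_.add_apply, map_smul, _root_.smul_apply,
      smul_eq_mul, hQ]
    ring
  refine ⟨(∑ i, p i • e i : EuclideanSpace ℝ (Fin 3)), isParallelVector_iff.2 ⟨fun h0 => hp ?_,
    fun v w => ?_, fun v => ?_⟩⟩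
  · exact funext (Fintype.linearIndependent_iff.1 e.linearIndependent p h0)
  · rw [← e.sum_repr v, ← e.sum_repr w, hbr, hin]
    simp only [Fin.sum_univ_three] at h1 h2 ⊢
    linear_combination (e.repr v 0 * e.repr w 2 - e.repr v 2 * e.repr w 0) * h1 +
      (e.repr v 1 * e.repr w 2 - e.repr v 2 * e.repr w 1) * h2
  · rw [← e.sum_repr v, hbr, hin]
    exact h3 _

lemma HasBasis.exists_isParallelVector_of_abelian (h : HasBasis g 0 0 0 0 1) :
    ∃ X, IsParallelVector g X :=
  h.exists_isParallelVector ![1, 0, 0] (fun h => by simpa using congrFun h 0) (by simp) (by simp)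
    (by simp)

/-- The vector `z` acts by an infinitesimal rotation on the derived algebra, which is its orthogonal
complement. -/
lemma HasBasis.exists_isParallelVector_of_rotation {ν : ℝ}
    (h : HasBasis g 0 1 (-1) 0 !![1, 0, 0; 0, 1, 0; 0, 0, ν]) : ∃ X, IsParallelVector g X :=
  h.exists_isParallelVector ![0, 0, 1] (fun h => by simpa using congrFun h 2)
    (by simp [Fin.sum_univ_three]) (by simp [Fin.sum_univ_three])
    (fun w => by simp [Fin.sum_univ_three]; ring)

/-- The vector `2x - y` is central and orthogonal to the derived algebra, the line spanned by
`y`. -/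
lemma HasBasis.exists_isParallelVector_of_product {ν : ℝ}
    (h : HasBasis g 0 (-1) 0 (-2) !![1, 1 / 2, 0; 1 / 2, 1, 0; 0, 0, ν]) :
    ∃ X, IsParallelVector g X :=
  h.exists_isParallelVector ![2, -1, 0] (fun h => by simpa using congrFun h 0)
    (by simp [Fin.sum_univ_three]) (by simp [Fin.sum_univ_three])
    (fun w => by simp [Fin.sum_univ_three]; ring)

end MetricLieAlgebra

/-! ### Group multiplication in the chart at the identity -/

section ChartAtOne

open Filter Topology

variable {E : Type*} [NormedAddCommGroup E]
  {G : Type*} [Group G] [TopologicalSpace G] [ChartedSpace E G]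

variable (E G) in
/-- The preferred chart at the identity. -/
def chartOne : OpenPartialHomeomorph G E := chartAt E (1 : G)

variable (E G) in
/-- The coordinates of the identity. -/
def coordOne : E := chartOne E G 1

lemma mem_chartOne_source : (1 : G) ∈ (chartOne E G).source := mem_chart_source E 1

lemma coordOne_mem : coordOne E G ∈ (chartOne E G).target :=
  (chartOne E G).map_source mem_chartOne_source

lemma chartOne_symm_coordOne : (chartOne E G).symm (coordOne E G) = 1 :=
  (chartOne E G).left_inv mem_chartOne_source

lemma continuousAt_chartOne_symm : ContinuousAt (chartOne E G).symm (coordOne E G) :=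
  (chartOne E G).continuousAt_symm coordOne_mem

lemma conj_coordOne (a : G) :
    chartOne E G (a * (chartOne E G).symm (coordOne E G) * a⁻¹) = coordOne E G := by
  rw [chartOne_symm_coordOne, mul_one, mul_inv_cancel]; rfl

/-- Group multiplication in the chart at the identity. -/
def chartMul (E : Type*) [NormedAddCommGroup E] [NormedSpace ℝ E]
    (G : Type*) [Group G] [TopologicalSpace G] [ChartedSpace E G] (p : E × E) : E :=
  chartOne E G ((chartOne E G).symm p.1 * (chartOne E G).symm p.2)

/-- The adjoint representation: the derivative at `1` of conjugation, in the chart at `1`. -/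
def adj (E : Type*) [NormedAddCommGroup E] [NormedSpace ℝ E]
    {G : Type*} [Group G] [TopologicalSpace G] [ChartedSpace E G] (a : G) : E →L[ℝ] E :=
  fderiv ℝ (fun y => chartOne E G (a * (chartOne E G).symm y * a⁻¹)) (coordOne E G)

variable [NormedSpace ℝ E] [LieGroup 𝓘(ℝ, E) ∞ G]

lemma chartOne_mem_maximalAtlas : chartOne E G ∈ IsManifold.maximalAtlas 𝓘(ℝ, E) ∞ G :=
  IsManifold.chart_mem_maximalAtlas 1

lemma contMDiffAt_chartOne_symm {x : E} (hx : x ∈ (chartOne E G).target) :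
    ContMDiffAt 𝓘(ℝ, E) 𝓘(ℝ, E) ∞ (chartOne E G).symm x :=
  contMDiffAt_symm_of_mem_maximalAtlas chartOne_mem_maximalAtlas hx

lemma contMDiffAt_chartOne {p : G} (hp : p ∈ (chartOne E G).source) :
    ContMDiffAt 𝓘(ℝ, E) 𝓘(ℝ, E) ∞ (chartOne E G) p :=
  contMDiffAt_of_mem_maximalAtlas chartOne_mem_maximalAtlas hp

lemma contDiffAt_chartMul {p : E × E} (h1 : p.1 ∈ (chartOne E G).target)
    (h2 : p.2 ∈ (chartOne E G).target)
    (h : (chartOne E G).symm p.1 * (chartOne E G).symm p.2 ∈ (chartOne E G).source) :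
    ContDiffAt ℝ ∞ (chartMul E G) p := by
  rw [← contMDiffAt_iff_contDiffAt]
  have e1 : ContMDiffAt 𝓘(ℝ, E × E) 𝓘(ℝ, E) ∞ (fun p : E × E => (chartOne E G).symm p.1) p :=
    ContMDiffAt.comp p (contMDiffAt_chartOne_symm h1) contDiff_fst.contMDiff.contMDiffAt
  have e2 : ContMDiffAt 𝓘(ℝ, E × E) 𝓘(ℝ, E) ∞ (fun p : E × E => (chartOne E G).symm p.2) p :=
    ContMDiffAt.comp p (contMDiffAt_chartOne_symm h2) contDiff_snd.contMDiff.contMDiffAt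
  exact ContMDiffAt.comp p (contMDiffAt_chartOne h) (e1.mul e2)

lemma contDiffAt_chartMul_one : ContDiffAt ℝ ∞ (chartMul E G) (coordOne E G, coordOne E G) :=
  contDiffAt_chartMul coordOne_mem coordOne_mem (by
    rw [chartOne_symm_coordOne, one_mul]; exact mem_chartOne_source)

omit [LieGroup 𝓘(ℝ, E) ∞ G] in
lemma chartMul_coordOne_right {x : E} (hx : x ∈ (chartOne E G).target) :
    chartMul E G (x, coordOne E G) = x := by
  rw [chartMul, chartOne_symm_coordOne, mul_one, (chartOne E G).right_inv hx]

omit [LieGroup 𝓘(ℝ, E) ∞ G] in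
lemma chartMul_coordOne_left {x : E} (hx : x ∈ (chartOne E G).target) :
    chartMul E G (coordOne E G, x) = x := by
  rw [chartMul, chartOne_symm_coordOne, one_mul, (chartOne E G).right_inv hx]

lemma hasFDerivAt_chartMul_one : HasFDerivAt (chartMul E G)
    (ContinuousLinearMap.fst ℝ E E + ContinuousLinearMap.snd ℝ E E)
    (coordOne E G, coordOne E G) := by
  have h := (contDiffAt_chartMul_one (E := E) (G := G)).differentiableAt (by simp)
  have ht : ∀ᶠ x in 𝓝 (coordOne E G), x ∈ (chartOne E G).target :=
    (chartOne E G).open_target.mem_nhds coordOne_mem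
  have e1 := (h.hasFDerivAt.comp (f := fun x => (x, coordOne E G)) _
    (hasFDerivAt_prodMk_left (𝕜 := ℝ) (coordOne E G) (coordOne E G))).unique
    ((hasFDerivAt_id (coordOne E G)).congr_of_eventuallyEq
      (ht.mono fun x hx => chartMul_coordOne_right hx))
  have e2 := (h.hasFDerivAt.comp (f := fun x => (coordOne E G, x)) _
    (hasFDerivAt_prodMk_right (𝕜 := ℝ) (coordOne E G) (coordOne E G))).unique
    ((hasFDerivAt_id (coordOne E G)).congr_of_eventuallyEq
      (ht.mono fun x hx => chartMul_coordOne_left hx))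
  refine h.hasFDerivAt.congr_fderiv ?_
  ext p
  · simpa using congrArg (fun D : E →L[ℝ] E => D p) e1
  · simpa using congrArg (fun D : E →L[ℝ] E => D p) e2

/-! #### Conjugation -/

lemma contMDiff_conj (a : G) : ContMDiff 𝓘(ℝ, E) 𝓘(ℝ, E) ∞ (fun q : G => a * q * a⁻¹) :=
  (contMDiff_const.mul contMDiff_id).mul contMDiff_const

lemma hasFDerivAt_conj (a : G) :
    HasFDerivAt (fun y => chartOne E G (a * (chartOne E G).symm y * a⁻¹)) (adj E a)
      (coordOne E G) := by
  refine DifferentiableAt.hasFDerivAt (ContDiffAt.differentiableAt (n := ∞) ?_ (by simp))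
  rw [← contMDiffAt_iff_contDiffAt]
  refine ContMDiffAt.comp (coordOne E G) (contMDiffAt_chartOne ?_)
    (ContMDiffAt.comp (coordOne E G) (contMDiff_conj a).contMDiffAt
      (contMDiffAt_chartOne_symm coordOne_mem))
  simp only [chartOne_symm_coordOne, mul_one, mul_inv_cancel]
  exact mem_chartOne_source

lemma eventually_conj_mem (a : G) : ∀ᶠ y in 𝓝 (coordOne E G),
    a * (chartOne E G).symm y * a⁻¹ ∈ (chartOne E G).source := by
  have h : ContinuousAt (fun y => a * (chartOne E G).symm y * a⁻¹) (coordOne E G) :=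
    ContinuousAt.comp (g := fun q : G => a * q * a⁻¹)
      (contMDiff_conj (E := E) a).continuous.continuousAt continuousAt_chartOne_symm
  refine h.eventually_mem ((chartOne E G).open_source.mem_nhds ?_)
  simp only [chartOne_symm_coordOne, mul_one, mul_inv_cancel]
  exact mem_chartOne_source

lemma adj_mul (a b : G) : adj E (a * b) = adj E a ∘L adj E b := by
  have h := HasFDerivAt.comp (coordOne E G) (by rw [conj_coordOne]; exact hasFDerivAt_conj a)
    (hasFDerivAt_conj (E := E) b)
  refine (hasFDerivAt_conj (a * b)).unique (h.congr_of_eventuallyEq ?_)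
  filter_upwards [eventually_conj_mem (E := E) b] with y hy
  simp only [Function.comp, (chartOne E G).left_inv hy]
  simp only [mul_inv_rev, mul_assoc]

/-- Conjugation acts on the velocity of a curve through `1` by the adjoint representation. -/
lemma hasDerivAt_conj {γ : ℝ → G} {v : E} (h1 : γ 0 = 1) (hc : ContinuousAt γ 0)
    (h : HasDerivAt (fun t => chartOne E G (γ t)) v 0) (a : G) :
    HasDerivAt (fun t => chartOne E G (a * γ t * a⁻¹)) (adj E a v) 0 := by
  have h' := HasFDerivAt.comp_hasDerivAt (0 : ℝ)
    (show HasFDerivAt _ (adj E a) (chartOne E G (γ 0)) by rw [h1]; exact hasFDerivAt_conj a) h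
  refine h'.congr_of_eventuallyEq ?_
  filter_upwards [hc.eventually_mem ((chartOne E G).open_source.mem_nhds
    (by rw [h1]; exact mem_chartOne_source))] with t ht
  simp only [Function.comp, (chartOne E G).left_inv ht]

/-! #### The derivative of the adjoint representation -/

omit [LieGroup 𝓘(ℝ, E) ∞ G] in
lemma mfderiv_chartOne_symm [IsManifold 𝓘(ℝ, E) ∞ G] :
    (mfderiv 𝓘(ℝ, E) 𝓘(ℝ, E) (chartOne E G).symm (coordOne E G) : E →L[ℝ] E) =
      ContinuousLinearMap.id ℝ E := by
  have h : MDifferentiableAt 𝓘(ℝ, E) 𝓘(ℝ, E) (chartOne E G).symm (coordOne E G) :=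
    (contMDiffAt_symm_of_mem_maximalAtlas (n := ∞) (IsManifold.chart_mem_maximalAtlas 1)
      coordOne_mem).mdifferentiableAt (by simp)
  refine h.mfderiv.trans ?_
  simp only [writtenInExtChartAt, mfld_simps, fderivWithin_univ, chartOne_symm_coordOne]
  refine HasFDerivAt.fderiv ((hasFDerivAt_id (coordOne E G)).congr_of_eventuallyEq ?_)
  filter_upwards [(chartOne E G).open_target.mem_nhds coordOne_mem] with x hx
  exact (chartOne E G).right_inv hx

/-- In the chart at `1`, the frame of left-invariant fields is the partial derivative of the
multiplication in the second variable. -/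
lemma leftFrame_chartOne {x : E} (hx : x ∈ (chartOne E G).target) (b : E) :
    leftFrame (chartOne E G) x b = fderiv ℝ (chartMul E G) (x, coordOne E G) (0, b) := by
  let D : E →L[ℝ] E := mfderiv 𝓘(ℝ, E) 𝓘(ℝ, E) (chartOne E G).symm x
  let L : E →L[ℝ] E := mfderiv 𝓘(ℝ, E) 𝓘(ℝ, E) (fun q : G => (chartOne E G).symm x * q) 1
  let P : E →L[ℝ] E := fderiv ℝ (chartMul E G) (x, coordOne E G) ∘L ContinuousLinearMap.inr ℝ E E
  have hsrc : (chartOne E G).symm x * (chartOne E G).symm (coordOne E G) ∈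
      (chartOne E G).source := by
    rw [chartOne_symm_coordOne, mul_one]; exact (chartOne E G).map_target hx
  have hinj : ∀ D : E →L[ℝ] E, D.IsInvertible → Function.Injective D := by
    rintro _ ⟨e, rfl⟩
    exact e.injective
  refine hinj D (isInvertible_mfderiv_symm chartOne_mem_maximalAtlas hx) ?_
  refine (mfderiv_symm_leftFrame chartOne_mem_maximalAtlas hx b).trans ?_
  have hP : HasFDerivAt (fun y => chartMul E G (x, y)) P (coordOne E G) :=
    ((contDiffAt_chartMul hx coordOne_mem hsrc).differentiableAt (by simp)).hasFDerivAt.comp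
      (f := fun y => (x, y)) _ (hasFDerivAt_prodMk_right (𝕜 := ℝ) x (coordOne E G))
  have hD : ∀ z, z = x → HasMFDerivAt 𝓘(ℝ, E) 𝓘(ℝ, E) (chartOne E G).symm z
      (mfderiv 𝓘(ℝ, E) 𝓘(ℝ, E) (chartOne E G).symm z) := by
    rintro _ rfl
    exact ((contMDiffAt_chartOne_symm hx).mdifferentiableAt (by simp)).hasMFDerivAt
  have hD' : ∀ z, z = x →
      (mfderiv 𝓘(ℝ, E) 𝓘(ℝ, E) (chartOne E G).symm z : E →L[ℝ] E) = D := by rintro _ rfl; rfl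
  have hx' := chartMul_coordOne_right (G := G) hx
  have h1 := (hD _ hx').comp (f := fun y => chartMul E G (x, y)) (coordOne E G) hP.hasMFDerivAt
  have h2 := ((mdifferentiable_mul_left (E := E) ((chartOne E G).symm x)
      ((chartOne E G).symm (coordOne E G))).hasMFDerivAt).comp (coordOne E G)
      ((contMDiffAt_chartOne_symm (coordOne_mem (E := E) (G := G))).mdifferentiableAt
        (by simp)).hasMFDerivAt
  have hL : ∀ q, q = 1 → (mfderiv 𝓘(ℝ, E) 𝓘(ℝ, E) (fun q : G => (chartOne E G).symm x * q) q :
      E →L[ℝ] E) = L := by rintro _ rfl; rfl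
  have h3 : (fun y => (chartOne E G).symm x * (chartOne E G).symm y) =ᶠ[𝓝 (coordOne E G)]
      fun y => (chartOne E G).symm (chartMul E G (x, y)) := by
    have hc : ContinuousAt (fun y => (chartOne E G).symm x * (chartOne E G).symm y)
        (coordOne E G) :=
      ContinuousAt.comp (g := fun q : G => (chartOne E G).symm x * q)
        (mdifferentiable_mul_left (E := E) _).continuous.continuousAt continuousAt_chartOne_symm
    filter_upwards [hc.eventually_mem ((chartOne E G).open_source.mem_nhds hsrc)] with y hy
    exact ((chartOne E G).left_inv hy).symm
  have h4 := hasMFDerivAt_unique (h1.congr_of_eventuallyEq h3) h2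
  have h5 : ∀ D₁ L₁ I₁ : E →L[ℝ] E, D₁ = D → L₁ = L → I₁ = ContinuousLinearMap.id ℝ E →
      D₁ ∘L P = L₁ ∘L I₁ → L b = D (P b) := by
    rintro _ _ _ rfl rfl rfl h
    exact (congrArg (fun T : E →L[ℝ] E => T b) h).symm
  exact h5 _ _ _ (hD' _ hx') (hL _ chartOne_symm_coordOne) mfderiv_chartOne_symm h4

/-- In terms of the second derivative of the multiplication `μ` at `1`, the bracket is
`[a, b] = ∂₁∂₂μ(a, b) - ∂₁∂₂μ(b, a)`. -/
lemma bracketOne_eq [FiniteDimensional ℝ E] [CompleteSpace E] (a b : E) : bracketOne E G a b =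
    fderiv ℝ (fderiv ℝ (chartMul E G)) (coordOne E G, coordOne E G) (a, 0) (0, b) -
    fderiv ℝ (fderiv ℝ (chartMul E G)) (coordOne E G, coordOne E G) (b, 0) (0, a) := by
  have hd : DifferentiableAt ℝ (fderiv ℝ (chartMul E G)) (coordOne E G, coordOne E G) :=
    ((contDiffAt_chartMul_one.fderiv_right (m := ∞) le_rfl).differentiableAt (by simp))
  have hb : ∀ b : E, HasFDerivAt (fun x => leftFrame (chartOne E G) x b)
      (((ContinuousLinearMap.apply ℝ E ((0 : E), b)) ∘L
        fderiv ℝ (fderiv ℝ (chartMul E G)) (coordOne E G, coordOne E G)) ∘L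
          ContinuousLinearMap.inl ℝ E E) (coordOne E G) := fun b => by
    have h := ((ContinuousLinearMap.apply ℝ E ((0 : E), b)).hasFDerivAt.comp _ hd.hasFDerivAt).comp
      (f := fun x => (x, coordOne E G)) _
      (hasFDerivAt_prodMk_left (𝕜 := ℝ) (coordOne E G) (coordOne E G))
    refine h.congr_of_eventuallyEq ?_
    filter_upwards [(chartOne E G).open_target.mem_nhds coordOne_mem] with x hx
    exact leftFrame_chartOne hx b
  have h0 : ∀ b, leftFrame (chartOne E G) (coordOne E G) b = b := fun b => by
    rw [leftFrame_chartOne coordOne_mem, hasFDerivAt_chartMul_one.fderiv]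
    simp
  have h := lieBracket_leftFrame (E := E) (G := G) chartOne_mem_maximalAtlas coordOne_mem a b
  refine ((h.trans (h0 _)).symm).trans ?_
  rw [VectorField.lieBracket, (hb a).fderiv, (hb b).fderiv, h0, h0]
  simp

/-- The derivative of the adjoint representation is the Lie bracket. Conjugation by `x` intertwines
right and left translation, `∂₁μ(1, x) ∘ Ad(x) = ∂₂μ(x, 1)`; the derivative of this identity at `1`
gives the claim by the symmetry of the second derivative. -/
lemma hasDerivAt_adj [FiniteDimensional ℝ E] [CompleteSpace E] {γ : ℝ → G} {v : E} (h1 : γ 0 = 1)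
    (hc : ContinuousAt γ 0) (h : HasDerivAt (fun t => chartOne E G (γ t)) v 0) (b : E) :
    HasDerivAt (fun t => adj E (γ t) b) (bracketOne E G v b) 0 := by
  have hγ0 : chartOne E G (γ 0) = coordOne E G := by rw [h1]; rfl
  have hsrc : ∀ᶠ t in 𝓝 0, γ t ∈ (chartOne E G).source :=
    hc.eventually_mem ((chartOne E G).open_source.mem_nhds (by rw [h1]; exact mem_chartOne_source))
  set x : ℝ → E := fun t => chartOne E G (γ t) with hx
  have hμ := contDiffAt_chartMul_one (E := E) (G := G)
  have hd : DifferentiableAt ℝ (fderiv ℝ (chartMul E G)) (coordOne E G, coordOne E G) :=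
    (hμ.fderiv_right (m := ∞) le_rfl).differentiableAt (by simp)
  let Q := fderiv ℝ (fderiv ℝ (chartMul E G)) (coordOne E G, coordOne E G)
  let R : ℝ → E →L[ℝ] E := fun t =>
    fderiv ℝ (chartMul E G) (coordOne E G, x t) ∘L ContinuousLinearMap.inl ℝ E E
  let L : ℝ → E := fun t => fderiv ℝ (chartMul E G) (x t, coordOne E G) (0, b)
  have hR : HasDerivAt R (Q (0, v) ∘L ContinuousLinearMap.inl ℝ E E) 0 := by
    have h2 : HasDerivAt (fun t => fderiv ℝ (chartMul E G) (coordOne E G, x t)) (Q (0, v)) 0 :=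
      HasFDerivAt.comp_hasDerivAt (f := fun t => (coordOne E G, x t)) (0 : ℝ)
        (show HasFDerivAt _ Q (coordOne E G, x 0) by
          rw [hx]; dsimp only; rw [hγ0]; exact hd.hasFDerivAt)
        ((hasDerivAt_const 0 _).prodMk h)
    simpa using h2.clm_comp (hasDerivAt_const 0 (ContinuousLinearMap.inl ℝ E E))
  have hL : HasDerivAt L (Q (v, 0) (0, b)) 0 := by
    have h2 : HasDerivAt (fun t => fderiv ℝ (chartMul E G) (x t, coordOne E G)) (Q (v, 0)) 0 :=
      HasFDerivAt.comp_hasDerivAt (f := fun t => (x t, coordOne E G)) (0 : ℝ)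
        (show HasFDerivAt _ Q (x 0, coordOne E G) by
          rw [hx]; dsimp only; rw [hγ0]; exact hd.hasFDerivAt)
        (h.prodMk (hasDerivAt_const 0 _))
    simpa using h2.clm_apply (hasDerivAt_const 0 ((0 : E), b))
  have hx0 : x 0 = coordOne E G := hγ0
  have hR0 : R 0 = ContinuousLinearMap.id ℝ E := by
    ext z
    simp [R, hx0, hasFDerivAt_chartMul_one.fderiv]
  have key : ∀ᶠ t in 𝓝 0, R t (adj E (γ t) b) = L t := by
    filter_upwards [hsrc] with t ht
    have hxt : x t ∈ (chartOne E G).target := (chartOne E G).map_source ht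
    have hsymm : (chartOne E G).symm (x t) = γ t := (chartOne E G).left_inv ht
    have e1 : HasFDerivAt (chartMul E G) (fderiv ℝ (chartMul E G) (coordOne E G, x t))
        (chartOne E G (γ t * (chartOne E G).symm (coordOne E G) * (γ t)⁻¹), x t) := by
      rw [conj_coordOne]
      refine ((contDiffAt_chartMul coordOne_mem hxt ?_).differentiableAt (by simp)).hasFDerivAt
      rwa [chartOne_symm_coordOne, one_mul, hsymm]
    have e2 : HasFDerivAt (chartMul E G) (fderiv ℝ (chartMul E G) (x t, coordOne E G))
        (x t, coordOne E G) := by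
      refine ((contDiffAt_chartMul hxt coordOne_mem ?_).differentiableAt (by simp)).hasFDerivAt
      rwa [chartOne_symm_coordOne, mul_one, hsymm]
    have e3 := e1.comp (f := fun y => (chartOne E G (γ t * (chartOne E G).symm y * (γ t)⁻¹), x t))
      (coordOne E G) ((hasFDerivAt_conj (γ t)).prodMk (hasFDerivAt_const (x t) _))
    have e4 := e2.comp (f := fun y => (x t, y)) (coordOne E G)
      (hasFDerivAt_prodMk_right (𝕜 := ℝ) (x t) (coordOne E G))
    have e5 := (e3.congr_of_eventuallyEq ?_).unique e4
    · have e6 := congrArg (fun D : E →L[ℝ] E => D b) e5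
      simpa [R, L] using e6
    · filter_upwards [eventually_conj_mem (E := E) (γ t)] with y hy
      simp only [Function.comp, chartMul, (chartOne E G).left_inv hy, hsymm, inv_mul_cancel_right]
  have hinv : DifferentiableAt ℝ (fun t => (R t).inverse) 0 := by
    have h2 := (contDiffAt_map_inverse (n := ∞) (𝕜 := ℝ)
      (ContinuousLinearEquiv.refl ℝ E)).differentiableAt (by simp)
    exact DifferentiableAt.comp (g := ContinuousLinearMap.inverse) (0 : ℝ)
      (by rw [hR0]; exact h2) hR.differentiableAt
  have hRinv : ∀ᶠ t in 𝓝 0, (R t).IsInvertible :=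
    hR.continuousAt.eventually_mem (by rw [hR0]; exact (ContinuousLinearEquiv.refl ℝ E).nhds)
  have heq : (fun t => adj E (γ t) b) =ᶠ[𝓝 0] fun t => (R t).inverse (L t) := by
    filter_upwards [key, hRinv] with t h2 h3
    rw [← h2]
    obtain ⟨e, he⟩ := h3
    rw [← he]
    simp
  have hcd : DifferentiableAt ℝ (fun t => adj E (γ t) b) 0 :=
    (hinv.clm_apply hL.differentiableAt).congr_of_eventuallyEq heq
  have h0 : adj E (γ 0) b = b := by
    have h2 := key.self_of_nhds
    have h3 : L 0 = b := by simp [L, hx0, hasFDerivAt_chartMul_one.fderiv]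
    rwa [hR0, h3] at h2
  have hder := ((hR.clm_apply hcd.hasDerivAt).congr_of_eventuallyEq
    (key.mono fun t ht => ht.symm)).unique hL
  have hsymm : Q (0, v) (b, 0) = Q (b, 0) (0, v) :=
    (hμ.isSymmSndFDerivAt (by simpa using ENat.LEInfty.out)).eq _ _
  refine hcd.hasDerivAt.congr_deriv ?_
  rw [hR0, h0] at hder
  rw [bracketOne_eq]
  have h4 : Q (0, v) (b, 0) + deriv (fun t => adj E (γ t) b) 0 = Q (v, 0) (0, b) := hder
  rw [hsymm] at h4
  exact eq_sub_of_add_eq' h4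

end ChartAtOne

/-! ### One-parameter subgroups -/

section OneParameter

open Filter Topology

variable {E : Type*} [NormedAddCommGroup E] [NormedSpace ℝ E]
  {G : Type*} [Group G] [TopologicalSpace G] [ChartedSpace E G]

/-- `γ` is the one-parameter subgroup of `G` with velocity `v`: it is a homomorphism from the
additive group of real numbers, and an integral curve of the left-invariant field of `v`. -/
structure IsOneParameterSubgroup (γ : ℝ → G) (v : E) : Prop where
  map_add : ∀ s t, γ (s + t) = γ s * γ t
  isMIntegralCurve : IsMIntegralCurve (I := 𝓘(ℝ, E)) γ
    (mulInvariantVectorField (v : GroupLieAlgebra 𝓘(ℝ, E) G))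

variable {γ δ : ℝ → G} {v w : E}

lemma IsOneParameterSubgroup.map_zero (h : IsOneParameterSubgroup γ v) : γ 0 = 1 := by
  have h1 := h.map_add 0 0
  rw [add_zero] at h1
  exact (mul_eq_left.1 h1.symm)

lemma IsOneParameterSubgroup.map_neg (h : IsOneParameterSubgroup γ v) (t : ℝ) :
    γ (-t) = (γ t)⁻¹ := by
  rw [eq_inv_iff_mul_eq_one, ← h.map_add, neg_add_cancel, h.map_zero]

lemma IsOneParameterSubgroup.continuous (h : IsOneParameterSubgroup γ v) : Continuous γ :=
  h.isMIntegralCurve.continuous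

variable [LieGroup 𝓘(ℝ, E) ∞ G]

/-- Left translates of integral curves of left-invariant fields are integral curves. -/
lemma hasMFDerivAt_mul_left_integral (a : G) {t : ℝ}
    (h : HasMFDerivAt 𝓘(ℝ, ℝ) 𝓘(ℝ, E) γ t ((1 : ℝ →L[ℝ] ℝ).smulRight
      (mulInvariantVectorField (v : GroupLieAlgebra 𝓘(ℝ, E) G) (γ t)))) :
    HasMFDerivAt 𝓘(ℝ, ℝ) 𝓘(ℝ, E) (fun t => a * γ t) t ((1 : ℝ →L[ℝ] ℝ).smulRight
      (mulInvariantVectorField (v : GroupLieAlgebra 𝓘(ℝ, E) G) (a * γ t))) := by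
  have h1 := ((mdifferentiable_mul_left (E := E) a (γ t)).hasMFDerivAt).comp t h
  have h2 := mfderiv_mul_left_comp (E := E) a (γ t) 1 v
  -- the base points `γ t * 1` and `γ t` are not definitionally equal
  have h3 : ∀ r, r = γ t → (mfderiv 𝓘(ℝ, E) 𝓘(ℝ, E) (fun q : G => a * q) r
      (mfderiv 𝓘(ℝ, E) 𝓘(ℝ, E) (fun q : G => γ t * q) 1 v) : E) =
      mfderiv 𝓘(ℝ, E) 𝓘(ℝ, E) (fun q : G => a * q) (γ t)
      (mfderiv 𝓘(ℝ, E) 𝓘(ℝ, E) (fun q : G => γ t * q) 1 v) := by rintro _ rfl; rfl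
  have h4 : (mfderiv 𝓘(ℝ, E) 𝓘(ℝ, E) (fun q : G => a * q) (γ t)
      (mulInvariantVectorField (v : GroupLieAlgebra 𝓘(ℝ, E) G) (γ t)) : E) =
      mulInvariantVectorField (v : GroupLieAlgebra 𝓘(ℝ, E) G) (a * γ t) :=
    (h3 _ (mul_one _)).symm.trans h2
  have h5 : ∀ (D : E →L[ℝ] E) (y z : E), D y = z →
      D ∘L ((1 : ℝ →L[ℝ] ℝ).smulRight y) = (1 : ℝ →L[ℝ] ℝ).smulRight z := by
    rintro D y _ rfl
    ext
    simp
  have h6 := h5 (mfderiv 𝓘(ℝ, E) 𝓘(ℝ, E) (fun q : G => a * q) (γ t)) _ _ h4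
  have h7 : ∀ D D' : ℝ →L[ℝ] E, D = D' →
      HasMFDerivAt 𝓘(ℝ, ℝ) 𝓘(ℝ, E) (fun t => a * γ t) t D →
      HasMFDerivAt 𝓘(ℝ, ℝ) 𝓘(ℝ, E) (fun t => a * γ t) t D' := by rintro _ _ rfl h; exact h
  exact h7 _ _ h6 h1

omit [LieGroup 𝓘(ℝ, E) ∞ G] in
/-- The velocity at `0` of a curve through `1` can be computed in the chart at `1`. -/
lemma hasMFDerivAt_iff_hasDerivAt_chartOne (h1 : γ 0 = 1) :
    HasMFDerivAt 𝓘(ℝ, ℝ) 𝓘(ℝ, E) γ 0 ((1 : ℝ →L[ℝ] ℝ).smulRight v : ℝ →L[ℝ] E) ↔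
      ContinuousAt γ 0 ∧ HasDerivAt (fun t => chartOne E G (γ t)) v 0 := by
  have h2 : (1 : ℝ →L[ℝ] ℝ).smulRight v = ContinuousLinearMap.toSpanSingleton ℝ v := by
    ext; simp
  rw [h2]
  simp only [HasMFDerivAt, writtenInExtChartAt, mfld_simps, h1]
  exact and_congr_right fun _ =>
    Iff.trans (hasFDerivWithinAt_univ (𝕜 := ℝ) (E := ℝ) (F := E))
      (hasDerivAt_iff_hasFDerivAt (𝕜 := ℝ) (F := E)).symm

omit [LieGroup 𝓘(ℝ, E) ∞ G] in
lemma IsOneParameterSubgroup.hasDerivAt_chartOne (h : IsOneParameterSubgroup γ v) :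
    HasDerivAt (fun t => chartOne E G (γ t)) v 0 := by
  refine ((hasMFDerivAt_iff_hasDerivAt_chartOne h.map_zero).1 ?_).2
  have h1 := h.isMIntegralCurve 0
  have h2 : ∀ q : G, q = 1 →
      (mulInvariantVectorField (I := 𝓘(ℝ, E)) (v : GroupLieAlgebra 𝓘(ℝ, E) G) q : E) = v := by
    rintro _ rfl
    exact mulInvariantVectorField_apply_one v
  have h3 : ∀ y : E, y = v → HasMFDerivAt 𝓘(ℝ, ℝ) 𝓘(ℝ, E) γ 0
      ((1 : ℝ →L[ℝ] ℝ).smulRight y : ℝ →L[ℝ] E) → HasMFDerivAt 𝓘(ℝ, ℝ) 𝓘(ℝ, E) γ 0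
      ((1 : ℝ →L[ℝ] ℝ).smulRight v : ℝ →L[ℝ] E) := by rintro _ rfl h; exact h
  exact h3 _ (h2 _ h.map_zero) h1

/-- A homomorphism `ℝ → G` which is differentiable at `0` is a one-parameter subgroup. -/
lemma isOneParameterSubgroup_of_hasDerivAt (hadd : ∀ s t, γ (s + t) = γ s * γ t)
    (hc : ContinuousAt γ 0) (h : HasDerivAt (fun t => chartOne E G (γ t)) v 0) :
    IsOneParameterSubgroup γ v := by
  have h0 : γ 0 = 1 := by
    have h1 := hadd 0 0
    rw [add_zero] at h1
    exact (mul_eq_left.1 h1.symm)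
  have h1 := (hasMFDerivAt_iff_hasDerivAt_chartOne h0).2 ⟨hc, h⟩
  refine ⟨hadd, fun t => ?_⟩
  have h2 : ∀ q : G, q = 1 →
      (mulInvariantVectorField (I := 𝓘(ℝ, E)) (v : GroupLieAlgebra 𝓘(ℝ, E) G) q : E) = v := by
    rintro _ rfl
    exact mulInvariantVectorField_apply_one v
  have h3 : ∀ y : E, y = v → HasMFDerivAt 𝓘(ℝ, ℝ) 𝓘(ℝ, E) γ 0
      ((1 : ℝ →L[ℝ] ℝ).smulRight y : ℝ →L[ℝ] E) := by rintro _ rfl; exact h1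
  have h4 := hasMFDerivAt_mul_left_integral (γ t) (h3 _ (h2 _ h0))
  -- translate the parameter
  have h5 : HasMFDerivAt 𝓘(ℝ, ℝ) 𝓘(ℝ, ℝ) (fun s : ℝ => s - t) t (ContinuousLinearMap.id ℝ ℝ) :=
    ((hasFDerivAt_id t).sub_const t).hasMFDerivAt
  have h6 : ∀ r : ℝ, r = 0 → HasMFDerivAt 𝓘(ℝ, ℝ) 𝓘(ℝ, E) (fun s => γ t * γ s) r
      ((1 : ℝ →L[ℝ] ℝ).smulRight (mulInvariantVectorField (I := 𝓘(ℝ, E))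
        (v : GroupLieAlgebra 𝓘(ℝ, E) G) (γ t * γ 0)) : ℝ →L[ℝ] E) := by
    rintro _ rfl; exact h4
  have h7 := (h6 (t - t) (sub_self t)).comp (f := fun s : ℝ => s - t) t h5
  have h8 : (fun s => γ t * γ s) ∘ (fun s => s - t) = γ := by
    ext s
    simp only [Function.comp]
    rw [← hadd, add_sub_cancel]
  rw [h8] at h7
  have h9 : ∀ q : G, q = γ t → ∀ D : ℝ →L[ℝ] E, D = ((1 : ℝ →L[ℝ] ℝ).smulRight
        (mulInvariantVectorField (I := 𝓘(ℝ, E)) (v : GroupLieAlgebra 𝓘(ℝ, E) G) q) : ℝ →L[ℝ] E) →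
      HasMFDerivAt 𝓘(ℝ, ℝ) 𝓘(ℝ, E) γ t D → HasMFDerivAt 𝓘(ℝ, ℝ) 𝓘(ℝ, E) γ t
        ((1 : ℝ →L[ℝ] ℝ).smulRight
          (mulInvariantVectorField (I := 𝓘(ℝ, E)) (v : GroupLieAlgebra 𝓘(ℝ, E) G) (γ t)) :
          ℝ →L[ℝ] E) := by
    rintro _ rfl _ rfl h; exact h
  exact h9 (γ t * γ 0) (by rw [h0, mul_one]) _ (ContinuousLinearMap.comp_id _) h7

/-- Lie groups are Hausdorff, as points are closed in Euclidean space. -/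
lemma t2Space_of_lieGroup (E : Type*) [NormedAddCommGroup E] [NormedSpace ℝ E]
    (G : Type*) [Group G] [TopologicalSpace G] [ChartedSpace E G] [LieGroup 𝓘(ℝ, E) ∞ G] :
    T2Space G := by
  have := topologicalGroup_of_lieGroup 𝓘(ℝ, E) ∞ (G := G)
  have : T1Space G := 𝓘(ℝ, E).t1Space G
  infer_instance

/-- A one-parameter subgroup is determined by its velocity, by uniqueness of integral curves. -/
lemma IsOneParameterSubgroup.unique [CompleteSpace E] (hγ : IsOneParameterSubgroup γ v)
    (hδ : IsOneParameterSubgroup δ v) : γ = δ := by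
  have := t2Space_of_lieGroup E G
  have : IsManifold 𝓘(ℝ, E) 1 G := IsManifold.of_le (n := ∞) (by simp)
  exact isMIntegralCurve_Ioo_eq_of_contMDiff_boundaryless (t₀ := 0)
    ((contMDiff_infty_mulInvariantVectorField (v : GroupLieAlgebra 𝓘(ℝ, E) G)).of_le (by simp))
    hγ.isMIntegralCurve hδ.isMIntegralCurve (by rw [hγ.map_zero, hδ.map_zero])

/-- A local integral curve through `1` can be translated to any point, so the integral curves of a
left-invariant field exist on intervals of a fixed length, hence for all time. By uniqueness, the
integral curve through `1` is a homomorphism. -/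
lemma exists_isOneParameterSubgroup [CompleteSpace E] (v : E) :
    ∃ γ : ℝ → G, IsOneParameterSubgroup γ v := by
  have := t2Space_of_lieGroup E G
  have : IsManifold 𝓘(ℝ, E) 1 G := IsManifold.of_le (n := ∞) (by simp)
  have hv := (contMDiff_infty_mulInvariantVectorField (G := G)
    (v : GroupLieAlgebra 𝓘(ℝ, E) G)).of_le (show (1 : WithTop ℕ∞) ≤ ∞ by simp)
  obtain ⟨γ, h0, hγ⟩ := exists_isMIntegralCurveAt_of_contMDiffAt_boundaryless (t₀ := 0)
    (hv.contMDiffAt (x := (1 : G)))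
  obtain ⟨ε, hε, hγε⟩ := isMIntegralCurveAt_iff'.1 hγ
  obtain ⟨δ, hδ0, hδ⟩ := exists_isMIntegralCurve_of_isMIntegralCurveOn hv hε (fun x => by
    refine ⟨fun t => x * γ t, by simp [h0], fun t ht => ?_⟩
    have hball : Set.Ioo (-ε) ε = Metric.ball (0 : ℝ) ε := by rw [Real.ball_eq_Ioo]; simp
    have h1 : HasMFDerivAt 𝓘(ℝ, ℝ) 𝓘(ℝ, E) γ t _ := (hγε.isMIntegralCurveAt
      (Metric.isOpen_ball.mem_nhds (hball ▸ ht))).hasMFDerivAt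
    exact (hasMFDerivAt_mul_left_integral x h1).hasMFDerivWithinAt) 1
  refine ⟨δ, fun s t => ?_, hδ⟩
  have h1 := hδ.comp_add s
  have h2 : IsMIntegralCurve (I := 𝓘(ℝ, E)) (fun t => δ s * δ t)
      (mulInvariantVectorField (v : GroupLieAlgebra 𝓘(ℝ, E) G)) := fun t =>
    hasMFDerivAt_mul_left_integral (δ s) (hδ t)
  have h3 := isMIntegralCurve_Ioo_eq_of_contMDiff_boundaryless (t₀ := 0) hv h1 h2
    (by simp [hδ0])
  have h4 := congrFun h3 t
  simp only [Function.comp] at h4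
  rw [add_comm, h4]

omit [LieGroup 𝓘(ℝ, E) ∞ G] [Group G] [TopologicalSpace G] [ChartedSpace E G] in
/-- Solutions of an autonomous differential equation with smooth right-hand side are smooth. -/
lemma contDiffOn_of_hasDerivAt {f : E → E} {U : Set E} (hf : ContDiffOn ℝ ∞ f U) {u : ℝ → E}
    {s : Set ℝ} (hs : IsOpen s) (hu : ∀ t ∈ s, u t ∈ U)
    (h : ∀ t ∈ s, HasDerivAt u (f (u t)) t) : ContDiffOn ℝ ∞ u s := by
  rw [contDiffOn_infty]
  intro n
  induction n with
  | zero => exact contDiffOn_zero.2 fun t ht => (h t ht).continuousAt.continuousWithinAt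
  | succ n ih =>
    rw [Nat.cast_succ, contDiffOn_succ_iff_deriv_of_isOpen hs]
    refine ⟨fun t ht => (h t ht).differentiableAt.differentiableWithinAt, by simp, ?_⟩
    exact ((hf.of_le (by exact_mod_cast le_top)).comp ih hu).congr fun t ht => (h t ht).deriv

/-- One-parameter subgroups are smooth: in a chart, they solve an ordinary differential equation
with smooth right-hand side. -/
lemma IsOneParameterSubgroup.contMDiff [FiniteDimensional ℝ E] (h : IsOneParameterSubgroup γ v) :
    ContMDiff 𝓘(ℝ, ℝ) 𝓘(ℝ, E) ∞ γ := by
  have hφ := chartOne_mem_maximalAtlas (E := E) (G := G)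
  have hs : IsOpen (γ ⁻¹' (chartOne E G).source) :=
    (chartOne E G).open_source.preimage h.continuous
  have hder : ∀ t ∈ γ ⁻¹' (chartOne E G).source, HasDerivAt (fun t => chartOne E G (γ t))
      (leftFrame (chartOne E G) (chartOne E G (γ t)) v) t := by
    intro t ht
    have hx := (chartOne E G).map_source ht
    have hsymm : (chartOne E G).symm (chartOne E G (γ t)) = γ t := (chartOne E G).left_inv ht
    have hM : (chartOne E G).MDifferentiable 𝓘(ℝ, E) 𝓘(ℝ, E) :=
      ⟨(contMDiffOn_of_mem_maximalAtlas hφ).mdifferentiableOn (by simp),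
        (contMDiffOn_symm_of_mem_maximalAtlas hφ).mdifferentiableOn (by simp)⟩
    let D : E →L[ℝ] E := mfderiv 𝓘(ℝ, E) 𝓘(ℝ, E) (chartOne E G) (γ t)
    let D' : E →L[ℝ] E := mfderiv 𝓘(ℝ, E) 𝓘(ℝ, E) (chartOne E G).symm (chartOne E G (γ t))
    have h1 : HasMFDerivAt 𝓘(ℝ, E) 𝓘(ℝ, E) (chartOne E G) (γ t) D :=
      (hM.mdifferentiableAt ht).hasMFDerivAt
    have h2 := h1.comp t (h.isMIntegralCurve t)
    have h3' : ∀ q : G, q = γ t → (mfderiv 𝓘(ℝ, E) 𝓘(ℝ, E) (chartOne E G) q : E →L[ℝ] E) = D := by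
      rintro _ rfl; rfl
    have h3 : D ∘L D' = ContinuousLinearMap.id ℝ E :=
      (congrArg (fun T : E →L[ℝ] E => T ∘L D') (h3' _ hsymm)).symm.trans (hM.comp_symm_deriv hx)
    have h4 : ∀ q : G, q = γ t → (mfderiv 𝓘(ℝ, E) 𝓘(ℝ, E) (fun r : G => q * r) 1 v : E) =
        mulInvariantVectorField (I := 𝓘(ℝ, E)) (v : GroupLieAlgebra 𝓘(ℝ, E) G) (γ t) := by
      rintro _ rfl; rfl
    have h5 : D' (leftFrame (chartOne E G) (chartOne E G (γ t)) v) =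
        mulInvariantVectorField (I := 𝓘(ℝ, E)) (v : GroupLieAlgebra 𝓘(ℝ, E) G) (γ t) :=
      (mfderiv_symm_leftFrame hφ hx v).trans (h4 _ hsymm)
    have h6 : D (mulInvariantVectorField (I := 𝓘(ℝ, E)) (v : GroupLieAlgebra 𝓘(ℝ, E) G) (γ t)) =
        leftFrame (chartOne E G) (chartOne E G (γ t)) v :=
      (congrArg D h5).symm.trans (congrArg (fun T : E →L[ℝ] E => T _) h3)
    have h7 : ∀ z : E, HasFDerivAt (fun t => chartOne E G (γ t))
        (D ∘L ((1 : ℝ →L[ℝ] ℝ).smulRight z)) t →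
        HasDerivAt (fun t => chartOne E G (γ t)) (D z) t := by
      intro z hz
      simpa using hz.hasDerivAt
    exact (h7 _ (hasMFDerivAt_iff_hasFDerivAt.1 h2)).congr_deriv h6
  have hu := contDiffOn_of_hasDerivAt (f := fun x => leftFrame (chartOne E G) x v)
    ((contDiffOn_leftFrame hφ).clm_apply contDiffOn_const) hs
    (fun t ht => (chartOne E G).map_source ht) hder
  have h0 : (0 : ℝ) ∈ γ ⁻¹' (chartOne E G).source := by
    rw [Set.mem_preimage, h.map_zero]; exact mem_chartOne_source
  have hγ0 : ContMDiffAt 𝓘(ℝ, ℝ) 𝓘(ℝ, E) ∞ γ 0 := by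
    have h1 := ContMDiffAt.comp (0 : ℝ)
      (contMDiffAt_chartOne_symm ((chartOne E G).map_source h0))
      (hu.contDiffAt (hs.mem_nhds h0)).contMDiffAt
    refine h1.congr_of_eventuallyEq ?_
    filter_upwards [hs.mem_nhds h0] with t ht
    exact ((chartOne E G).left_inv ht).symm
  intro t
  have h1 : ContMDiffAt 𝓘(ℝ, ℝ) 𝓘(ℝ, E) ∞ (fun s => γ (s - t)) t :=
    ContMDiffAt.comp t (by rw [sub_self]; exact hγ0)
      (contDiff_id.sub contDiff_const).contMDiff.contMDiffAt
  refine ((contMDiff_mul_left (a := γ t)).contMDiffAt.comp t h1).congr_of_eventuallyEq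
    (Eventually.of_forall fun s => ?_)
  simp only [Function.comp]
  rw [← h.map_add, add_sub_cancel]

lemma IsOneParameterSubgroup.conj (h : IsOneParameterSubgroup γ v) (a : G) :
    IsOneParameterSubgroup (fun t => a * γ t * a⁻¹) (adj E a v) := by
  refine isOneParameterSubgroup_of_hasDerivAt (fun s t => ?_) ?_
    (hasDerivAt_conj h.map_zero h.continuous.continuousAt h.hasDerivAt_chartOne a)
  · rw [h.map_add]; group
  · exact ((contMDiff_conj (E := E) a).continuous.comp h.continuous).continuousAt

lemma IsOneParameterSubgroup.mul (hγ : IsOneParameterSubgroup γ v)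
    (hδ : IsOneParameterSubgroup δ w) (hcomm : ∀ s t, γ s * δ t = δ t * γ s) (a b : ℝ) :
    IsOneParameterSubgroup (fun t => γ (t * a) * δ (t * b)) (a • v + b • w) := by
  have := topologicalGroup_of_lieGroup 𝓘(ℝ, E) ∞ (G := G)
  refine isOneParameterSubgroup_of_hasDerivAt (fun s t => ?_) ?_ ?_
  · rw [add_mul, add_mul, hγ.map_add, hδ.map_add, mul_assoc, ← mul_assoc (γ (t * a)), hcomm]
    simp only [mul_assoc]
  · exact ((hγ.continuous.comp (continuous_mul_const a)).mul
      (hδ.continuous.comp (continuous_mul_const b))).continuousAt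
  · have h1 : HasDerivAt (fun t => chartOne E G (γ (t * a))) (a • v) 0 :=
      HasDerivAt.scomp (g₁ := fun t => chartOne E G (γ t)) (h := fun t => t * a) (0 : ℝ)
        (by rw [zero_mul]; exact hγ.hasDerivAt_chartOne) (hasDerivAt_mul_const a)
    have h2 : HasDerivAt (fun t => chartOne E G (δ (t * b))) (b • w) 0 :=
      HasDerivAt.scomp (g₁ := fun t => chartOne E G (δ t)) (h := fun t => t * b) (0 : ℝ)
        (by rw [zero_mul]; exact hδ.hasDerivAt_chartOne) (hasDerivAt_mul_const b)
    have h3 := HasFDerivAt.comp_hasDerivAt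
      (f := fun t => (chartOne E G (γ (t * a)), chartOne E G (δ (t * b)))) (0 : ℝ)
      (show HasFDerivAt (chartMul E G) _ _ by
        simp only [zero_mul, hγ.map_zero, hδ.map_zero]; exact hasFDerivAt_chartMul_one)
      (h1.prodMk h2)
    have h4 : ∀ {γ : ℝ → G} {v : E} (a : ℝ), IsOneParameterSubgroup γ v →
        ∀ᶠ t in 𝓝 0, γ (t * a) ∈ (chartOne E G).source := fun {γ v} a hγ => by
      refine (hγ.continuous.comp (continuous_mul_const a)).continuousAt.eventually_mem
        ((chartOne E G).open_source.mem_nhds ?_)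
      simp only [Function.comp, zero_mul, hγ.map_zero]
      exact mem_chartOne_source
    refine (h3.congr_of_eventuallyEq ?_).congr_deriv (by simp)
    filter_upwards [h4 a hγ, h4 b hδ] with t ht1 ht2
    simp only [Function.comp, chartMul, (chartOne E G).left_inv ht1, (chartOne E G).left_inv ht2]

end OneParameter

/-! ### Homomorphisms onto simply connected groups -/

section Covering

open Filter Topology

/-- A homomorphism from a connected to a simply connected group which is a local homeomorphism at
the identity is bijective: it is a covering map, which has a section, since the identity of the
simply connected group lifts; by the uniqueness of lifts the section is a two-sided inverse. -/
lemma bijective_of_map_nhds_one {H G : Type*} [Group H] [TopologicalSpace H] [IsTopologicalGroup H]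
    [ConnectedSpace H] [Group G] [TopologicalSpace G] [IsTopologicalGroup G]
    [SimplyConnectedSpace G] [LocallyPathConnectedSpace G] (f : H →* G)
    (hmap : map f (𝓝 1) = 𝓝 1) (hinj : ∀ᶠ h in 𝓝 (1 : H), f h = 1 → h = 1) :
    Function.Bijective f := by
  have hcont : Continuous f := continuous_of_continuousAt_one f (by
    rw [ContinuousAt, map_one]; exact hmap.le)
  have hopen : IsOpenMap f := by
    refine IsOpenMap.of_nhds_le fun a => le_of_eq ?_
    rw [← map_mul_left_nhds_one a, ← map_mul_left_nhds_one (f a), ← hmap, Filter.map_map,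
      Filter.map_map]
    congr 1
    ext x
    simp
  have hsurj : Function.Surjective f := by
    have h1 : IsOpen (f.range : Set G) := by
      rw [MonoidHom.coe_range]; exact hopen.isOpen_range
    have h2 : IsClopen (f.range : Set G) := ⟨Subgroup.isClosed_of_isOpen _ h1, h1⟩
    have h3 := h2.eq_univ ⟨1, f.range.one_mem⟩
    rw [MonoidHom.coe_range] at h3
    exact Set.range_eq_univ.1 h3
  refine ⟨?_, hsurj⟩
  have hdisc : IsDiscrete (f.ker : Set H) := by
    rw [isDiscrete_iff_forall_mem_exists_isOpen]
    intro y hy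
    obtain ⟨U, hU, hUo, hU1⟩ := mem_nhds_iff.1 hinj
    refine ⟨(fun x => y⁻¹ * x) ⁻¹' U, hUo.preimage (continuous_const_mul _), ?_⟩
    ext x
    simp only [Set.mem_inter_iff, Set.mem_preimage, SetLike.mem_coe, MonoidHom.mem_ker,
      Set.mem_singleton_iff] at hy ⊢
    constructor
    · rintro ⟨h1, h2⟩
      have h3 := hU h1 (by rw [map_mul, map_inv, hy, h2]; simp)
      rwa [inv_mul_eq_one, eq_comm] at h3
    · rintro rfl
      exact ⟨by simpa using hU1, hy⟩
  have hcov : IsCoveringMap f :=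
    ((hopen.isQuotientMap hcont hsurj).isQuotientCoveringMap_of_isDiscrete_ker_monoidHom
      hdisc).isCoveringMap
  obtain ⟨σ, ⟨hσ1, hσ⟩, -⟩ := hcov.existsUnique_continuousMap_lifts (ContinuousMap.id G) 1 1
    (by simp)
  have h1 : σ ∘ f = id := hcov.eq_of_comp_eq (σ.continuous.comp hcont) continuous_id
    (by rw [← Function.comp_assoc, hσ]; rfl) 1 (by simp [hσ1])
  exact Function.LeftInverse.injective (congrFun h1)

end Covering

/-! ### The adjoint action of a one-parameter subgroup -/

section AdjointAction

open Filter Topology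

variable {E : Type*} [NormedAddCommGroup E] [NormedSpace ℝ E] [FiniteDimensional ℝ E]
  [CompleteSpace E]
  {G : Type*} [Group G] [TopologicalSpace G] [ChartedSpace E G] [LieGroup 𝓘(ℝ, E) ∞ G]
  {γ δ : ℝ → G} {z w : E}

omit [FiniteDimensional ℝ E] [CompleteSpace E] in
lemma adj_one : adj E (1 : G) = ContinuousLinearMap.id ℝ E := by
  refine (hasFDerivAt_conj (E := E) (1 : G)).unique ?_
  refine (hasFDerivAt_id _).congr_of_eventuallyEq ?_
  filter_upwards [(chartOne E G).open_target.mem_nhds coordOne_mem] with x hx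
  simp [(chartOne E G).right_inv hx]

lemma IsOneParameterSubgroup.hasDerivAt_adj (h : IsOneParameterSubgroup γ z) (b : E) (s : ℝ) :
    HasDerivAt (fun s => adj E (γ s) b) (adj E (γ s) (bracketOne E G z b)) s := by
  have h1 : HasDerivAt (fun t => adj E (γ (t - s)) b) (bracketOne E G z b) s :=
    HasDerivAt.comp_sub_const (f := fun t => adj E (γ t) b) s s (by
      rw [sub_self]
      exact LeftInvariantFinsler.hasDerivAt_adj h.map_zero h.continuous.continuousAt
        h.hasDerivAt_chartOne b)
  refine ((adj E (γ s)).hasFDerivAt.comp_hasDerivAt s h1).congr_of_eventuallyEq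
    (Eventually.of_forall fun t => ?_)
  simp only [Function.comp]
  rw [← ContinuousLinearMap.comp_apply, ← adj_mul, ← h.map_add, add_sub_cancel]

/-- If `[z, w] = 0`, then `Ad` of the subgroup of `z` fixes `w`, and conjugation by its elements
fixes the subgroup of `w`. -/
lemma IsOneParameterSubgroup.commute (hγ : IsOneParameterSubgroup γ z)
    (hδ : IsOneParameterSubgroup δ w) (h : bracketOne E G z w = 0) (s t : ℝ) :
    γ s * δ t = δ t * γ s := by
  have h1 : ∀ s, HasDerivAt (fun s => adj E (γ s) w) 0 s := fun s => by
    simpa [h] using hγ.hasDerivAt_adj w s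
  have h2 := is_const_of_deriv_eq_zero (fun s => (h1 s).differentiableAt) (fun s => (h1 s).deriv)
    s 0
  rw [hγ.map_zero, adj_one] at h2
  have h3 := hδ.conj (γ s)
  rw [h2] at h3
  have h4 := congrFun (h3.unique hδ) t
  exact mul_inv_eq_iff_eq_mul.1 h4

omit [FiniteDimensional ℝ E] [CompleteSpace E] in
lemma hasDerivAt_exp_smul_mulVec (A : Matrix (Fin 2) (Fin 2) ℝ) (w : Fin 2 → ℝ) (s : ℝ) :
    HasDerivAt (fun s : ℝ => NormedSpace.exp (s • A) *ᵥ w)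
      (A *ᵥ (NormedSpace.exp (s • A) *ᵥ w)) s := by
  -- the exponential depends only on the topology, so any normed algebra structure will do
  let _ : NormedRing (Matrix (Fin 2) (Fin 2) ℝ) := Matrix.linftyOpNormedRing
  let _ : NormedAlgebra ℝ (Matrix (Fin 2) (Fin 2) ℝ) := Matrix.linftyOpNormedAlgebra
  have h := hasDerivAt_exp_smul_const' (𝕂 := ℝ) A s
  have h2 := (LinearMap.toContinuousLinearMap
    ((Matrix.mulVecBilin ℝ ℝ).flip w :
      Matrix (Fin 2) (Fin 2) ℝ →ₗ[ℝ] (Fin 2 → ℝ))).hasFDerivAt.comp_hasDerivAt s h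
  refine h2.congr_deriv ?_
  exact (Matrix.mulVec_mulVec w A (NormedSpace.exp (s • A))).symm

/-- The linear combination of two vectors with given coefficients. -/
def planeMap (e : Fin 2 → E) (w : Fin 2 → ℝ) : E := w 0 • e 0 + w 1 • e 1

/-- If `ad z` acts on the span of `e 0` and `e 1` by the matrix `A`, then the adjoint action of the
one-parameter subgroup of `z` is given there by `exp(sA)`. -/
lemma IsOneParameterSubgroup.adj_planeMap (h : IsOneParameterSubgroup γ z) {e : Fin 2 → E}
    {A : Matrix (Fin 2) (Fin 2) ℝ}
    (hA : ∀ w, bracketOne E G z (planeMap e w) = planeMap e (A *ᵥ w)) (s : ℝ) (w : Fin 2 → ℝ) :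
    adj E (γ s) (planeMap e w) = planeMap e (NormedSpace.exp (s • A) *ᵥ w) := by
  -- the curve `Ad(γ s) exp(-sA)` is constant
  have key : ∀ w, adj E (γ s) (planeMap e (NormedSpace.exp (s • -A) *ᵥ w)) = planeMap e w := by
    intro w
    have h1 : ∀ s, HasDerivAt
        (fun s => adj E (γ s) (planeMap e (NormedSpace.exp (s • -A) *ᵥ w))) 0 s := by
      intro s
      have hM := hasDerivAt_pi.1 (hasDerivAt_exp_smul_mulVec (-A) w s)
      have h2 := ((hM 0).smul (h.hasDerivAt_adj (e 0) s)).add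
        ((hM 1).smul (h.hasDerivAt_adj (e 1) s))
      have hf : (fun s => adj E (γ s) (planeMap e (NormedSpace.exp (s • -A) *ᵥ w))) =
          fun s => (NormedSpace.exp (s • -A) *ᵥ w) 0 • adj E (γ s) (e 0) +
            (NormedSpace.exp (s • -A) *ᵥ w) 1 • adj E (γ s) (e 1) := by
        ext s
        simp [planeMap]
      rw [hf]
      refine h2.congr_deriv ?_
      generalize NormedSpace.exp (s • -A) *ᵥ w = v
      have h3 := congrArg (adj E (γ s)) (hA v)
      rw [planeMap, planeMap, _root_.map_add, map_smul, map_smul, _root_.map_add, map_smul,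
        map_smul, _root_.map_add, map_smul, map_smul] at h3
      simp only [Matrix.neg_mulVec, Pi.neg_apply]
      rw [add_add_add_comm, h3]
      module
    have h2 := is_const_of_deriv_eq_zero (fun s => (h1 s).differentiableAt)
      (fun s => (h1 s).deriv) s 0
    rw [h2, h.map_zero, adj_one]
    simp
  have h1 := key (NormedSpace.exp (s • A) *ᵥ w)
  have h2 : NormedSpace.exp (s • -A) * NormedSpace.exp (s • A) = 1 := by
    rw [smul_neg, ← neg_smul, ← SemidirectPlane.exp_add_smul, neg_add_cancel, zero_smul,
      NormedSpace.exp_zero]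
  rwa [Matrix.mulVec_mulVec, h2, Matrix.one_mulVec] at h1

end AdjointAction

/-! ### Homomorphisms with invertible derivative -/

section InvertibleDerivative

open Filter Topology

variable {E : Type*} [NormedAddCommGroup E] [NormedSpace ℝ E]
  {G : Type*} [Group G] [TopologicalSpace G] [ChartedSpace E G] [LieGroup 𝓘(ℝ, E) ∞ G]
  {E' : Type*} [NormedAddCommGroup E'] [NormedSpace ℝ E'] [CompleteSpace E']
  {H : Type*} [Group H] [TopologicalSpace H] [ChartedSpace E' H] [LieGroup 𝓘(ℝ, E') ∞ H]

/-- A smooth homomorphism onto a simply connected Lie group, from a connected one, whose derivative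
at `1` is invertible, is an isomorphism of Lie groups. -/
lemma lieGroupIsomorphic_of_hasFDerivAt [ConnectedSpace H] [SimplyConnectedSpace G] {f : H →* G}
    (hf : ContMDiff 𝓘(ℝ, E') 𝓘(ℝ, E) ∞ f) {L : E' ≃L[ℝ] E}
    (hL : HasFDerivAt (fun x => chartOne E G (f ((chartOne E' H).symm x))) (L : E' →L[ℝ] E)
      (coordOne E' H)) : LieGroupIsomorphic E E' G H := by
  have := topologicalGroup_of_lieGroup 𝓘(ℝ, E) ∞ (G := G)
  have := topologicalGroup_of_lieGroup 𝓘(ℝ, E') ∞ (G := H)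
  have := ChartedSpace.locallyPathConnectedSpace E G
  set F : E' → E := fun x => chartOne E G (f ((chartOne E' H).symm x)) with hF
  have hF1 : F (coordOne E' H) = coordOne E G := by
    simp only [hF, chartOne_symm_coordOne, map_one]; rfl
  have hsrc : ∀ᶠ h in 𝓝 (1 : H), f h ∈ (chartOne E G).source :=
    hf.continuous.continuousAt.eventually_mem ((chartOne E G).open_source.mem_nhds
      (by rw [map_one]; exact mem_chartOne_source))
  have hFd : ContDiffAt ℝ ∞ F (coordOne E' H) := by
    rw [← contMDiffAt_iff_contDiffAt]
    refine ContMDiffAt.comp (coordOne E' H) (contMDiffAt_chartOne ?_)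
      (hf.contMDiffAt.comp (coordOne E' H) (contMDiffAt_chartOne_symm coordOne_mem))
    rw [chartOne_symm_coordOne, map_one]; exact mem_chartOne_source
  have hn : (∞ : WithTop ℕ∞) ≠ 0 := by simp
  let e := hFd.toOpenPartialHomeomorph F hL hn
  have hesrc : coordOne E' H ∈ e.source := hFd.mem_toOpenPartialHomeomorph_source hL hn
  -- the homomorphism in terms of `F`
  have hfF : ∀ᶠ h in 𝓝 (1 : H), h ∈ (chartOne E' H).source ∧ chartOne E' H h ∈ e.source ∧
      f h ∈ (chartOne E G).source ∧ chartOne E G (f h) = F (chartOne E' H h) := by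
    have h1 : ContinuousAt (chartOne E' H) (1 : H) :=
      (chartOne E' H).continuousAt mem_chartOne_source
    filter_upwards [(chartOne E' H).open_source.mem_nhds mem_chartOne_source,
      h1.eventually_mem (e.open_source.mem_nhds hesrc), hsrc] with h h2 h3 h4
    exact ⟨h2, h3, h4, by simp only [hF, (chartOne E' H).left_inv h2]⟩
  have hmap : map f (𝓝 1) = 𝓝 1 := by
    have h1 : f =ᶠ[𝓝 1] (chartOne E G).symm ∘ F ∘ chartOne E' H := by
      filter_upwards [hfF] with h ⟨_, _, h1, h2⟩
      simp only [Function.comp, ← h2, (chartOne E G).left_inv h1]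
    rw [map_congr h1, ← Filter.map_map, ← Filter.map_map,
      (chartOne E' H).map_nhds_eq mem_chartOne_source]
    rw [show chartOne E' H 1 = coordOne E' H from rfl,
      (hFd.hasStrictFDerivAt' hL hn).map_nhds_eq_of_equiv, hF1]
    exact (chartOne E G).symm_map_nhds_eq mem_chartOne_source
  have hinj : ∀ᶠ h in 𝓝 (1 : H), f h = 1 → h = 1 := by
    filter_upwards [hfF] with h ⟨h1, h2, _, h3⟩ h4
    refine (chartOne E' H).injOn h1 mem_chartOne_source (e.injOn h2 hesrc ?_)
    refine h3.symm.trans ?_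
    rw [h4]
    exact hF1.symm
  let Φ := MulEquiv.ofBijective f (bijective_of_map_nhds_one f hmap hinj)
  have hΦ : ∀ h, Φ h = f h := fun h => rfl
  refine ⟨Φ.symm, ?_, hf⟩
  -- near `1`, the inverse is given by the inverse function theorem
  have h1 : ContMDiffAt 𝓘(ℝ, E) 𝓘(ℝ, E') ∞ Φ.symm 1 := by
    have h2 : ContDiffAt ℝ ∞ e.symm (coordOne E G) := by
      rw [← hF1]; exact hFd.to_localInverse hL hn
    have h3 : e.symm (coordOne E G) = coordOne E' H := by
      rw [← hF1]; exact e.left_inv hesrc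
    have h4 : ContMDiffAt 𝓘(ℝ, E) 𝓘(ℝ, E') ∞
        (fun q => (chartOne E' H).symm (e.symm (chartOne E G q))) 1 := by
      refine ContMDiffAt.comp (1 : G) (contMDiffAt_chartOne_symm ?_)
        (ContMDiffAt.comp (1 : G) h2.contMDiffAt (contMDiffAt_chartOne mem_chartOne_source))
      rw [show chartOne E G 1 = coordOne E G from rfl, h3]
      exact coordOne_mem
    refine h4.congr_of_eventuallyEq ?_
    have h5 : Tendsto Φ.symm (𝓝 1) (𝓝 1) := by
      rw [← hmap, tendsto_map'_iff]
      exact tendsto_id.congr fun h => (Φ.symm_apply_apply h).symm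
    filter_upwards [h5.eventually hfF] with q ⟨h6, h7, _, h8⟩
    rw [← hΦ, Φ.apply_symm_apply] at h8
    rw [h8]
    exact ((congrArg _ (e.left_inv h7)).trans ((chartOne E' H).left_inv h6)).symm
  -- elsewhere, translate
  intro a
  have h2 : ContMDiffAt 𝓘(ℝ, E) 𝓘(ℝ, E') ∞ (fun q => Φ.symm (a⁻¹ * q)) a :=
    ContMDiffAt.comp a (by rw [inv_mul_cancel]; exact h1)
      (contMDiff_mul_left (a := a⁻¹)).contMDiffAt
  refine ((contMDiff_mul_left (a := Φ.symm a)).contMDiffAt.comp a h2).congr_of_eventuallyEq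
    (Eventually.of_forall fun q => ?_)
  simp only [Function.comp]
  rw [← map_mul, mul_inv_cancel_left]

end InvertibleDerivative

/-! ### The semidirect products as Lie groups -/

namespace SemidirectPlane

variable (A : Matrix (Fin 2) (Fin 2) ℝ)

instance : ConnectedSpace (SemidirectPlane A) :=
  inferInstanceAs (ConnectedSpace ((Fin 2 → ℝ) × ℝ))

instance : IsManifold 𝓘(ℝ, (Fin 2 → ℝ) × ℝ) ∞ (SemidirectPlane A) :=
  inferInstanceAs (IsManifold 𝓘(ℝ, (Fin 2 → ℝ) × ℝ) ∞ ((Fin 2 → ℝ) × ℝ))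

/-- `(w, s) ↦ exp(sA) w` is smooth: it is linear in `w`, and solves a linear differential equation
in `s`. -/
lemma contDiff_exp_smul_mulVec :
    ContDiff ℝ ∞ (fun p : (Fin 2 → ℝ) × ℝ => NormedSpace.exp (p.2 • A) *ᵥ p.1) := by
  have h1 : ∀ w : Fin 2 → ℝ, ContDiff ℝ ∞ (fun s : ℝ => NormedSpace.exp (s • A) *ᵥ w) := by
    intro w
    rw [← contDiffOn_univ]
    exact contDiffOn_of_hasDerivAt (f := fun v => A *ᵥ v) (U := Set.univ)
      (LinearMap.toContinuousLinearMap (Matrix.mulVecLin A)).contDiff.contDiffOn isOpen_univ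
      (fun _ _ => Set.mem_univ _) fun s _ => hasDerivAt_exp_smul_mulVec A w s
  have h2 : (fun p : (Fin 2 → ℝ) × ℝ => NormedSpace.exp (p.2 • A) *ᵥ p.1) = fun p =>
      p.1 0 • (NormedSpace.exp (p.2 • A) *ᵥ ![1, 0]) +
        p.1 1 • (NormedSpace.exp (p.2 • A) *ᵥ ![0, 1]) := by
    ext p i
    fin_cases i <;> simp [Matrix.mulVec, dotProduct, Fin.sum_univ_two] <;> ring
  rw [h2]
  exact (((contDiff_apply ℝ ℝ (0 : Fin 2)).comp contDiff_fst).smul ((h1 _).comp contDiff_snd)).add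
    (((contDiff_apply ℝ ℝ (1 : Fin 2)).comp contDiff_fst).smul ((h1 _).comp contDiff_snd))

lemma mul_def (p q : SemidirectPlane A) :
    p * q = (p.1 + NormedSpace.exp (p.2 • A) *ᵥ q.1, p.2 + q.2) := rfl

instance : LieGroup 𝓘(ℝ, (Fin 2 → ℝ) × ℝ) ∞ (SemidirectPlane A) where
  contMDiff_mul := by
    have h : ContDiff ℝ ∞ (fun p : ((Fin 2 → ℝ) × ℝ) × ((Fin 2 → ℝ) × ℝ) =>
        (p.1.1 + NormedSpace.exp (p.1.2 • A) *ᵥ p.2.1, p.1.2 + p.2.2)) :=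
      ((contDiff_fst.comp contDiff_fst).add ((contDiff_exp_smul_mulVec A).comp
        ((contDiff_fst.comp contDiff_snd).prodMk (contDiff_snd.comp contDiff_fst)))).prodMk
        ((contDiff_snd.comp contDiff_fst).add (contDiff_snd.comp contDiff_snd))
    have h1 := h.contMDiff
    rw [modelWithCornersSelf_prod, ← chartedSpaceSelf_prod] at h1
    exact h1
  contMDiff_inv := by
    have h : ContDiff ℝ ∞ (fun p : (Fin 2 → ℝ) × ℝ =>
        (-(NormedSpace.exp ((-p.2) • A) *ᵥ p.1), -p.2)) :=
      ((contDiff_exp_smul_mulVec A).comp (contDiff_fst.prodMk contDiff_snd.neg)).neg.prodMk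
        contDiff_snd.neg
    exact h.contMDiff

end SemidirectPlane

/-! ### Simply connected groups with a given Lie algebra -/

section Integration

open Filter Topology

variable {E : Type*} [NormedAddCommGroup E] [NormedSpace ℝ E] [FiniteDimensional ℝ E]
  {G : Type*} [Group G] [TopologicalSpace G] [ChartedSpace E G] [LieGroup 𝓘(ℝ, E) ∞ G]
  {A : Matrix (Fin 2) (Fin 2) ℝ} {e : Fin 2 → E} {z : E}

omit [LieGroup 𝓘(ℝ, E) ∞ G] [FiniteDimensional ℝ E] [Group G] in
lemma contMDiff_comp_contDiff {E' : Type*} [NormedAddCommGroup E'] [NormedSpace ℝ E'] {γ : ℝ → G}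
    (hγ : ContMDiff 𝓘(ℝ, ℝ) 𝓘(ℝ, E) ∞ γ) {f : E' → ℝ} (hf : ContDiff ℝ ∞ f) :
    ContMDiff 𝓘(ℝ, E') 𝓘(ℝ, E) ∞ (fun x => γ (f x)) :=
  hγ.comp hf.contMDiff

/-- If `ad z` acts on the span of two commuting vectors `e 0` and `e 1` by the matrix `A`, then
`exp(u₀ e₀) exp(u₁ e₁) exp(s z)` is a homomorphism of the semidirect product to `G`. -/
lemma exists_hom_of_bracketOne [CompleteSpace E] (h01 : bracketOne E G (e 0) (e 1) = 0)
    (hA : ∀ w, bracketOne E G z (planeMap e w) = planeMap e (A *ᵥ w)) :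
    ∃ f : SemidirectPlane A →* G, ContMDiff 𝓘(ℝ, (Fin 2 → ℝ) × ℝ) 𝓘(ℝ, E) ∞ f ∧
      ∀ L : (Fin 2 → ℝ) × ℝ →L[ℝ] E, (∀ p, L p = planeMap e p.1 + p.2 • z) →
        HasFDerivAt (fun p : (Fin 2 → ℝ) × ℝ => chartOne E G (f p)) L 0 := by
  obtain ⟨γ₀, h₀⟩ := exists_isOneParameterSubgroup (G := G) (e 0)
  obtain ⟨γ₁, h₁⟩ := exists_isOneParameterSubgroup (G := G) (e 1)
  obtain ⟨γ₂, h₂⟩ := exists_isOneParameterSubgroup (G := G) z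
  have hcomm := h₀.commute h₁ h01
  let pl : (Fin 2 → ℝ) → G := fun w => γ₀ (w 0) * γ₁ (w 1)
  have hpl : ∀ w, IsOneParameterSubgroup (fun t => pl (t • w)) (planeMap e w) := fun w =>
    h₀.mul h₁ hcomm (w 0) (w 1)
  have hpl_add : ∀ v w, pl (v + w) = pl v * pl w := fun v w => by
    simp only [pl, Pi.add_apply, h₀.map_add, h₁.map_add]
    rw [mul_assoc, ← mul_assoc (γ₀ (w 0)), hcomm]
    simp only [mul_assoc]
  -- conjugation by `exp(s z)` is `exp(sA)` on the plane
  have hconj : ∀ s w, γ₂ s * pl w * (γ₂ s)⁻¹ = pl (NormedSpace.exp (s • A) *ᵥ w) := fun s w => by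
    have h3 := (hpl w).conj (γ₂ s)
    rw [h₂.adj_planeMap hA] at h3
    simpa using congrFun (h3.unique (hpl _)) 1
  let f : SemidirectPlane A →* G := MonoidHom.mk' (fun p => pl p.1 * γ₂ p.2) fun p q => by
    rw [SemidirectPlane.mul_def]
    simp only [hpl_add, ← hconj, h₂.map_add]
    group
  have hf : ∀ (w : Fin 2 → ℝ) (s : ℝ), f (w, s) = γ₀ (w 0) * γ₁ (w 1) * γ₂ s := fun _ _ => rfl
  have hsmooth : ContMDiff 𝓘(ℝ, (Fin 2 → ℝ) × ℝ) 𝓘(ℝ, E) ∞ f :=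
    ((contMDiff_comp_contDiff h₀.contMDiff ((contDiff_apply ℝ ℝ (0 : Fin 2)).comp
      contDiff_fst)).mul (contMDiff_comp_contDiff h₁.contMDiff
        ((contDiff_apply ℝ ℝ (1 : Fin 2)).comp contDiff_fst))).mul
      (contMDiff_comp_contDiff h₂.contMDiff contDiff_snd)
  refine ⟨f, hsmooth, fun L hL => ?_⟩
  have h1 : f ((0 : Fin 2 → ℝ), (0 : ℝ)) = 1 := map_one f
  have hd : DifferentiableAt ℝ (fun p : (Fin 2 → ℝ) × ℝ => chartOne E G (f p)) 0 := by
    refine ContDiffAt.differentiableAt (n := ∞) ?_ (by simp)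
    rw [← contMDiffAt_iff_contDiffAt]
    have h2 : ContMDiff 𝓘(ℝ, (Fin 2 → ℝ) × ℝ) 𝓘(ℝ, E) ∞ (fun p : (Fin 2 → ℝ) × ℝ => f p) := hsmooth
    refine ContMDiffAt.comp (g := chartOne E G) (0 : (Fin 2 → ℝ) × ℝ) (contMDiffAt_chartOne ?_)
      h2.contMDiffAt
    rw [show f (0 : (Fin 2 → ℝ) × ℝ) = 1 from h1]
    exact mem_chartOne_source
  -- the derivative is determined by its values along the one-parameter subgroups
  refine hd.hasFDerivAt.congr_fderiv ?_
  set D := fderiv ℝ (fun p : (Fin 2 → ℝ) × ℝ => chartOne E G (f p)) 0 with hD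
  have hcurve : ∀ p : (Fin 2 → ℝ) × ℝ,
      HasDerivAt (fun t : ℝ => chartOne E G (f (t • p))) (D p) 0 := fun p => by
    have h3 : HasDerivAt (fun t : ℝ => t • p) p 0 := by
      simpa using (hasDerivAt_id (0 : ℝ)).smul_const p
    exact HasFDerivAt.comp_hasDerivAt (0 : ℝ) (by rw [zero_smul]; exact hd.hasFDerivAt) h3
  have hD1 : ∀ w, D (w, 0) = planeMap e w := fun w => by
    refine (hcurve (w, 0)).unique ((hpl w).hasDerivAt_chartOne.congr_of_eventuallyEq
      (Eventually.of_forall fun t => ?_))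
    simp only [Prod.smul_mk, smul_zero]
    rw [hf, h₂.map_zero, mul_one]
  have hD2 : D (0, 1) = z := by
    refine (hcurve (0, 1)).unique (h₂.hasDerivAt_chartOne.congr_of_eventuallyEq
      (Eventually.of_forall fun t => ?_))
    simp only [Prod.smul_mk, smul_zero, smul_eq_mul, mul_one]
    rw [hf]
    simp [h₀.map_zero, h₁.map_zero]
  refine ContinuousLinearMap.ext fun ⟨w, s⟩ => ?_
  have h3 : ((w, s) : (Fin 2 → ℝ) × ℝ) = (w, 0) + s • (0, 1) := by simp
  rw [hL]
  conv_lhs => rw [h3]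
  rw [map_add, map_smul, hD1, hD2]

/-- A simply connected Lie group is a semidirect product if its Lie algebra has a basis with
`[b₀, b₁] = 0` for which `ad b₂` preserves the span of `b₀` and `b₁`. The columns of the matrix are
the coefficients of `[b₂, b₀]` and `[b₂, b₁]`. -/
lemma lieGroupIsomorphic_semidirectPlane [SimplyConnectedSpace G] (b : Module.Basis (Fin 3) ℝ E)
    {p q r s : ℝ} (h01 : bracketOne E G (b 0) (b 1) = 0)
    (h02 : bracketOne E G (b 0) (b 2) = p • b 0 + q • b 1)
    (h12 : bracketOne E G (b 1) (b 2) = r • b 0 + s • b 1) :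
    LieGroupIsomorphic E ((Fin 2 → ℝ) × ℝ) G (SemidirectPlane !![-p, -r; -q, -s]) := by
  have hE : CompleteSpace E := FiniteDimensional.complete ℝ E
  obtain ⟨f, hf, hfd⟩ := exists_hom_of_bracketOne (e := ![b 0, b 1]) (z := b 2)
    (A := !![-p, -r; -q, -s]) (by simpa using h01) (fun w => by
      have h1 := bracketOne_skew (G := G) (b 2) (b 0)
      have h2 := bracketOne_skew (G := G) (b 2) (b 1)
      rw [h02] at h1
      rw [h12] at h2
      simp only [planeMap, Matrix.cons_val_zero, Matrix.cons_val_one]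
      rw [map_add, map_smul, map_smul, h1, h2]
      simp [Matrix.mulVec, dotProduct, Fin.sum_univ_two]
      module)
  let L : (Fin 2 → ℝ) × ℝ →ₗ[ℝ] E :=
    { toFun := fun x => x.1 0 • b 0 + x.1 1 • b 1 + x.2 • b 2
      map_add' := fun x y => by simp; module
      map_smul' := fun c x => by simp [mul_smul] }
  have hL : LinearMap.ker L = ⊥ := by
    rw [LinearMap.ker_eq_bot']
    rintro ⟨w, t⟩ h
    have h1 := (Fintype.linearIndependent_iff.1 b.linearIndependent) ![w 0, w 1, t]
      (by simpa [Fin.sum_univ_three] using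
        show w 0 • b 0 + w 1 • b 1 + t • b 2 = 0 from h)
    refine Prod.ext (funext fun i => ?_) (h1 2)
    fin_cases i
    exacts [h1 0, h1 1]
  let Le : ((Fin 2 → ℝ) × ℝ) ≃L[ℝ] E := (LinearEquiv.ofInjectiveOfFinrankEq L
    (LinearMap.ker_eq_bot.1 hL)
    (by rw [Module.finrank_eq_card_basis b]; simp)).toContinuousLinearEquiv
  exact lieGroupIsomorphic_of_hasFDerivAt hf (L := Le) (hfd Le fun x => rfl)

end Integration

section Recognition

variable {G : Type*} [Group G] [TopologicalSpace G] [ChartedSpace (EuclideanSpace ℝ (Fin 3)) G]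
  [LieGroup (𝓡 3) ∞ G] [SimplyConnectedSpace G] {g : RiemMetric (EuclideanSpace ℝ (Fin 3)) G}

lemma HasBasis.lieGroupIsomorphic {a b c d : ℝ} {Q : Matrix (Fin 3) (Fin 3) ℝ}
    (h : HasBasis g a b c d Q) {A : Matrix (Fin 2) (Fin 2) ℝ} (hA : !![-a, -c; -b, -d] = A) :
    LieGroupIsomorphic (EuclideanSpace ℝ (Fin 3)) ((Fin 2 → ℝ) × ℝ) G (SemidirectPlane A) := by
  subst hA
  obtain ⟨e, h1, h2, h3, -⟩ := h.exists_bracketOne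
  exact lieGroupIsomorphic_semidirectPlane e h1 h2 h3

lemma HasBasis.isomorphicToVectorGroup {Q : Matrix (Fin 3) (Fin 3) ℝ}
    (h : HasBasis g 0 0 0 0 Q) : IsomorphicToVectorGroup (EuclideanSpace ℝ (Fin 3))
      (EuclideanSpace ℝ (Fin 3)) G := by
  obtain ⟨Φ, hΦ, hΦ'⟩ := h.lieGroupIsomorphic (A := 0) (by
    ext i j; fin_cases i <;> fin_cases j <;> simp)
  -- for `A = 0` the product is the addition of the vector space `ℝ² × ℝ`
  let T : ((Fin 2 → ℝ) × ℝ) ≃L[ℝ] EuclideanSpace ℝ (Fin 3) :=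
    ContinuousLinearEquiv.ofFinrankEq (by simp)
  let Ψ : SemidirectPlane (0 : Matrix (Fin 2) (Fin 2) ℝ) ≃*
      Multiplicative (EuclideanSpace ℝ (Fin 3)) :=
    { toFun := fun p => Multiplicative.ofAdd (T p)
      invFun := fun v => T.symm v.toAdd
      left_inv := fun p => T.symm_apply_apply p
      right_inv := fun v => T.apply_symm_apply v
      map_mul' := fun p q => by
        rw [SemidirectPlane.mul_def, smul_zero, NormedSpace.exp_zero, Matrix.one_mulVec]
        exact congrArg Multiplicative.ofAdd (T.map_add p q) }
  exact ⟨Φ.trans Ψ, T.contDiff.contMDiff.comp hΦ, hΦ'.comp T.symm.contDiff.contMDiff⟩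

end Recognition

/-! ### The classification -/

section Classification

variable {G : Type*} [Group G] [TopologicalSpace G] [ChartedSpace (EuclideanSpace ℝ (Fin 3)) G]
  [LieGroup (𝓡 3) ∞ G] {g : RiemMetric (EuclideanSpace ℝ (Fin 3)) G}

lemma IsParallelVector.isInList [SimplyConnectedSpace G] {X : EuclideanSpace ℝ (Fin 3)}
    (hX : IsParallelVector (G := G) g X) : IsInList g := by
  obtain h | ⟨ν, hν, h⟩ | ⟨ν, hν, h⟩ := hX.hasBasis
  · exact Or.inl ⟨h.isomorphicToVectorGroup, h⟩
  · exact Or.inr (Or.inl ⟨h.lieGroupIsomorphic (by norm_num), ν, hν, h⟩)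
  · exact Or.inr (Or.inr ⟨h.lieGroupIsomorphic (by norm_num), ν, hν, h⟩)

lemma IsInList.exists_isParallelVector (h : IsInList g) : ∃ X, IsParallelVector g X := by
  obtain ⟨-, h⟩ | ⟨-, ν, -, h⟩ | ⟨-, ν, -, h⟩ := h
  · exact h.exists_isParallelVector_of_abelian
  · exact h.exists_isParallelVector_of_rotation
  · exact h.exists_isParallelVector_of_product

end Classification

end LeftInvariantFinsler

end

theorem mainTheorem1 {G : Type*} [Group G] [TopologicalSpace G]
    [ChartedSpace (EuclideanSpace ℝ (Fin 3)) G] [LieGroup (𝓡 3) ∞ G] [SimplyConnectedSpace G]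
    (g : LeftInvariantFinsler.RiemMetric (EuclideanSpace ℝ (Fin 3)) G)
    (hg : LeftInvariantFinsler.IsLeftInvariantRiem g) :
    (LeftInvariantFinsler.AdmitsBerwaldRanders g ↔ LeftInvariantFinsler.IsInList g) ∧
      (LeftInvariantFinsler.AdmitsBerwaldMatsumoto g ↔ LeftInvariantFinsler.IsInList g) := by
  constructor <;> refine ⟨fun h => ?_, fun h => ?_⟩
  · obtain ⟨X, hX⟩ := LeftInvariantFinsler.exists_isParallelVector_of_admitsBerwaldRanders hg h
    exact hX.isInList
  · obtain ⟨X, hX⟩ := h.exists_isParallelVector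
    exact hX.admitsBerwaldRanders hg
  · obtain ⟨X, hX⟩ := LeftInvariantFinsler.exists_isParallelVector_of_admitsBerwaldMatsumoto hg h
    exact hX.isInList
  · obtain ⟨X, hX⟩ := h.exists_isParallelVector
    exact hX.admitsBerwaldMatsumoto hg
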